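/- **Setting.** A Lévy operator on $\mathbb{R}^m$ is an operator $$\mathcal{L}\varphi(x)=\operatorname{Div}(AD\varphi)(x)+\int_{\mathbb{R}^m}\big[\varphi(x+z)-\varphi(x)-\mathbf 1_{|z|<1}D\varphi(x)\cdot z\big]\,d\mu(z),$$ where $A$ is a nonnegative definite matrix and $\mu\ge 0$ is a Borel measure with $\int(1\wedge|z|^2)\,d\mu<\infty$. Its symbol is $\psi(\xi)=\xi\cdot A\xi+\int(1-e^{i\xi\cdot z}+i\xi\cdot z\mathbf 1_{|z|<1})\,d\mu(z)$, its heat kernel $p_t$ is the probability measure with Fourier transform $\int e^{-i\xi\cdot y}\,p_t(dy)=e^{-t\psi(\xi)}$, and $P_t\varphi=p_t*\varphi$. We say that $\mathcal{L}$ satisfies (L1) with $\alpha$ (on $(0,T]$) if for $t\in(0,T]$ the measure $p_t$ has a density $p_t\in C_b^\infty(\mathbb{R}^m)$, and there is $c_0>0$ such that $\int_{\mathbb{R}^m}|Dp_t(y)|\,dy\le c_0t^{-1/\alpha}$ for all $t\in(0,T]$. For $n\in\{0,1,2,\dots\}$, $C_b^n$ is the space of functions with bounded continuous derivatives up to order $n$;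 for noninteger $\gamma>0$, $C_b^\gamma$ is the space of $\varphi\in C_b^{\lfloor\gamma\rfloor}$ such that $D^{\lfloor\gamma\rfloor}\varphi$ is (globally) $\{\gamma\}$-Hölder, where $\{\gamma\}=\gamma-\lfloor\gamma\rfloor$; $[\,\cdot\,]_{\{\gamma\}}$ denotes the Hölder seminorm. **Theorem (More regularity in certain directions).** Let $d=d_1+d_2$ with $d_1,d_2\ge 0$, and write $x=(x_1,x_2)\in\mathbb{R}^d$ with $x_i\in\mathbb{R}^{d_i}$. Let $T>0$, $\beta\in[0,1]$, $1<\alpha_2\le\alpha_1\le 2$. Assume: * $H:[0,T]\times\mathbb{R}^d\times\mathbb{R}^d\to\mathbb{R}$ is continuous, there is $H_0>0$ with $|H(t,x,0)|\le H_0$, and for each $R>0$ there is $L_R>0$ with $|H(t,x,p)-H(t,x,q)|\le L_R|p-q|$, for all $t\in(0,T)$, $x\in\mathbb{R}^d$, $p,q\in B(0,R)$; * for each $R>0$ there is $M_R>0$ with $|H(t,x,p)-H(t,x',p)|\le M_R|x-x'|^\beta$ for all $t\in[0,T]$, $p\in B(0,R)$ and $x,x'\in\mathbb{R}^d$ with $|x-x'|<1$;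 * $u_0:\mathbb{R}^d\to\mathbb{R}$ is bounded and Lipschitz; * $\mathcal{L}^1$ and $\mathcal{L}^2$ are Lévy operators on $\mathbb{R}^{d_1}$ and $\mathbb{R}^{d_2}$ which satisfy (L1) on $(0,T]$ with $\alpha_1$ and $\alpha_2$ respectively. Let $\mathcal{L}=\mathcal{L}^1_{x_1}+\mathcal{L}^2_{x_2}$ (a Lévy operator on $\mathbb{R}^d$), with heat semigroup $P_t$. For $T'\in(0,T]$, a mild solution on $(0,T']$ of $$\partial_tu-\mathcal{L}u-H(t,x,Du)=0,\qquad u(0,\cdot)=u_0,$$ is a function $u\in C((0,T'];C^1_b(\mathbb{R}^d))$ such that $u(t,x)=P_t[u_0](x)+\int_0^tP_{t-s}[H(s,\cdot,Du(s,\cdot))](x)\,ds$ for all $t\in(0,T']$, $x\in\mathbb{R}^d$. Then: (i) There is $T_0\in(0,T]$ such that for every $T'\in(0,T_0]$ there exists a mild solution $u\in C_b((0,T'];C_b^1(\mathbb{R}^d))$ on $(0,T']$. Moreover, for every $T'\in(0,T]$ and every mild solution $u\in C_b((0,T'];C_b^1(\mathbb{R}^d))$ on $(0,T']$: (ii) If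 $\alpha_2+\beta\notin\mathbb{N}$, then $u(t)\in C_b^{\alpha_2+\beta}(\mathbb{R}^d)$ for each $t\in(0,T']$. (iii) If also $\alpha_1+\beta\notin\mathbb{N}$, then for each $t\in(0,T']$ we have $u(t,\cdot,x_2)\in C_b^{\alpha_1+\beta}(\mathbb{R}^{d_1})$ uniformly for $x_2\in\mathbb{R}^{d_2}$: the $C_b^{\alpha_1+\beta}(\mathbb{R}^{d_1})$-norm of $u(t,\cdot,x_2)$ is bounded independently of $x_2$; in particular $\sup_{x_2}\big[D_{x_1}^{\lfloor\alpha_1+\beta\rfloor}u(t,\cdot,x_2)\big]_{\{\alpha_1+\beta\}}<\infty$. -/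

import Mathlib

open Set Filter Topology MeasureTheory
open scoped ContDiff Matrix

noncomputable section

/-! ### Lévy operators, their symbols and heat kernels -/

/-- A Lévy triplet `(A, 0, μ)` on `ℝ^ι`: a nonnegative definite matrix `A` and a Borel measure `μ`
with `∫ (1 ∧ |z|²) dμ(z) < ∞`. -/
structure LevyTriplet (ι : Type) [Fintype ι] where
  /-- the diffusion matrix -/
  A : Matrix ι ι ℝ
  posSemidef : A.PosSemidef
  /-- the Lévy measure -/
  μ : Measure (EuclideanSpace ℝ ι)
  levy : ∫⁻ z, ENNReal.ofReal (min 1 (‖z‖ ^ 2)) ∂μ < ⊤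

namespace LevyTriplet

variable {ι : Type} [Fintype ι]

/-- The Lévy operator of the triplet,
`Div (A Dφ)(x) + ∫ [φ(x+z) - φ(x) - 1_{|z|<1} Dφ(x)·z] dμ(z)`. -/
def op [DecidableEq ι] (L : LevyTriplet ι) (φ : EuclideanSpace ℝ ι → ℝ)
    (x : EuclideanSpace ℝ ι) : ℝ :=
  (∑ i, ∑ j, L.A i j *
      fderiv ℝ (fun y => fderiv ℝ φ y (EuclideanSpace.single j 1)) x (EuclideanSpace.single i 1)) +
    ∫ z, (φ (x + z) - φ x - (if ‖z‖ < 1 then fderiv ℝ φ x z else 0)) ∂L.μ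

/-- The symbol `ψ(ξ) = ξ·Aξ + ∫ (1 - e^{iξ·z} + iξ·z 1_{|z|<1}) dμ(z)`; on the Fourier side the
Lévy operator is multiplication by `-ψ`. -/
def symbol (L : LevyTriplet ι) (ξ : EuclideanSpace ℝ ι) : ℂ :=
  ((ξ.ofLp ⬝ᵥ (L.A *ᵥ ξ.ofLp) : ℝ) : ℂ) +
    ∫ z, (1 - Complex.exp (Complex.I * (inner ℝ ξ z : ℝ)) +
      (if ‖z‖ < 1 then Complex.I * (inner ℝ ξ z : ℝ) else 0)) ∂L.μ

/-- `ν` is a probability measure whose Fourier transform `∫ e^{-iξ·y} dν(y)` is `e^{-tψ(ξ)}`. -/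
def IsHeatMeasure (L : LevyTriplet ι) (t : ℝ) (ν : Measure (EuclideanSpace ℝ ι)) : Prop :=
  IsProbabilityMeasure ν ∧
    ∀ ξ, ∫ y, Complex.exp (-(Complex.I * (inner ℝ ξ y : ℝ))) ∂ν
      = Complex.exp (-((t : ℂ) * L.symbol ξ))

open Classical in
/-- The heat kernel `p_t` of the Lévy operator, as a measure: the probability measure with Fourier
transform `e^{-tψ}` (it is unique, and by the Lévy–Khintchine theorem it exists for all `t ≥ 0`;
the second branch is only there to make the definition total). -/
def heatMeasure (L : LevyTriplet ι) (t : ℝ) : Measure (EuclideanSpace ℝ ι) :=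
  if h : ∃ ν, L.IsHeatMeasure t ν then h.choose else Measure.dirac 0

/-- The heat semigroup `P_t f = p_t * f`. -/
def semigroup (L : LevyTriplet ι) (t : ℝ) (f : EuclideanSpace ℝ ι → ℝ)
    (x : EuclideanSpace ℝ ι) : ℝ :=
  ∫ y, f (x - y) ∂(L.heatMeasure t)

/-- The Lévy operator is nondegenerate of order `α` on `(0, T]`: its heat kernel has a density
`p_t ∈ C_b^∞` with `∫ |D p_t| ≤ c₀ t^{-1/α}` for `t ∈ (0, T]`. -/
def HasOrder (L : LevyTriplet ι) (T α : ℝ) : Prop :=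
  ∃ p : ℝ → EuclideanSpace ℝ ι → ℝ,
    (∀ t ∈ Ioc 0 T, (∀ x, 0 ≤ p t x) ∧
      L.heatMeasure t = volume.withDensity (fun x => ENNReal.ofReal (p t x)) ∧
      ContDiff ℝ ∞ (p t) ∧ ∀ n : ℕ, ∃ C : ℝ, ∀ x, ‖iteratedFDeriv ℝ n (p t) x‖ ≤ C) ∧
    ∃ c₀ > 0, ∀ t ∈ Ioc 0 T,
      ∫⁻ y, ‖fderiv ℝ (p t) y‖ₑ ≤ ENNReal.ofReal (c₀ * t ^ (-(1 / α)))

end LevyTriplet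

/-! ### The product space `ℝ^ι × ℝ^κ` and the operator `ℒ¹_{x₁} + ℒ²_{x₂}` -/

/-- The point `(x₁, x₂)`. -/
def pairPt {ι κ : Type} (x₁ : EuclideanSpace ℝ ι) (x₂ : EuclideanSpace ℝ κ) :
    EuclideanSpace ℝ (ι ⊕ κ) :=
  WithLp.toLp 2 (Sum.elim x₁.ofLp x₂.ofLp)

section Pair

variable {ι κ : Type} [Fintype ι] [Fintype κ]

lemma norm_pairPt_sq (x₁ : EuclideanSpace ℝ ι) (x₂ : EuclideanSpace ℝ κ) :
    ‖pairPt x₁ x₂‖ ^ 2 = ‖x₁‖ ^ 2 + ‖x₂‖ ^ 2 := by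
  simp [EuclideanSpace.norm_sq_eq, pairPt]

lemma norm_pairPt_left (x₁ : EuclideanSpace ℝ ι) :
    ‖pairPt x₁ (0 : EuclideanSpace ℝ κ)‖ = ‖x₁‖ := by
  have h := norm_pairPt_sq x₁ (0 : EuclideanSpace ℝ κ)
  rw [norm_zero] at h
  exact (sq_eq_sq₀ (norm_nonneg _) (norm_nonneg _)).1 (by linarith)

lemma norm_pairPt_right (x₂ : EuclideanSpace ℝ κ) :
    ‖pairPt (0 : EuclideanSpace ℝ ι) x₂‖ = ‖x₂‖ := by
  have h := norm_pairPt_sq (0 : EuclideanSpace ℝ ι) x₂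
  rw [norm_zero] at h
  exact (sq_eq_sq₀ (norm_nonneg _) (norm_nonneg _)).1 (by linarith)

/-- The embedding `x₁ ↦ (x₁, 0)`. -/
def inlL : EuclideanSpace ℝ ι →L[ℝ] EuclideanSpace ℝ (ι ⊕ κ) :=
  LinearMap.toContinuousLinearMap
    { toFun := fun x => pairPt x 0
      map_add' := fun x y => by ext i; cases i <;> simp [pairPt]
      map_smul' := fun c x => by ext i; cases i <;> simp [pairPt] }

/-- The embedding `x₂ ↦ (0, x₂)`. -/
def inrL : EuclideanSpace ℝ κ →L[ℝ] EuclideanSpace ℝ (ι ⊕ κ) :=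
  LinearMap.toContinuousLinearMap
    { toFun := fun x => pairPt 0 x
      map_add' := fun x y => by ext i; cases i <;> simp [pairPt]
      map_smul' := fun c x => by ext i; cases i <;> simp [pairPt] }

@[simp] lemma inlL_apply (x : EuclideanSpace ℝ ι) :
    (inlL x : EuclideanSpace ℝ (ι ⊕ κ)) = pairPt x 0 := rfl

@[simp] lemma inrL_apply (x : EuclideanSpace ℝ κ) :
    (inrL x : EuclideanSpace ℝ (ι ⊕ κ)) = pairPt 0 x := rfl

lemma posSemidef_fromBlocks {A : Matrix ι ι ℝ} {B : Matrix κ κ ℝ} (hA : A.PosSemidef)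
    (hB : B.PosSemidef) : (Matrix.fromBlocks A 0 0 B).PosSemidef := by
  refine Matrix.PosSemidef.of_dotProduct_mulVec_nonneg ?_ ?_
  · exact Matrix.IsHermitian.fromBlocks hA.1 (by simp) hB.1
  · intro x
    have h1 := hA.dotProduct_mulVec_nonneg (x ∘ Sum.inl)
    have h2 := hB.dotProduct_mulVec_nonneg (x ∘ Sum.inr)
    rw [Matrix.fromBlocks_mulVec]
    simp only [Matrix.zero_mulVec, add_zero, zero_add, dotProduct, Fintype.sum_sum_type,
      Sum.elim_inl, Sum.elim_inr]
    simp only [dotProduct] at h1 h2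
    exact add_nonneg h1 h2

/-- The triplet of `ℒ¹_{x₁} + ℒ²_{x₂}`: the matrix is `diag(A₁, A₂)`, and the Lévy measure is
`μ₁ ⊗ δ₀ + δ₀ ⊗ μ₂`. -/
def LevyTriplet.directSum (L₁ : LevyTriplet ι) (L₂ : LevyTriplet κ) : LevyTriplet (ι ⊕ κ) where
  A := Matrix.fromBlocks L₁.A 0 0 L₂.A
  posSemidef := posSemidef_fromBlocks L₁.posSemidef L₂.posSemidef
  μ := L₁.μ.map inlL + L₂.μ.map inrL
  levy := by
    have hm : Measurable fun z : EuclideanSpace ℝ (ι ⊕ κ) =>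
        ENNReal.ofReal (min 1 (‖z‖ ^ 2)) := by fun_prop
    rw [lintegral_add_measure, lintegral_map hm inlL.continuous.measurable,
      lintegral_map hm inrL.continuous.measurable]
    simp only [inlL_apply, inrL_apply, norm_pairPt_left, norm_pairPt_right]
    exact ENNReal.add_lt_top.2 ⟨L₁.levy, L₂.levy⟩

/-- The integrand of a Lévy operator is integrable for bounded `C²` functions. -/
lemma LevyTriplet.integrable_op (L : LevyTriplet ι) {φ : EuclideanSpace ℝ ι → ℝ}
    (hφ : ContDiff ℝ 2 φ) {C : ℝ} (hC : ∀ x, |φ x| ≤ C) (x : EuclideanSpace ℝ ι) :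
    Integrable (fun z => φ (x + z) - φ x - (if ‖z‖ < 1 then fderiv ℝ φ x z else 0)) L.μ := by
  have hd : ContDiff ℝ 1 (fderiv ℝ φ) := hφ.fderiv_right (by norm_num)
  have hcd : Continuous (fderiv ℝ (fderiv ℝ φ)) := hd.continuous_fderiv (by norm_num)
  obtain ⟨K, hK⟩ := (isCompact_closedBall x 1).exists_bound_of_continuousOn
    (f := fderiv ℝ (fderiv ℝ φ)) hcd.continuousOn
  have hC0 : 0 ≤ C := (abs_nonneg _).trans (hC x)
  have hK0 : 0 ≤ K := (norm_nonneg _).trans (hK x (by simp))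
  have hmeas : Measurable
      (fun z => φ (x + z) - φ x - (if ‖z‖ < 1 then fderiv ℝ φ x z else 0)) := by
    have h1 : Measurable fun z => φ (x + z) :=
      (hφ.continuous.comp (continuous_const.add continuous_id)).measurable
    refine (h1.sub_const _).sub (Measurable.ite ?_ (fderiv ℝ φ x).continuous.measurable
      measurable_const)
    exact measurableSet_lt measurable_norm measurable_const
  have hmin : Integrable (fun z : EuclideanSpace ℝ ι => min 1 (‖z‖ ^ 2)) L.μ := by
    refine ⟨by fun_prop, ?_⟩
    rw [hasFiniteIntegral_iff_ofReal (Eventually.of_forall fun z => by positivity)]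
    exact L.levy
  refine (hmin.const_mul (2 * C + K)).mono' hmeas.aestronglyMeasurable
    (Eventually.of_forall fun z => ?_)
  by_cases hz : ‖z‖ < 1
  · rw [if_pos hz, min_eq_right (by nlinarith [norm_nonneg z])]
    have hball : ∀ y ∈ Metric.closedBall x ‖z‖, y ∈ Metric.closedBall x 1 :=
      fun y hy => Metric.closedBall_subset_closedBall hz.le hy
    have hfd : ∀ y ∈ Metric.closedBall x ‖z‖, ‖fderiv ℝ φ y - fderiv ℝ φ x‖ ≤ K * ‖z‖ := by
      intro y hy
      have := (convex_closedBall x 1).norm_image_sub_le_of_norm_fderiv_le (𝕜 := ℝ)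
        (fun w _ => (hd.differentiable (by norm_num)).differentiableAt)
        (fun w hw => hK w hw) (Metric.mem_closedBall_self zero_le_one) (hball y hy)
      refine this.trans (mul_le_mul_of_nonneg_left ?_ hK0)
      simpa [dist_eq_norm] using hy
    have := (convex_closedBall x ‖z‖).norm_image_sub_le_of_norm_fderiv_le' (𝕜 := ℝ) (f := φ)
      (φ := fderiv ℝ φ x) (C := K * ‖z‖) (x := x) (y := x + z)
      (fun w _ => (hφ.differentiable (by norm_num)).differentiableAt) hfd
      (Metric.mem_closedBall_self (norm_nonneg _)) (by simp)
    rw [add_sub_cancel_left] at this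
    refine this.trans ?_
    nlinarith [sq_nonneg ‖z‖, norm_nonneg z, mul_nonneg hC0 (sq_nonneg ‖z‖)]
  · rw [if_neg hz, min_eq_left (by nlinarith [norm_nonneg z]), sub_zero, mul_one, Real.norm_eq_abs]
    have := abs_sub (φ (x + z)) (φ x)
    linarith [hC (x + z), hC x]

lemma pairPt_eq (x₁ : EuclideanSpace ℝ ι) (x₂ : EuclideanSpace ℝ κ) :
    pairPt x₁ x₂ = inlL x₁ + inrL x₂ := by
  ext i; cases i <;> simp [pairPt]

lemma fderiv_pair_left {φ : EuclideanSpace ℝ (ι ⊕ κ) → ℝ} (h : Differentiable ℝ φ)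
    (x₁ : EuclideanSpace ℝ ι) (x₂ : EuclideanSpace ℝ κ) (v : EuclideanSpace ℝ ι) :
    fderiv ℝ (fun y => φ (pairPt y x₂)) x₁ v = fderiv ℝ φ (pairPt x₁ x₂) (inlL v) := by
  have h1 : HasFDerivAt (fun y : EuclideanSpace ℝ ι => pairPt y x₂)
      (inlL : EuclideanSpace ℝ ι →L[ℝ] EuclideanSpace ℝ (ι ⊕ κ)) x₁ := by
    simp only [pairPt_eq]
    exact (inlL.hasFDerivAt).add_const _
  have := (h (pairPt x₁ x₂)).hasFDerivAt.comp x₁ h1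
  exact congrArg (fun f => f v) this.fderiv

lemma fderiv_pair_right {φ : EuclideanSpace ℝ (ι ⊕ κ) → ℝ} (h : Differentiable ℝ φ)
    (x₁ : EuclideanSpace ℝ ι) (x₂ : EuclideanSpace ℝ κ) (v : EuclideanSpace ℝ κ) :
    fderiv ℝ (fun y => φ (pairPt x₁ y)) x₂ v = fderiv ℝ φ (pairPt x₁ x₂) (inrL v) := by
  have h1 : HasFDerivAt (fun y : EuclideanSpace ℝ κ => pairPt x₁ y)
      (inrL : EuclideanSpace ℝ κ →L[ℝ] EuclideanSpace ℝ (ι ⊕ κ)) x₂ := by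
    simp only [pairPt_eq]
    exact (inrL.hasFDerivAt).const_add _
  have := (h (pairPt x₁ x₂)).hasFDerivAt.comp x₂ h1
  exact congrArg (fun f => f v) this.fderiv

/-- The triplet `L₁.directSum L₂` is the one of `ℒ¹_{x₁} + ℒ²_{x₂}`. -/
lemma LevyTriplet.directSum_op [DecidableEq ι] [DecidableEq κ] (L₁ : LevyTriplet ι)
    (L₂ : LevyTriplet κ) {φ : EuclideanSpace ℝ (ι ⊕ κ) → ℝ} (hφ : ContDiff ℝ 2 φ) {C : ℝ}
    (hC : ∀ x, |φ x| ≤ C) (x₁ : EuclideanSpace ℝ ι) (x₂ : EuclideanSpace ℝ κ) :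
    (L₁.directSum L₂).op φ (pairPt x₁ x₂) =
      L₁.op (fun y => φ (pairPt y x₂)) x₁ + L₂.op (fun y => φ (pairPt x₁ y)) x₂ := by
  have hdiff : Differentiable ℝ φ := hφ.differentiable (by norm_num)
  have hd : ∀ v, Differentiable ℝ fun y => fderiv ℝ φ y v := fun v =>
    ((hφ.fderiv_right (m := 1) (by norm_num)).clm_apply contDiff_const).differentiable
      (by norm_num)
  have hinl : ∀ j : ι, (inlL (EuclideanSpace.single j (1 : ℝ)) : EuclideanSpace ℝ (ι ⊕ κ)) =
      EuclideanSpace.single (Sum.inl j) 1 := by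
    intro j; ext i; cases i <;> simp [pairPt]
  have hinr : ∀ j : κ, (inrL (EuclideanSpace.single j (1 : ℝ)) : EuclideanSpace ℝ (ι ⊕ κ)) =
      EuclideanSpace.single (Sum.inr j) 1 := by
    intro j; ext i; cases i <;> simp [pairPt]
  have hs1 : ContDiff ℝ 2 fun y => φ (pairPt y x₂) := by
    simp only [pairPt_eq]
    exact hφ.comp (by fun_prop)
  have hs2 : ContDiff ℝ 2 fun y => φ (pairPt x₁ y) := by
    simp only [pairPt_eq]
    exact hφ.comp (by fun_prop)
  have ht1 : ∀ z, pairPt (x₁ + z) x₂ = pairPt x₁ x₂ + (inlL z : EuclideanSpace ℝ (ι ⊕ κ)) := by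
    intro z; rw [pairPt_eq, pairPt_eq, map_add]; abel
  have ht2 : ∀ z, pairPt x₁ (x₂ + z) = pairPt x₁ x₂ + (inrL z : EuclideanSpace ℝ (ι ⊕ κ)) := by
    intro z; rw [pairPt_eq, pairPt_eq, map_add]; abel
  have hint := (L₁.directSum L₂).integrable_op hφ hC (pairPt x₁ x₂)
  have hint' := integrable_add_measure.1 hint
  have hI : ∫ z, (φ (pairPt x₁ x₂ + z) - φ (pairPt x₁ x₂) -
        (if ‖z‖ < 1 then fderiv ℝ φ (pairPt x₁ x₂) z else 0)) ∂(L₁.directSum L₂).μ =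
      (∫ z, (φ (pairPt (x₁ + z) x₂) - φ (pairPt x₁ x₂) -
        (if ‖z‖ < 1 then fderiv ℝ (fun y => φ (pairPt y x₂)) x₁ z else 0)) ∂L₁.μ) +
      ∫ z, (φ (pairPt x₁ (x₂ + z)) - φ (pairPt x₁ x₂) -
        (if ‖z‖ < 1 then fderiv ℝ (fun y => φ (pairPt x₁ y)) x₂ z else 0)) ∂L₂.μ := by
    refine (integral_add_measure hint'.1 hint'.2).trans ?_
    rw [integral_map inlL.continuous.aemeasurable hint'.1.1,
      integral_map inrL.continuous.aemeasurable hint'.2.1]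
    congr 1
    · refine integral_congr_ae (Eventually.of_forall fun z => ?_)
      simp only [fderiv_pair_left hdiff, ht1, inlL_apply, norm_pairPt_left]
    · refine integral_congr_ae (Eventually.of_forall fun z => ?_)
      simp only [fderiv_pair_right hdiff, ht2, inrL_apply, norm_pairPt_right]
  unfold LevyTriplet.op
  rw [hI]
  simp only [Fintype.sum_sum_type, LevyTriplet.directSum, Matrix.fromBlocks_apply₁₁,
    Matrix.fromBlocks_apply₁₂, Matrix.fromBlocks_apply₂₁, Matrix.fromBlocks_apply₂₂,
    Matrix.zero_apply, zero_mul, Finset.sum_const_zero, add_zero, zero_add]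
  simp only [fderiv_pair_left hdiff, fderiv_pair_right hdiff, hinl, hinr,
    fderiv_pair_left (hd _), fderiv_pair_right (hd _)]
  ring

end Pair

/-! ### Hölder spaces -/

section Spaces

variable {E : Type*} [NormedAddCommGroup E] [NormedSpace ℝ E]

/-- `f ∈ C_b^n`, with all derivatives up to order `n` bounded by `C`. -/
def CbBound (n : ℕ) (C : ℝ) (f : E → ℝ) : Prop :=
  ContDiff ℝ n f ∧ ∀ j ≤ n, ∀ x, ‖iteratedFDeriv ℝ j f x‖ ≤ C

/-- `f ∈ C_b^γ` with bound `C`: the derivatives up to order `⌊γ⌋` are bounded by `C` and the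
Hölder seminorm of exponent `{γ} = γ - ⌊γ⌋` of the derivative of order `⌊γ⌋` is at most `C`. -/
def HolderBound (γ : ℝ) (C : ℝ) (f : E → ℝ) : Prop :=
  CbBound ⌊γ⌋₊ C f ∧
    ∀ x y, ‖iteratedFDeriv ℝ ⌊γ⌋₊ f x - iteratedFDeriv ℝ ⌊γ⌋₊ f y‖ ≤ C * ‖x - y‖ ^ Int.fract γ

/-- `f ∈ C_b^γ`. -/
def MemCbHolder (γ : ℝ) (f : E → ℝ) : Prop := ∃ C : ℝ, HolderBound γ C f

/-- `u ∈ C((0,T]; C_b^1)`. -/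
def MemCC1 (T : ℝ) (u : ℝ → E → ℝ) : Prop :=
  (∀ t ∈ Ioc 0 T, ∃ C : ℝ, CbBound 1 C (u t)) ∧
    ∀ t ∈ Ioc 0 T, ∀ ε > 0, ∀ᶠ s in 𝓝[Ioc 0 T] t, CbBound 1 ε (fun x => u s x - u t x)

/-- `u ∈ C_b((0,T]; C_b^1)`. -/
def MemCbC1 (T : ℝ) (u : ℝ → E → ℝ) : Prop :=
  MemCC1 T u ∧ ∃ C : ℝ, ∀ t ∈ Ioc 0 T, CbBound 1 C (u t)

end Spaces

/-! ### The equation `∂ₜu - ℒu - H(t,x,Du) = 0`, `u(0) = u₀` -/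

section Equation

variable {E : Type*} [NormedAddCommGroup E]

/-- `H` is continuous on `[0,T] × E × E`, `H(t,x,0)` is bounded, and `H` is locally Lipschitz
in `p`, uniformly in `(t,x)`. -/
def HamiltonianLip (T : ℝ) (H : ℝ → E → E → ℝ) : Prop :=
  ContinuousOn (fun q : ℝ × E × E => H q.1 q.2.1 q.2.2) (Icc 0 T ×ˢ univ) ∧
    (∃ H₀ > 0, ∀ t ∈ Ioo 0 T, ∀ x, |H t x 0| ≤ H₀) ∧
    ∀ R > 0, ∃ K > 0, ∀ t ∈ Ioo 0 T, ∀ x, ∀ p ∈ Metric.ball (0 : E) R,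
      ∀ q ∈ Metric.ball (0 : E) R, |H t x p - H t x q| ≤ K * ‖p - q‖

/-- `H` is `β`-Hölder in `x`, locally uniformly in `p` and uniformly in `t`. -/
def HamiltonianHolder (T β : ℝ) (H : ℝ → E → E → ℝ) : Prop :=
  ∀ R > 0, ∃ M > 0, ∀ t ∈ Icc 0 T, ∀ p ∈ Metric.ball (0 : E) R, ∀ x x' : E, ‖x - x'‖ < 1 →
    |H t x p - H t x' p| ≤ M * ‖x - x'‖ ^ β

/-- `u` is a mild solution on `(0,T]`: `u ∈ C((0,T]; C_b^1)` and
`u(t) = P_t u₀ + ∫₀ᵗ P_{t-s}[H(s,·,Du(s,·))] ds` (where the time integral converges). -/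
def IsMildSolution {ι : Type} [Fintype ι] (L : LevyTriplet ι) (T : ℝ)
    (H : ℝ → EuclideanSpace ℝ ι → EuclideanSpace ℝ ι → ℝ) (u₀ : EuclideanSpace ℝ ι → ℝ)
    (u : ℝ → EuclideanSpace ℝ ι → ℝ) : Prop :=
  MemCC1 T u ∧ ∀ t ∈ Ioc 0 T, ∀ x,
    IntervalIntegrable (fun s => L.semigroup (t - s) (fun y => H s y (gradient (u s) y)) x)
      volume 0 t ∧
    u t x = L.semigroup t u₀ x +
      ∫ s in (0 : ℝ)..t, L.semigroup (t - s) (fun y => H s y (gradient (u s) y)) x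

end Equation

end

set_option linter.unusedSectionVars false

/-! ### Heat measures -/

section HeatMeasures

/-! Everything is read off from the formula `Du(t) = D P_t u₀ + ∫₀ᵗ D P_{t-s} g(s) ds` with `g(s,y)
= H(s,y,Du(s,y))`, by counting the powers of `t - s` that each derivative of `P_{t-s} g(s)` costs.

The heat kernel of `ℒ¹ + ℒ²` is the convolution of the two kernels placed on the two axes.
Convolution with one factor is a contraction on bounded continuous functions, so a derivative in
`x₁` costs `t^(-1/α₁)` and one in `x₂` costs `t^(-1/α₂)` (`smooths_of_hasOrder`). As `α₂ ≤ α₁` and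
`t ≤ T`, the full gradient costs a multiple of `t^(-1/α₂)` (`Smooths.id_of_partial`), which is
integrable at `0` because `α₂ > 1`. For short times the formula is therefore a contraction in the
unknown `w = Du` (`exists_fixedPoint`).

For regularity, the formula is compared with its translate by `η`. Since `u₀` is Lipschitz and `H`
is `β`-Hölder in `x` and Lipschitz in `p`, a singular Gronwall inequality (`singular_gronwall`)
bounds the increment of `Du(t)` by `C t^(-1/α₂) |η|^β` for `|η| < 1`. Hence `g(s)` is `β`-Hölder in
all directions, with a constant `C s^(-1/α₂)` that is integrable in time (`exists_holderSource`).

Let such a source now be smoothed with order `α` in the directions of a linear map `J`. The first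
derivative of `P_r g(s)` along `J` costs only `r^(-(1-β)/α)`, each further one `r^(-1/α)`. So `n`
derivatives cost `r^(-(n-β)/α)`, integrable exactly when `n < α + β`. The last integrable derivative
is interpolated against the next one, which gives the Hölder exponent `α + β - n`
(`isDirHolder_of_holderSource`). This argument uses smoothing along `J` only and no mixed
derivatives: with `J = id` and order `α₂` it gives the isotropic regularity, with `J = inlL` and
order `α₁` the better regularity in `x₁`, uniformly in the base point and hence in `x₂`. -/

lemma exists_eq_pairPt {ι κ : Type} (x : EuclideanSpace ℝ (ι ⊕ κ)) : ∃ x₁ x₂, x = pairPt x₁ x₂ :=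
  ⟨WithLp.toLp 2 fun i => x (Sum.inl i), WithLp.toLp 2 fun i => x (Sum.inr i), by
    ext i; cases i <;> rfl⟩

variable {ι κ : Type} [Fintype ι] [Fintype κ]

/-- A semigroup of probability measures on `[0, T]` which is continuous at `0`. -/
structure IsHeatFlow {E : Type*} [NormedAddCommGroup E] [MeasurableSpace E] (T : ℝ)
    (K : ℝ → Measure E) : Prop where
  prob : ∀ t ∈ Icc 0 T, IsProbabilityMeasure (K t)
  conv_eq : ∀ s t, 0 ≤ s → 0 ≤ t → s + t ≤ T → K (s + t) = K s ∗ K t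
  tendsto : Tendsto (fun h => ∫ y, min 1 ‖y‖ ∂(K h)) (𝓝[>] 0) (𝓝 0)

namespace LevyTriplet

lemma IsHeatMeasure.heatMeasure {L : LevyTriplet ι} {t : ℝ} {ν : Measure (EuclideanSpace ℝ ι)}
    (h : L.IsHeatMeasure t ν) : L.IsHeatMeasure t (L.heatMeasure t) := by
  have h' : ∃ ν, L.IsHeatMeasure t ν := ⟨ν, h⟩
  unfold LevyTriplet.heatMeasure
  rw [dif_pos h']
  exact h'.choose_spec

lemma IsHeatMeasure.charFun_eq {L : LevyTriplet ι} {t : ℝ} {ν : Measure (EuclideanSpace ℝ ι)}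
    (h : L.IsHeatMeasure t ν) (ξ : EuclideanSpace ℝ ι) :
    charFun ν ξ = Complex.exp (-((t : ℂ) * L.symbol (-ξ))) := by
  rw [← h.2 (-ξ), charFun_apply]
  refine integral_congr_ae (Eventually.of_forall fun y => ?_)
  simp only [inner_neg_left, real_inner_comm]
  congr 1
  push_cast
  ring

lemma isHeatMeasure_of_charFun {L : LevyTriplet ι} {t : ℝ} {ν : Measure (EuclideanSpace ℝ ι)}
    (hν : IsProbabilityMeasure ν)
    (h : ∀ ξ, charFun ν ξ = Complex.exp (-((t : ℂ) * L.symbol (-ξ)))) : L.IsHeatMeasure t ν := by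
  refine ⟨hν, fun ξ => ?_⟩
  have h1 := h (-ξ)
  rw [neg_neg] at h1
  rw [← h1, charFun_apply]
  refine integral_congr_ae (Eventually.of_forall fun y => ?_)
  simp only [inner_neg_right, real_inner_comm]
  congr 1
  push_cast
  ring

lemma IsHeatMeasure.unique {L : LevyTriplet ι} {t : ℝ} {ν ν' : Measure (EuclideanSpace ℝ ι)}
    (h : L.IsHeatMeasure t ν) (h' : L.IsHeatMeasure t ν') : ν = ν' := by
  have := h.1
  have := h'.1
  refine Measure.ext_of_charFun (funext fun ξ => ?_)
  rw [h.charFun_eq, h'.charFun_eq]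

lemma isHeatMeasure_zero (L : LevyTriplet ι) : L.IsHeatMeasure 0 (Measure.dirac 0) :=
  isHeatMeasure_of_charFun inferInstance fun ξ => by simp

lemma IsHeatMeasure.conv {L : LevyTriplet ι} {s t : ℝ} {ν ν' : Measure (EuclideanSpace ℝ ι)}
    (h : L.IsHeatMeasure s ν) (h' : L.IsHeatMeasure t ν') :
    L.IsHeatMeasure (s + t) (ν ∗ ν') := by
  have := h.1
  have := h'.1
  refine isHeatMeasure_of_charFun inferInstance fun ξ => ?_
  rw [charFun_conv, h.charFun_eq, h'.charFun_eq, ← Complex.exp_add]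
  congr 1
  push_cast
  ring

/-- In dimension zero the only frequency is `0`, where the symbol vanishes. This covers `d₁ = 0` or
`d₂ = 0`. -/
lemma isHeatMeasure_of_subsingleton [IsEmpty ι] (L : LevyTriplet ι) (t : ℝ) :
    L.IsHeatMeasure t (Measure.dirac 0) :=
  isHeatMeasure_of_charFun inferInstance fun ξ => by
    rw [Subsingleton.elim ξ 0]
    simp [symbol, dotProduct]

/-- Existence of the heat kernel follows from the nondegeneracy assumption itself, without the
Lévy–Khintchine theorem: otherwise `heatMeasure` would take its default value `δ₀`, which charges a
point and so has no density in positive dimension. -/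
lemma HasOrder.isHeatMeasure {L : LevyTriplet ι} {T α : ℝ} (h : L.HasOrder T α) {t : ℝ}
    (ht : t ∈ Icc 0 T) : L.IsHeatMeasure t (L.heatMeasure t) := by
  rcases ht.1.eq_or_lt with rfl | h0
  · exact L.isHeatMeasure_zero.heatMeasure
  by_cases hex : ∃ ν, L.IsHeatMeasure t ν
  · exact hex.choose_spec.heatMeasure
  obtain ⟨p, hp, -⟩ := h
  have h1 := (hp t ⟨h0, ht.2⟩).2.1
  rw [heatMeasure, dif_neg hex] at h1
  cases isEmpty_or_nonempty ι
  · exact (L.isHeatMeasure_of_subsingleton t).heatMeasure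
  · have h2 := congrArg (fun ν => ν {(0 : EuclideanSpace ℝ ι)}) h1
    have h3 : (volume.withDensity fun x => ENNReal.ofReal (p t x))
        {(0 : EuclideanSpace ℝ ι)} = 0 :=
      withDensity_absolutelyContinuous _ _ (by simp)
    simp [h3] at h2

/-- For `‖z‖ < 1` the integrand is a second-order Taylor remainder of the exponential; for larger
`z` it is at most `2`. -/
lemma norm_symbol_integrand_le (ξ z : EuclideanSpace ℝ ι) :
    ‖1 - Complex.exp (Complex.I * (inner ℝ ξ z : ℝ)) +
      (if ‖z‖ < 1 then Complex.I * (inner ℝ ξ z : ℝ) else 0)‖ ≤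
      (2 * ‖ξ‖ ^ 2 + 2) * min 1 (‖z‖ ^ 2) := by
  set θ : ℝ := inner ℝ ξ z
  have hθ : |θ| ≤ ‖ξ‖ * ‖z‖ := abs_real_inner_le_norm ξ z
  have hI : ‖Complex.I * (θ : ℂ)‖ = |θ| := by simp
  by_cases hz : ‖z‖ < 1
  · rw [if_pos hz, min_eq_right (by nlinarith [norm_nonneg z])]
    have hsq : θ ^ 2 ≤ ‖ξ‖ ^ 2 * ‖z‖ ^ 2 := by
      rw [← mul_pow, ← sq_abs]
      gcongr
    have key : ‖1 - Complex.exp (Complex.I * θ) + Complex.I * θ‖ ≤ 2 * θ ^ 2 := by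
      have he : 1 - Complex.exp (Complex.I * θ) + Complex.I * θ =
          -(Complex.exp (Complex.I * θ) - 1 - Complex.I * θ) := by ring
      rw [he, norm_neg]
      by_cases h1 : |θ| ≤ 1
      · refine (Complex.norm_exp_sub_one_sub_id_le (by rwa [hI])).trans ?_
        rw [hI, sq_abs]
        nlinarith [sq_nonneg θ]
      · refine (norm_sub_le _ _).trans ?_
        have := Real.norm_exp_I_mul_ofReal_sub_one_le (x := θ)
        rw [hI]
        rw [Real.norm_eq_abs] at this
        rw [← sq_abs]
        nlinarith
    nlinarith [sq_nonneg ‖z‖, sq_nonneg ‖ξ‖]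
  · rw [if_neg hz, min_eq_left (by nlinarith [norm_nonneg z]), add_zero]
    refine (norm_sub_le _ _).trans ?_
    have : ‖Complex.exp (Complex.I * θ)‖ = 1 := by
      rw [mul_comm]; exact Complex.norm_exp_ofReal_mul_I θ
    rw [this, norm_one]
    nlinarith [sq_nonneg ‖ξ‖]

lemma integrable_symbol (L : LevyTriplet ι) (ξ : EuclideanSpace ℝ ι) :
    Integrable (fun z => 1 - Complex.exp (Complex.I * (inner ℝ ξ z : ℝ)) +
      (if ‖z‖ < 1 then Complex.I * (inner ℝ ξ z : ℝ) else 0)) L.μ := by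
  have hmin : Integrable (fun z : EuclideanSpace ℝ ι => min 1 (‖z‖ ^ 2)) L.μ := by
    refine ⟨by fun_prop, ?_⟩
    rw [hasFiniteIntegral_iff_ofReal (Eventually.of_forall fun z => by positivity)]
    exact L.levy
  refine (hmin.const_mul (2 * ‖ξ‖ ^ 2 + 2)).mono' ?_
    (Eventually.of_forall fun z => norm_symbol_integrand_le ξ z)
  refine Measurable.aestronglyMeasurable ?_
  refine Measurable.add (by fun_prop) (Measurable.ite ?_ (by fun_prop) measurable_const)
  exact measurableSet_lt measurable_norm measurable_const

end LevyTriplet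

lemma inner_pairPt (x₁ y₁ : EuclideanSpace ℝ ι) (x₂ y₂ : EuclideanSpace ℝ κ) :
    inner ℝ (pairPt x₁ x₂) (pairPt y₁ y₂) = inner ℝ x₁ y₁ + inner ℝ x₂ y₂ := by
  simp [PiLp.inner_apply, pairPt]

namespace LevyTriplet

/-- The Lévy measure of the sum lives on the two axes, so the integral splits; each half is
integrable because the whole is. -/
lemma symbol_directSum (L₁ : LevyTriplet ι) (L₂ : LevyTriplet κ) (ξ₁ : EuclideanSpace ℝ ι)
    (ξ₂ : EuclideanSpace ℝ κ) :
    (L₁.directSum L₂).symbol (pairPt ξ₁ ξ₂) = L₁.symbol ξ₁ + L₂.symbol ξ₂ := by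
  have hint := integrable_add_measure.1 ((L₁.directSum L₂).integrable_symbol (pairPt ξ₁ ξ₂))
  have hA : (pairPt ξ₁ ξ₂).ofLp ⬝ᵥ ((L₁.directSum L₂).A *ᵥ (pairPt ξ₁ ξ₂).ofLp) =
      ξ₁.ofLp ⬝ᵥ (L₁.A *ᵥ ξ₁.ofLp) + ξ₂.ofLp ⬝ᵥ (L₂.A *ᵥ ξ₂.ofLp) := by
    simp [directSum, pairPt, Matrix.fromBlocks_mulVec, dotProduct, Function.comp_def]
  unfold symbol
  rw [hA]
  have hI := integral_add_measure hint.1 hint.2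
  rw [integral_map inlL.continuous.aemeasurable hint.1.1,
    integral_map inrL.continuous.aemeasurable hint.2.1] at hI
  simp only [inlL_apply, inrL_apply, norm_pairPt_left, norm_pairPt_right, inner_pairPt,
    inner_zero_right, add_zero, zero_add] at hI
  rw [Complex.ofReal_add, add_add_add_comm]
  exact congrArg₂ _ rfl hI

lemma charFun_map_inlL (ν : Measure (EuclideanSpace ℝ ι)) (ξ₁ : EuclideanSpace ℝ ι)
    (ξ₂ : EuclideanSpace ℝ κ) :
    charFun (ν.map (inlL : EuclideanSpace ℝ ι →L[ℝ] EuclideanSpace ℝ (ι ⊕ κ))) (pairPt ξ₁ ξ₂) =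
      charFun ν ξ₁ := by
  rw [charFun_apply, integral_map inlL.continuous.aemeasurable
    (Continuous.aestronglyMeasurable (by fun_prop)), charFun_apply]
  simp [inner_pairPt]

lemma charFun_map_inrL (ν : Measure (EuclideanSpace ℝ κ)) (ξ₁ : EuclideanSpace ℝ ι)
    (ξ₂ : EuclideanSpace ℝ κ) :
    charFun (ν.map (inrL : EuclideanSpace ℝ κ →L[ℝ] EuclideanSpace ℝ (ι ⊕ κ))) (pairPt ξ₁ ξ₂) =
      charFun ν ξ₂ := by
  rw [charFun_apply, integral_map inrL.continuous.aemeasurable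
    (Continuous.aestronglyMeasurable (by fun_prop)), charFun_apply]
  simp [inner_pairPt]

lemma isProbabilityMeasure_map_clm {E F : Type*} [NormedAddCommGroup E] [NormedSpace ℝ E]
    [NormedAddCommGroup F] [NormedSpace ℝ F] [MeasurableSpace E] [MeasurableSpace F]
    [BorelSpace E] [BorelSpace F] (ν : Measure E) [IsProbabilityMeasure ν] (J : E →L[ℝ] F) :
    IsProbabilityMeasure (ν.map J) :=
  Measure.isProbabilityMeasure_map J.continuous.aemeasurable

/-- The exponential of a sum of symbols is the product of the characteristic functions. Writing the
product kernel as a convolution of measures on the axes lets one factor be treated as a mere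
contraction later. -/
lemma IsHeatMeasure.directSum {L₁ : LevyTriplet ι} {L₂ : LevyTriplet κ} {t : ℝ}
    {ν₁ : Measure (EuclideanSpace ℝ ι)} {ν₂ : Measure (EuclideanSpace ℝ κ)}
    (h₁ : L₁.IsHeatMeasure t ν₁) (h₂ : L₂.IsHeatMeasure t ν₂) :
    (L₁.directSum L₂).IsHeatMeasure t
      (ν₁.map (inlL : _ →L[ℝ] EuclideanSpace ℝ (ι ⊕ κ)) ∗
        ν₂.map (inrL : _ →L[ℝ] EuclideanSpace ℝ (ι ⊕ κ))) := by
  have := h₁.1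
  have := h₂.1
  have := isProbabilityMeasure_map_clm ν₁ (inlL : _ →L[ℝ] EuclideanSpace ℝ (ι ⊕ κ))
  have := isProbabilityMeasure_map_clm ν₂ (inrL : _ →L[ℝ] EuclideanSpace ℝ (ι ⊕ κ))
  refine isHeatMeasure_of_charFun inferInstance fun ξ => ?_
  obtain ⟨ξ₁, ξ₂, rfl⟩ := exists_eq_pairPt ξ
  have hneg : -pairPt ξ₁ ξ₂ = pairPt (-ξ₁) (-ξ₂) := by
    ext i; cases i <;> simp [pairPt]
  rw [charFun_conv, charFun_map_inlL, charFun_map_inrL, h₁.charFun_eq, h₂.charFun_eq, hneg,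
    symbol_directSum, ← Complex.exp_add]
  congr 1
  ring

/-- The semigroup law holds because both sides have the same characteristic function. Continuity at
`0` is Lévy's continuity theorem, tested on the bounded continuous function `min 1 ‖y‖`. -/
lemma isHeatFlow_of_isHeatMeasure {L : LevyTriplet ι} {T : ℝ} (hT : 0 < T)
    (h : ∀ t ∈ Icc 0 T, L.IsHeatMeasure t (L.heatMeasure t)) : IsHeatFlow T L.heatMeasure where
  prob t ht := (h t ht).1
  conv_eq s t hs ht hst :=
    (h _ ⟨by positivity, hst⟩).unique
      ((h s ⟨hs, by linarith⟩).conv (h t ⟨ht, by linarith⟩))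
  tendsto := by
    classical
    refine tendsto_of_seq_tendsto fun r hr => ?_
    rw [tendsto_nhdsWithin_iff] at hr
    have hev : ∀ᶠ n in atTop, r n ∈ Icc 0 T := by
      filter_upwards [hr.2, hr.1.eventually (eventually_lt_nhds hT)] with n h1 h2
      exact ⟨le_of_lt h1, h2.le⟩
    -- Outside `[0, T]` the heat measure is not known to be a probability measure, so `δ₀` stands in
    -- there; this concerns only finitely many `n`.
    let ν : ℕ → ProbabilityMeasure (EuclideanSpace ℝ ι) := fun n =>
      ⟨if r n ∈ Icc 0 T then L.heatMeasure (r n) else Measure.dirac 0, by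
        split_ifs with hn
        exacts [(h _ hn).1, inferInstance]⟩
    let ν₀ : ProbabilityMeasure (EuclideanSpace ℝ ι) := ⟨Measure.dirac 0, inferInstance⟩
    have hν : ∀ n, r n ∈ Icc 0 T → (ν n : Measure (EuclideanSpace ℝ ι)) = L.heatMeasure (r n) := by
      intro n hn
      exact if_pos hn
    have hlim : Tendsto ν atTop (𝓝 ν₀) := by
      rw [ProbabilityMeasure.tendsto_iff_tendsto_charFun]
      intro ξ
      have h1 : Tendsto (fun n => Complex.exp (-((r n : ℂ) * L.symbol (-ξ)))) atTop
          (𝓝 (charFun (ν₀ : Measure (EuclideanSpace ℝ ι)) ξ)) := by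
        change Tendsto _ _ (𝓝 (charFun (Measure.dirac (0 : EuclideanSpace ℝ ι)) ξ))
        rw [L.isHeatMeasure_zero.charFun_eq]
        have hc : Continuous fun s : ℝ => Complex.exp (-((s : ℂ) * L.symbol (-ξ))) := by fun_prop
        exact (hc.tendsto 0).comp hr.1
      refine h1.congr' ?_
      filter_upwards [hev] with n hn
      rw [hν n hn, (h _ hn).charFun_eq]
    rw [ProbabilityMeasure.tendsto_iff_forall_integral_tendsto] at hlim
    have h2 := hlim (BoundedContinuousFunction.ofNormedAddCommGroup
      (fun y : EuclideanSpace ℝ ι => min 1 ‖y‖) (by fun_prop) 1 (fun y => by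
        rw [Real.norm_of_nonneg (by positivity)]; exact min_le_left _ _))
    simp only [BoundedContinuousFunction.coe_ofNormedAddCommGroup, ν₀, ProbabilityMeasure.coe_mk] at h2
    rw [integral_dirac] at h2
    simp only [norm_zero, zero_le_one, inf_of_le_right] at h2
    refine h2.congr' ?_
    filter_upwards [hev] with n hn
    rw [hν n hn]
    rfl

end LevyTriplet

end HeatMeasures

/-! ### Convolution with a measure and directional derivatives -/

/-- Bounded continuous functions with bound `M`. -/
def IsBC {E W : Type*} [TopologicalSpace E] [NormedAddCommGroup W] (M : ℝ) (f : E → W) : Prop :=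
  Continuous f ∧ ∀ x, ‖f x‖ ≤ M

/-- The convolution of the measure `ν` with the function `f`. -/
noncomputable def convFun {E W : Type*} [NormedAddCommGroup E] [MeasurableSpace E]
    [NormedAddCommGroup W] [NormedSpace ℝ W] (ν : Measure E) (f : E → W) (x : E) : W :=
  ∫ y, f (x - y) ∂ν

section DirDeriv

variable {E V W : Type*} [NormedAddCommGroup E] [NormedSpace ℝ E]
  [NormedAddCommGroup V] [NormedSpace ℝ V] [NormedAddCommGroup W] [NormedSpace ℝ W]

/-- The derivative of `f` in the directions of the range of `J`. -/
noncomputable def dirFDeriv (J : V →L[ℝ] E) (f : E → W) (x : E) : V →L[ℝ] W :=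
  fderiv ℝ (fun v => f (x + J v)) 0

/-- `f'` is the derivative of `f` in the directions of the range of `J`. -/
def HasDirFDeriv (J : V →L[ℝ] E) (f : E → W) (f' : E → V →L[ℝ] W) : Prop :=
  ∀ x, HasFDerivAt (fun v => f (x + J v)) (f' x) 0

variable {J : V →L[ℝ] E} {f g : E → W} {f' g' : E → V →L[ℝ] W}

lemma HasDirFDeriv.eq (h : HasDirFDeriv J f f') : f' = dirFDeriv J f :=
  funext fun x => (h x).fderiv.symm

lemma HasDirFDeriv.hasFDerivAt (h : HasDirFDeriv J f f') (x : E) (v : V) :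
    HasFDerivAt (fun w => f (x + J w)) (f' (x + J v)) v := by
  have h1 := h (x + J v)
  have h2 : HasFDerivAt (fun w : V => w - v) (ContinuousLinearMap.id ℝ V) v :=
    (hasFDerivAt_id v).sub_const v
  have h3 : HasFDerivAt (fun w => f (x + J v + J w)) (f' (x + J v)) (v - v) := by
    rwa [sub_self]
  have h4 := HasFDerivAt.comp (g := fun w => f (x + J v + J w)) (f := fun w => w - v) v h3 h2
  simpa [Function.comp_def, map_sub] using h4

lemma HasDirFDeriv.sub (hf : HasDirFDeriv J f f') (hg : HasDirFDeriv J g g') :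
    HasDirFDeriv J (fun x => f x - g x) (fun x => f' x - g' x) :=
  fun x => (hf x).sub (hg x)

lemma HasDirFDeriv.add (hf : HasDirFDeriv J f f') (hg : HasDirFDeriv J g g') :
    HasDirFDeriv J (fun x => f x + g x) (fun x => f' x + g' x) :=
  fun x => (hf x).add (hg x)

lemma HasDirFDeriv.comp_add_right (hf : HasDirFDeriv J f f') (a : E) :
    HasDirFDeriv J (fun x => f (x + a)) (fun x => f' (x + a)) := fun x => by
  have := hf (x + a)
  simpa only [add_right_comm] using this

lemma HasDirFDeriv.norm_sub_le (h : HasDirFDeriv J f f') {M : ℝ} (hM : ∀ x, ‖f' x‖ ≤ M)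
    (x : E) (v : V) : ‖f (x + J v) - f x‖ ≤ M * ‖v‖ := by
  have := convex_univ.norm_image_sub_le_of_norm_hasFDerivWithin_le (𝕜 := ℝ)
    (f := fun w => f (x + J w)) (f' := fun w => f' (x + J w)) (C := M) (x := 0) (y := v)
    (fun w _ => (h.hasFDerivAt x w).hasFDerivWithinAt) (fun w _ => hM _) (mem_univ _) (mem_univ _)
  simpa using this

/-- If `f'` varies by at most `A` over the directions of norm at most `r`, and `f` by at most `B`,
then `f'` is at most `B / r + A`. -/
lemma HasDirFDeriv.norm_le (h : HasDirFDeriv J f f') {A B r : ℝ} (hr : 0 < r) (x : E)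
    (hA : ∀ v, ‖v‖ ≤ r → ‖f' (x + J v) - f' x‖ ≤ A)
    (hB : ∀ v, ‖v‖ ≤ r → ‖f (x + J v) - f x‖ ≤ B) : ‖f' x‖ ≤ B / r + A := by
  have hA0 : 0 ≤ A := (norm_nonneg _).trans (hA 0 (by simpa using hr.le))
  have hB0 : 0 ≤ B := (norm_nonneg _).trans (hB 0 (by simpa using hr.le))
  refine ContinuousLinearMap.opNorm_le_of_unit_norm (by positivity) fun v hv => ?_
  have hrv : ‖r • v‖ = r := by rw [norm_smul, hv, mul_one, Real.norm_of_nonneg hr.le]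
  -- Along the step `r • v` the function differs from its linearisation at `x` by at most `A r`;
  -- hence `r ‖f' x v‖ ≤ A r + B`.
  have h1 := (convex_closedBall (0 : V) r).norm_image_sub_le_of_norm_hasFDerivWithin_le' (𝕜 := ℝ)
    (f := fun w => f (x + J w)) (f' := fun w => f' (x + J w)) (φ := f' x) (C := A) (x := 0)
    (y := r • v) (fun w _ => (h.hasFDerivAt x w).hasFDerivWithinAt)
    (fun w hw => hA w (by simpa using hw)) (by simpa using hr.le) (by simp [hrv])
  simp only [map_zero, add_zero, sub_zero, hrv] at h1
  have h2 : ‖f' x (r • v)‖ ≤ A * r + B := by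
    have := _root_.norm_sub_le (f (x + J (r • v)) - f x) (f (x + J (r • v)) - f x - f' x (r • v))
    rw [sub_sub_cancel] at this
    linarith [hB (r • v) hrv.le]
  rw [map_smul, norm_smul, Real.norm_of_nonneg hr.le] at h2
  rw [div_add' _ _ _ hr.ne', le_div_iff₀ hr]
  linarith

end DirDeriv

section ConvFun

variable {E V W : Type*} [NormedAddCommGroup E] [NormedSpace ℝ E] [FiniteDimensional ℝ E]
  [MeasurableSpace E] [BorelSpace E]
  [NormedAddCommGroup V] [NormedSpace ℝ V] [FiniteDimensional ℝ V]
  [NormedAddCommGroup W] [NormedSpace ℝ W]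
  {ν μ : Measure E} {f g : E → W} {M : ℝ}

lemma IsBC.nonneg (h : IsBC M f) : 0 ≤ M := (norm_nonneg _).trans (h.2 0)

lemma IsBC.mono (h : IsBC M f) {M' : ℝ} (hM : M ≤ M') : IsBC M' f :=
  ⟨h.1, fun x => (h.2 x).trans hM⟩

lemma IsBC.sub (h : IsBC M f) {M' : ℝ} (h' : IsBC M' g) : IsBC (M + M') (fun x => f x - g x) :=
  ⟨h.1.sub h'.1, fun x => (norm_sub_le _ _).trans (add_le_add (h.2 x) (h'.2 x))⟩

lemma IsBC.comp_add_right (h : IsBC M f) (a : E) : IsBC M (fun x => f (x + a)) :=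
  ⟨h.1.comp (by fun_prop), fun x => h.2 _⟩

lemma IsBC.aestronglyMeasurable_sub (h : IsBC M f) (x : E) :
    AEStronglyMeasurable (fun y => f (x - y)) ν :=
  (h.1.comp (continuous_const.sub continuous_id)).aestronglyMeasurable

lemma IsBC.integrable [IsFiniteMeasure ν] (h : IsBC M f) (x : E) :
    Integrable (fun y => f (x - y)) ν :=
  (integrable_const M).mono' (h.aestronglyMeasurable_sub x) (Eventually.of_forall fun _ => h.2 _)

lemma IsBC.conv [IsProbabilityMeasure ν] (h : IsBC M f) : IsBC M (convFun ν f) := by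
  constructor
  · refine continuous_of_dominated (bound := fun _ => M) (fun x => h.aestronglyMeasurable_sub x)
      (fun x => Eventually.of_forall fun _ => h.2 _) (integrable_const M)
      (Eventually.of_forall fun y => h.1.comp (by fun_prop))
  · intro x
    have := norm_integral_le_of_norm_le_const (μ := ν) (f := fun y => f (x - y)) (C := M)
      (Eventually.of_forall fun _ => h.2 _)
    simpa [convFun] using this

lemma convFun_sub [IsFiniteMeasure ν] (hf : IsBC M f) {M' : ℝ} (hg : IsBC M' g) :
    convFun ν (fun x => f x - g x) = fun x => convFun ν f x - convFun ν g x :=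
  funext fun x => integral_sub (hf.integrable x) (hg.integrable x)

lemma convFun_comp_add_right (a : E) :
    convFun ν (fun x => f (x + a)) = fun x => convFun ν f (x + a) := by
  funext x
  simp only [convFun, sub_add_eq_add_sub]

lemma convFun_conv [IsProbabilityMeasure μ] [IsProbabilityMeasure ν] (hf : IsBC M f) :
    convFun (μ ∗ ν) f = convFun μ (convFun ν f) := by
  funext x
  have hint : Integrable (fun y => f (x - y)) (μ ∗ ν) := hf.integrable x
  unfold convFun
  rw [integral_conv hint]
  simp only [sub_sub]

lemma HasDirFDeriv.conv {J : V →L[ℝ] E} {f' : E → V →L[ℝ] W} [IsFiniteMeasure ν]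
    (h : HasDirFDeriv J f f') (hf : IsBC M f) {M' : ℝ} (hf' : IsBC M' f') :
    HasDirFDeriv J (convFun ν f) (convFun ν f') := by
  intro x
  have := hasFDerivAt_integral_of_dominated_of_fderiv_le (𝕜 := ℝ) (μ := ν)
    (F := fun v y => f (x + J v - y)) (F' := fun v y => f' (x + J v - y)) (x₀ := 0)
    (bound := fun _ => M') univ_mem
    (Eventually.of_forall fun v => hf.aestronglyMeasurable_sub _) (hf.integrable _)
    (hf'.aestronglyMeasurable_sub _)
    (Eventually.of_forall fun y v _ => hf'.2 _) (integrable_const M')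
    (Eventually.of_forall fun y v _ => by
      have := h.hasFDerivAt (x - y) v
      simpa only [sub_add_eq_add_sub] using this)
  simpa [convFun] using this

end ConvFun

/-! ### Smoothing by a differentiable density -/

section Density

variable {E V W : Type*} [NormedAddCommGroup E] [NormedSpace ℝ E] [FiniteDimensional ℝ E]
  [MeasurableSpace E] [BorelSpace E]
  [NormedAddCommGroup V] [NormedSpace ℝ V] [FiniteDimensional ℝ V] [MeasurableSpace V]
  [BorelSpace V] [NormedAddCommGroup W] [NormedSpace ℝ W] [CompleteSpace W]

lemma convFun_map_withDensity (μ : Measure V) (J : V →L[ℝ] E) {p : V → ℝ} (hp : Measurable p)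
    (hp0 : ∀ y, 0 ≤ p y) {h : E → W} (hh : Continuous h) (x : E) :
    convFun ((μ.withDensity fun y => ENNReal.ofReal (p y)).map J) h x =
      ∫ y, p y • h (x - J y) ∂μ := by
  unfold convFun
  rw [integral_map J.continuous.aemeasurable
    (Continuous.aestronglyMeasurable (by fun_prop)),
    integral_withDensity_eq_integral_toReal_smul₀ (by fun_prop) (by simp)]
  simp only [ENNReal.toReal_ofReal (hp0 _)]

/-- Convolution with a differentiable density whose derivative is integrable. -/
lemma hasDirFDeriv_convFun_density (μ : Measure V) [μ.IsAddHaarMeasure] (J : V →L[ℝ] E)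
    {p : V → ℝ} (hp : ContDiff ℝ 1 p) (hp0 : ∀ y, 0 ≤ p y) (hpi : Integrable p μ)
    (hdi : Integrable (fderiv ℝ p) μ) {M : ℝ} {h : E → W} (hh : IsBC M h) :
    HasDirFDeriv J (convFun ((μ.withDensity fun y => ENNReal.ofReal (p y)).map J) h)
        (fun x => ∫ y, (fderiv ℝ p y).smulRight (h (x - J y)) ∂μ) ∧
      IsBC ((∫ y, ‖fderiv ℝ p y‖ ∂μ) * M)
        (fun x => ∫ y, (fderiv ℝ p y).smulRight (h (x - J y)) ∂μ) := by
  have hcd : Continuous (fderiv ℝ p) := hp.continuous_fderiv (by norm_num)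
  have hM := hh.nonneg
  set D : E → V →L[ℝ] W := fun x => ∫ y, (fderiv ℝ p y).smulRight (h (x - J y)) ∂μ with hD
  have hjc : Continuous fun q : E × V => (fderiv ℝ p q.2).smulRight (h (q.1 - J q.2)) :=
    ((ContinuousLinearMap.smulRightL ℝ V W).continuous.comp (hcd.comp continuous_snd)).clm_apply
      (hh.1.comp (by fun_prop))
  have hbd : ∀ x y, ‖(fderiv ℝ p y).smulRight (h (x - J y))‖ ≤ ‖fderiv ℝ p y‖ * M := by
    intro x y
    rw [ContinuousLinearMap.norm_smulRight_apply]
    exact mul_le_mul_of_nonneg_left (hh.2 _) (norm_nonneg _)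
  have hmeas : ∀ x, AEStronglyMeasurable (fun y => (fderiv ℝ p y).smulRight (h (x - J y))) μ :=
    fun x => (hjc.comp (Continuous.prodMk_right x)).aestronglyMeasurable
  have hDi : ∀ x, Integrable (fun y => (fderiv ℝ p y).smulRight (h (x - J y))) μ :=
    fun x => (hdi.norm.mul_const M).mono' (hmeas x) (Eventually.of_forall (hbd x))
  have hDc : Continuous D := continuous_of_dominated hmeas
    (fun x => Eventually.of_forall (hbd x)) (hdi.norm.mul_const M)
    (Eventually.of_forall fun y => hjc.comp (Continuous.prodMk_left y))
  have hDb : ∀ x, ‖D x‖ ≤ (∫ y, ‖fderiv ℝ p y‖ ∂μ) * M := fun x => by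
    rw [← integral_mul_const]
    exact norm_integral_le_of_norm_le (hdi.norm.mul_const M) (Eventually.of_forall (hbd x))
  refine ⟨fun x => ?_, hDc, hDb⟩
  -- the increment is the integral of the derivative
  have hinc : ∀ v, convFun ((μ.withDensity fun y => ENNReal.ofReal (p y)).map J) h (x + J v) -
      convFun ((μ.withDensity fun y => ENNReal.ofReal (p y)).map J) h x =
      ∫ θ in (0 : ℝ)..1, D (x + J (θ • v)) v := by
    intro v
    -- Translating the integration variable moves `θ • v` from `h`, which is only continuous, to the
    -- density, which can be differentiated in `θ`.
    have hDv : ∀ θ : ℝ, D (x + J (θ • v)) v =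
        ∫ y, (fderiv ℝ p (y + θ • v) v) • h (x - J y) ∂μ := by
      intro θ
      rw [hD, ContinuousLinearMap.integral_apply (hDi _),
        ← integral_add_right_eq_self _ (θ • v)]
      refine integral_congr_ae (Eventually.of_forall fun y => ?_)
      simp only [ContinuousLinearMap.smulRight_apply, map_add, add_sub_add_right_eq_sub]
    have hshift : ∀ w, Integrable (fun y => p (y + w) • h (x - J y)) μ := fun w => by
      refine ((hpi.comp_add_right w).norm.mul_const M).mono' ?_ (Eventually.of_forall fun y => ?_)
      · exact Continuous.aestronglyMeasurable
          ((hp.continuous.comp (by fun_prop)).smul (hh.1.comp (by fun_prop)))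
      · rw [norm_smul]
        exact mul_le_mul_of_nonneg_left (hh.2 _) (norm_nonneg _)
    have hprod : Integrable (fun q : ℝ × V => (fderiv ℝ p (q.2 + q.1 • v) v) • h (x - J q.2))
        ((volume.restrict (Ioc (0 : ℝ) 1)).prod μ) := by
      have hc : Continuous fun q : ℝ × V => (fderiv ℝ p (q.2 + q.1 • v) v) • h (x - J q.2) :=
        ((hcd.comp (by fun_prop)).clm_apply continuous_const).smul (hh.1.comp (by fun_prop))
      have hb : ∀ (θ : ℝ) (y : V), ‖(fderiv ℝ p (y + θ • v) v) • h (x - J y)‖ ≤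
          ‖fderiv ℝ p (y + θ • v)‖ * (‖v‖ * M) := by
        intro θ y
        rw [norm_smul, ← mul_assoc]
        exact mul_le_mul (ContinuousLinearMap.le_opNorm _ _) (hh.2 _) (norm_nonneg _)
          (by positivity)
      have hi : ∀ θ : ℝ, Integrable (fun y => ‖fderiv ℝ p (y + θ • v)‖ * (‖v‖ * M)) μ := fun θ =>
        (hdi.comp_add_right (θ • v)).norm.mul_const _
      have hm := hc.aestronglyMeasurable (μ := (volume.restrict (Ioc (0 : ℝ) 1)).prod μ)
      rw [integrable_prod_iff hm]
      refine ⟨Eventually.of_forall fun θ => (hi θ).mono'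
        (hc.comp (Continuous.prodMk_right θ)).aestronglyMeasurable
        (Eventually.of_forall (hb θ)), ?_⟩
      refine (integrable_const ((∫ y, ‖fderiv ℝ p y‖ ∂μ) * (‖v‖ * M))).mono'
        hm.norm.integral_prod_right' (Eventually.of_forall fun θ => ?_)
      rw [Real.norm_of_nonneg (integral_nonneg fun _ => norm_nonneg _), ← integral_mul_const,
        ← integral_add_right_eq_self (fun y => ‖fderiv ℝ p y‖ * (‖v‖ * M)) (θ • v)]
      exact integral_mono_of_nonneg (Eventually.of_forall fun _ => norm_nonneg _) (hi θ)
        (Eventually.of_forall (hb θ))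
    rw [convFun_map_withDensity μ J hp.continuous.measurable hp0 hh.1,
      convFun_map_withDensity μ J hp.continuous.measurable hp0 hh.1,
      ← integral_add_right_eq_self (fun y => p y • h (x + J v - J y)) v]
    simp only [map_add, add_sub_add_right_eq_sub, hDv]
    rw [intervalIntegral.integral_of_le zero_le_one, integral_integral_swap hprod,
      ← integral_sub (hshift v) (by simpa using hshift 0)]
    refine integral_congr_ae (Eventually.of_forall fun y => ?_)
    simp only
    rw [← intervalIntegral.integral_of_le zero_le_one, intervalIntegral.integral_smul_const,
      ← sub_smul]
    congr 1
    have hder : ∀ θ ∈ uIcc (0 : ℝ) 1, HasDerivAt (fun θ : ℝ => p (y + θ • v))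
        (fderiv ℝ p (y + θ • v) v) θ := by
      intro θ _
      have h1 : HasDerivAt (fun θ : ℝ => y + θ • v) v θ := by
        simpa using ((hasDerivAt_id θ).smul_const v).const_add y
      exact ((hp.differentiable (by norm_num)) _).hasFDerivAt.comp_hasDerivAt θ h1
    rw [intervalIntegral.integral_eq_sub_of_hasDerivAt hder
      (Continuous.intervalIntegrable
        ((hcd.comp (by fun_prop)).clm_apply continuous_const) _ _)]
    simp
  rw [hasFDerivAt_iff_isLittleO_nhds_zero, Asymptotics.isLittleO_iff]
  intro ε hε
  -- Continuity of the candidate `D` upgrades the integral formula for increments to Fréchet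
  -- differentiability.
  have hcont : ContinuousAt (fun v => D (x + J v)) 0 := by fun_prop
  obtain ⟨δ, hδ, hδ'⟩ := Metric.continuousAt_iff.1 hcont ε hε
  filter_upwards [Metric.ball_mem_nhds (0 : V) hδ] with v hv
  simp only [zero_add, map_zero, add_zero]
  rw [hinc v]
  have hci : IntervalIntegrable (fun θ : ℝ => D (x + J (θ • v)) v) volume 0 1 :=
    Continuous.intervalIntegrable (by fun_prop) _ _
  have hconst : D x v = ∫ _ in (0 : ℝ)..1, D x v := by simp
  rw [hconst, ← intervalIntegral.integral_sub hci (by simp)]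
  have := intervalIntegral.norm_integral_le_of_norm_le_const (a := 0) (b := 1)
    (f := fun θ : ℝ => D (x + J (θ • v)) v - D x v) (C := ε * ‖v‖) (fun θ hθ => ?_)
  · simpa using this
  · rw [uIoc_of_le zero_le_one] at hθ
    rw [← sub_apply]
    refine (ContinuousLinearMap.le_opNorm _ _).trans
      (mul_le_mul_of_nonneg_right ?_ (norm_nonneg _))
    have h2 : dist (θ • v) 0 < δ := by
      rw [dist_zero_right, norm_smul, Real.norm_of_nonneg hθ.1.le]
      rw [mem_ball_zero_iff] at hv
      nlinarith [hθ.2, norm_nonneg v]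
    have := hδ' h2
    rw [dist_eq_norm, map_zero, add_zero] at this
    exact this.le

end Density

/-! ### Smoothing in the directions of a subspace -/

section Smoothing

variable {E V W : Type} [NormedAddCommGroup E] [NormedSpace ℝ E] [FiniteDimensional ℝ E]
  [MeasurableSpace E] [BorelSpace E]
  [NormedAddCommGroup V] [NormedSpace ℝ V] [FiniteDimensional ℝ V]
  [NormedAddCommGroup W] [NormedSpace ℝ W] [CompleteSpace W]

/-- The measures `K t` smooth in the directions of `J`, of order `α`: convolution with `K t` maps
bounded continuous functions to functions with a bounded continuous derivative in these directions,
with norm at most `c * t ^ (-1/α)`. -/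
def Smooths (T α c : ℝ) (K : ℝ → Measure E) (J : V →L[ℝ] E) : Prop :=
  ∀ t ∈ Ioc 0 T, ∀ (W : Type) [NormedAddCommGroup W] [NormedSpace ℝ W] [CompleteSpace W]
    (f : E → W) (M : ℝ), IsBC M f →
    HasDirFDeriv J (convFun (K t) f) (dirFDeriv J (convFun (K t) f)) ∧
      IsBC (c * t ^ (-(1 / α)) * M) (dirFDeriv J (convFun (K t) f))

/-- A family `G t`, `t ∈ (0, T]`, of bounded continuous functions with `G (s + t) = K s * G t` and
`‖G t‖ ≤ A * t ^ (-a)`. -/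
structure IsHeatFamily (T : ℝ) (K : ℝ → Measure E) (A a : ℝ) (G : ℝ → E → W) : Prop where
  bc : ∀ t ∈ Ioc 0 T, IsBC (A * t ^ (-a)) (G t)
  flow : ∀ s t, 0 ≤ s → 0 < t → s + t ≤ T → G (s + t) = convFun (K s) (G t)

variable {T α c A a M : ℝ} {K : ℝ → Measure E} {J : V →L[ℝ] E} {f : E → W} {G : ℝ → E → W}

lemma isHeatFamily_convFun (hK : IsHeatFlow T K) (hf : IsBC M f) :
    IsHeatFamily T K M 0 (fun t => convFun (K t) f) where
  bc t ht := by
    have := hK.prob t ⟨ht.1.le, ht.2⟩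
    simpa using hf.conv (ν := K t)
  flow s t hs ht hst := by
    have := hK.prob t ⟨ht.le, by linarith⟩
    have := hK.prob s ⟨hs, by linarith⟩
    simp only [hK.conv_eq s t hs ht.le hst, convFun_conv hf]

/-- The derivative of a heat family is a heat family. -/
lemma IsHeatFamily.dirFDeriv (hK : IsHeatFlow T K) (hS : Smooths T α c K J)
    (hG : IsHeatFamily T K A a G) :
    (∀ t ∈ Ioc 0 T, HasDirFDeriv J (G t) (dirFDeriv J (G t))) ∧
      IsHeatFamily T K (c * A * 2 ^ (a + 1 / α)) (a + 1 / α) (fun t => dirFDeriv J (G t)) := by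
  -- Half of the time is spent on taking the derivative and the other half on the bound for `G`;
  -- replacing `t` by `t / 2` in both powers gives the factor `2 ^ (a + 1 / α)`.
  have hhalf : ∀ t ∈ Ioc 0 T, HasDirFDeriv J (G t) (_root_.dirFDeriv J (G t)) ∧
      IsBC (c * A * 2 ^ (a + 1 / α) * t ^ (-(a + 1 / α))) (_root_.dirFDeriv J (G t)) := by
    intro t ht
    have ht2 : t / 2 ∈ Ioc 0 T := ⟨by linarith [ht.1], by linarith [ht.1, ht.2]⟩
    have h1 := hG.flow (t / 2) (t / 2) ht2.1.le ht2.1 (by linarith [ht.2])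
    rw [add_halves] at h1
    have h2 := hS (t / 2) ht2 W (G (t / 2)) _ (hG.bc _ ht2)
    rw [← h1] at h2
    refine ⟨h2.1, ?_⟩
    convert h2.2 using 1
    have h3 : ∀ b : ℝ, (t / 2) ^ (-b) = t ^ (-b) * 2 ^ b := fun b => by
      rw [Real.div_rpow ht.1.le zero_le_two, Real.rpow_neg zero_le_two b, div_inv_eq_mul]
    rw [h3, h3, neg_add, Real.rpow_add ht.1, Real.rpow_add two_pos]
    ring
  refine ⟨fun t ht => (hhalf t ht).1, fun t ht => (hhalf t ht).2, fun s t hs ht hst => ?_⟩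
  have htT : t ∈ Ioc 0 T := ⟨ht, by linarith⟩
  have := hK.prob s ⟨hs, by linarith⟩
  simp only [hG.flow s t hs ht hst]
  exact ((hhalf t htT).1.conv (hG.bc t htT) (hhalf t htT).2).eq.symm

/-- The derivative of `K t * f` for a bounded continuous `f` which is Hölder in the directions
of `J`. -/
lemma isHeatFamily_dirFDeriv_of_holder {β C : ℝ} (hα : 0 < α) (hc : 0 ≤ c) (hK : IsHeatFlow T K)
    (hS : Smooths T α c K J) (hf : IsBC M f) (hβ : 0 ≤ β)
    (hC0 : 0 ≤ C) (hC : ∀ x v, ‖f (x + J v) - f x‖ ≤ C * ‖v‖ ^ β) :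
    IsHeatFamily T K ((1 + c) * C) ((1 - β) / α)
      (fun t => _root_.dirFDeriv J (convFun (K t) f)) := by
  refine ⟨fun t ht => ?_, ((isHeatFamily_convFun hK hf).dirFDeriv hK hS).2.flow⟩
  have hp := hK.prob t ⟨ht.1.le, ht.2⟩
  have hd := hS t ht W f M hf
  refine ⟨hd.2.1, fun x => ?_⟩
  -- The natural length scale at time `t`: it makes the bound `C r ^ β / r` from the increments of
  -- the convolution match the bound `c r⁻¹ · C r ^ β` from the increments of its derivative.
  set r := t ^ (1 / α) with hr
  have hr0 : 0 < r := Real.rpow_pos_of_pos ht.1 _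
  have hdiff : ∀ v, IsBC (C * ‖v‖ ^ β) (fun x => f (x + J v) - f x) := fun v =>
    ⟨((hf.comp_add_right (J v)).sub hf).1, fun x => hC x v⟩
  have hmono : ∀ v : V, ‖v‖ ≤ r → C * ‖v‖ ^ β ≤ C * r ^ β := fun v hv =>
    mul_le_mul_of_nonneg_left (Real.rpow_le_rpow (norm_nonneg _) hv hβ) hC0
  have hshift : ∀ v, convFun (K t) (fun x => f (x + J v) - f x) =
      fun x => convFun (K t) f (x + J v) - convFun (K t) f x := fun v => by
    rw [convFun_sub (hf.comp_add_right _) hf, convFun_comp_add_right]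
  have key := hd.1.norm_le hr0 x (A := c * t ^ (-(1 / α)) * (C * r ^ β)) (B := C * r ^ β)
    (fun v hv => ?_) (fun v hv => ?_)
  · refine key.trans (le_of_eq ?_)
    have h1 : t ^ (-(1 / α)) = r⁻¹ := by rw [Real.rpow_neg ht.1.le]
    have h2 : t ^ (-((1 - β) / α)) = r ^ β * r⁻¹ := by
      rw [hr, ← Real.rpow_mul ht.1.le, ← Real.rpow_neg ht.1.le, ← Real.rpow_add ht.1]
      congr 1
      field_simp
      ring
    rw [h1, h2]
    field_simp
  · have h1 := ((hd.1.comp_add_right (J v)).sub hd.1).eq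
    rw [← hshift v] at h1
    have h2 := (hS t ht W _ _ (hdiff v)).2.2 x
    rw [← h1] at h2
    exact h2.trans (mul_le_mul_of_nonneg_left (hmono v hv)
      (mul_nonneg hc (Real.rpow_nonneg ht.1.le _)))
  · have h2 := ((hdiff v).conv (ν := K t)).2 x
    rw [hshift v] at h2
    exact h2.trans (hmono v hv)

end Smoothing

/-! ### Partial and total smoothing on the product space -/

section DirectSum

/-- Convolution with the probability measure `ρ t` preserves bounded continuous functions and their
bounds, so all of the smoothing along `J` comes from the density of the kernel of `L`. -/
lemma smooths_of_hasOrder {ι : Type} [Fintype ι] {E : Type} [NormedAddCommGroup E]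
    [NormedSpace ℝ E] [FiniteDimensional ℝ E] [MeasurableSpace E] [BorelSpace E]
    {L : LevyTriplet ι} {T α : ℝ} (h : L.HasOrder T α) (J : EuclideanSpace ℝ ι →L[ℝ] E)
    {K ρ : ℝ → Measure E} (hρ : ∀ t ∈ Ioc 0 T, IsProbabilityMeasure (ρ t))
    (hK : ∀ t ∈ Ioc 0 T, K t = (L.heatMeasure t).map J ∗ ρ t) :
    ∃ c > 0, Smooths T α c K J := by
  obtain ⟨p, hp, c, hc, hb⟩ := id h
  refine ⟨c, hc, fun t ht W _ _ _ f M hf => ?_⟩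
  obtain ⟨hp0, hpt, hpc, -⟩ := hp t ht
  have := hρ t ht
  have hprob := (h.isHeatMeasure ⟨ht.1.le, ht.2⟩).1
  have := LevyTriplet.isProbabilityMeasure_map_clm (L.heatMeasure t) J
  have hM := hf.nonneg
  have hct : 0 ≤ c * t ^ (-(1 / α)) := mul_nonneg hc.le (Real.rpow_nonneg ht.1.le _)
  have hC1 : ContDiff ℝ 1 (p t) := hpc.of_le (by exact_mod_cast le_top)
  have hdm : AEStronglyMeasurable (fderiv ℝ (p t)) volume :=
    (hC1.continuous_fderiv (by norm_num)).aestronglyMeasurable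
  have hdi : Integrable (fderiv ℝ (p t)) volume :=
    ⟨hdm, (hb t ht).trans_lt ENNReal.ofReal_lt_top⟩
  have hpi : Integrable (p t) volume := by
    refine ⟨hC1.continuous.aestronglyMeasurable, ?_⟩
    rw [hasFiniteIntegral_iff_ofReal (Eventually.of_forall hp0)]
    have h1 : L.heatMeasure t univ = 1 := measure_univ
    rw [hpt, withDensity_apply _ MeasurableSet.univ, setLIntegral_univ] at h1
    rw [h1]
    exact ENNReal.one_lt_top
  rw [hK t ht, convFun_conv hf, hpt]
  obtain ⟨h1, h2⟩ := hasDirFDeriv_convFun_density volume J hC1 hp0 hpi hdi (hf.conv (ν := ρ t))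
  rw [← h1.eq]
  refine ⟨h1, h2.mono (mul_le_mul_of_nonneg_right ?_ hM)⟩
  rw [integral_norm_eq_lintegral_enorm hdm]
  exact ENNReal.toReal_le_of_le_ofReal hct (hb t ht)

variable {ι κ : Type} [Fintype ι] [Fintype κ]

/-- The projection `(x₁, x₂) ↦ x₁`. -/
noncomputable def fstPt : EuclideanSpace ℝ (ι ⊕ κ) →L[ℝ] EuclideanSpace ℝ ι :=
  LinearMap.toContinuousLinearMap
    { toFun := fun x => WithLp.toLp 2 fun i => x (Sum.inl i)
      map_add' := fun _ _ => rfl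
      map_smul' := fun _ _ => rfl }

/-- The projection `(x₁, x₂) ↦ x₂`. -/
noncomputable def sndPt : EuclideanSpace ℝ (ι ⊕ κ) →L[ℝ] EuclideanSpace ℝ κ :=
  LinearMap.toContinuousLinearMap
    { toFun := fun x => WithLp.toLp 2 fun i => x (Sum.inr i)
      map_add' := fun _ _ => rfl
      map_smul' := fun _ _ => rfl }

lemma pairPt_fstPt_sndPt (x : EuclideanSpace ℝ (ι ⊕ κ)) : pairPt (fstPt x) (sndPt x) = x := by
  ext i; cases i <;> rfl

lemma norm_fstPt_le (x : EuclideanSpace ℝ (ι ⊕ κ)) : ‖fstPt x‖ ≤ ‖x‖ := by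
  have h := norm_pairPt_sq (fstPt x) (sndPt x)
  rw [pairPt_fstPt_sndPt] at h
  exact abs_le_of_sq_le_sq' (by nlinarith [sq_nonneg ‖sndPt x‖]) (norm_nonneg _) |>.2

lemma norm_sndPt_le (x : EuclideanSpace ℝ (ι ⊕ κ)) : ‖sndPt x‖ ≤ ‖x‖ := by
  have h := norm_pairPt_sq (fstPt x) (sndPt x)
  rw [pairPt_fstPt_sndPt] at h
  exact abs_le_of_sq_le_sq' (by nlinarith [sq_nonneg ‖fstPt x‖]) (norm_nonneg _) |>.2

/-- A function with continuous derivatives in both groups of variables is differentiable. -/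
lemma HasDirFDeriv.of_partial {W : Type*} [NormedAddCommGroup W] [NormedSpace ℝ W]
    {f : EuclideanSpace ℝ (ι ⊕ κ) → W}
    {f₁ : EuclideanSpace ℝ (ι ⊕ κ) → EuclideanSpace ℝ ι →L[ℝ] W}
    {f₂ : EuclideanSpace ℝ (ι ⊕ κ) → EuclideanSpace ℝ κ →L[ℝ] W}
    (h₁ : HasDirFDeriv inlL f f₁) (h₂ : HasDirFDeriv inrL f f₂) (c₁ : Continuous f₁)
    (c₂ : Continuous f₂) :
    HasDirFDeriv (ContinuousLinearMap.id ℝ _) f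
      (fun x => (f₁ x).comp fstPt + (f₂ x).comp sndPt) := by
  intro x
  have h := hasStrictFDerivAt_uncurry_coprod (𝕜 := ℝ) (u := (0, 0))
    (f := fun (v : EuclideanSpace ℝ ι) (w : EuclideanSpace ℝ κ) => f (x + inlL v + inrL w))
    (f₁ := fun v w => f₁ (x + inlL v + inrL w)) (f₂ := fun v w => f₂ (x + inlL v + inrL w))
    (Eventually.of_forall fun q => by
      have := h₁.hasFDerivAt (x + inrL q.2) q.1
      simpa only [add_right_comm, Function.HasUncurry.uncurry, id] using this)
    (Eventually.of_forall fun q => h₂.hasFDerivAt (x + inlL q.1) q.2)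
    (Continuous.continuousAt (c₁.comp (by fun_prop)))
    (Continuous.continuousAt (c₂.comp (by fun_prop)))
  have h3 : HasFDerivAt (fun v : EuclideanSpace ℝ (ι ⊕ κ) => (fstPt v, sndPt v))
      ((fstPt (ι := ι) (κ := κ)).prod sndPt) 0 := (fstPt.prod sndPt).hasFDerivAt
  have h4 := HasFDerivAt.comp (0 : EuclideanSpace ℝ (ι ⊕ κ)) (by simpa using h.hasFDerivAt) h3
  refine (h4.congr_fderiv ?_).congr_of_eventuallyEq (Eventually.of_forall fun v => ?_)
  · ext v
    have h00 : pairPt (0 : EuclideanSpace ℝ ι) (0 : EuclideanSpace ℝ κ) = 0 := by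
      ext i; cases i <;> rfl
    simp [Function.HasUncurry.uncurry, h00]
  · have := pairPt_fstPt_sndPt v
    rw [pairPt_eq, inlL_apply, inrL_apply] at this
    simp only [Function.comp, Function.HasUncurry.uncurry, id, add_assoc, this,
      ContinuousLinearMap.id_apply]

/-- The total derivative is assembled from two continuous partial ones. The weaker smoothing
decides: on `(0, T]` the power `t ^ (-1/α₁)` is at most `max 1 T ^ (1/α₂ - 1/α₁)` times `t ^
(-1/α₂)`. -/
lemma Smooths.id_of_partial {T α₁ α₂ c₁ c₂ : ℝ} {K : ℝ → Measure (EuclideanSpace ℝ (ι ⊕ κ))}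
    (hα₂ : 0 < α₂) (hα : α₂ ≤ α₁) (hc₁ : 0 < c₁) (hc₂ : 0 < c₂)
    (h₁ : Smooths T α₁ c₁ K (inlL : EuclideanSpace ℝ ι →L[ℝ] _))
    (h₂ : Smooths T α₂ c₂ K (inrL : EuclideanSpace ℝ κ →L[ℝ] _)) :
    ∃ c > 0, Smooths T α₂ c K (ContinuousLinearMap.id ℝ _) := by
  refine ⟨c₁ * max 1 T ^ (1 / α₂ - 1 / α₁) + c₂, by positivity, fun t ht W _ _ _ f M hf => ?_⟩
  obtain ⟨a₁, b₁⟩ := h₁ t ht W f M hf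
  obtain ⟨a₂, b₂⟩ := h₂ t ht W f M hf
  have h := HasDirFDeriv.of_partial a₁ a₂ b₁.1 b₂.1
  rw [← h.eq]
  refine ⟨h, ?_, fun x => ?_⟩
  · exact (b₁.1.clm_comp continuous_const).add (b₂.1.clm_comp continuous_const)
  have n₁ : ‖(fstPt : EuclideanSpace ℝ (ι ⊕ κ) →L[ℝ] _)‖ ≤ 1 :=
    ContinuousLinearMap.opNorm_le_bound _ zero_le_one fun v => by simpa using norm_fstPt_le v
  have n₂ : ‖(sndPt : EuclideanSpace ℝ (ι ⊕ κ) →L[ℝ] _)‖ ≤ 1 :=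
    ContinuousLinearMap.opNorm_le_bound _ zero_le_one fun v => by simpa using norm_sndPt_le v
  have e₁ : ‖(dirFDeriv inlL (convFun (K t) f) x).comp (fstPt (ι := ι) (κ := κ))‖ ≤
      c₁ * t ^ (-(1 / α₁)) * M :=
    (ContinuousLinearMap.opNorm_comp_le _ _).trans
      ((mul_le_of_le_one_right (norm_nonneg _) n₁).trans (b₁.2 x))
  have e₂ : ‖(dirFDeriv inrL (convFun (K t) f) x).comp (sndPt (ι := ι) (κ := κ))‖ ≤
      c₂ * t ^ (-(1 / α₂)) * M :=
    (ContinuousLinearMap.opNorm_comp_le _ _).trans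
      ((mul_le_of_le_one_right (norm_nonneg _) n₂).trans (b₂.2 x))
  have hM := hf.nonneg
  have hexp : 0 ≤ 1 / α₂ - 1 / α₁ := sub_nonneg.2 (one_div_le_one_div_of_le hα₂ hα)
  have ht1 : t ^ (-(1 / α₁)) ≤ max 1 T ^ (1 / α₂ - 1 / α₁) * t ^ (-(1 / α₂)) := by
    have : t ^ (-(1 / α₁)) = t ^ (1 / α₂ - 1 / α₁) * t ^ (-(1 / α₂)) := by
      rw [← Real.rpow_add ht.1]; congr 1; ring
    rw [this]
    exact mul_le_mul_of_nonneg_right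
      (Real.rpow_le_rpow ht.1.le (ht.2.trans (le_max_right _ _)) hexp)
      (Real.rpow_nonneg ht.1.le _)
  refine (norm_add_le _ _).trans ((add_le_add e₁ e₂).trans ?_)
  have := mul_le_mul_of_nonneg_right (mul_le_mul_of_nonneg_left ht1 hc₁.le) hM
  linarith

end DirectSum

/-! ### Singular integrals in time -/

section SingularIntegrals

lemma measurePreserving_sub_left_Ioo (t : ℝ) :
    MeasurePreserving (fun s => t - s) (volume.restrict (Ioo 0 t)) (volume.restrict (Ioo 0 t)) := by
  have h := (Measure.measurePreserving_sub_left (volume : Measure ℝ) t).restrict_preimage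
    (measurableSet_Ioo (a := (0 : ℝ)) (b := t))
  rwa [Set.preimage_const_sub_Ioo, sub_self, sub_zero] at h

lemma integrableOn_comp_sub_left {φ : ℝ → ℝ} {t : ℝ} (h : IntegrableOn φ (Ioo 0 t)) :
    IntegrableOn (fun s => φ (t - s)) (Ioo 0 t) :=
  (measurePreserving_sub_left_Ioo t).integrable_comp_of_integrable h

lemma setIntegral_comp_sub_left (φ : ℝ → ℝ) (t : ℝ) :
    ∫ s in Ioo 0 t, φ (t - s) = ∫ s in Ioo 0 t, φ s :=
  (measurePreserving_sub_left_Ioo t).integral_comp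
    (Homeomorph.subLeft t).measurableEmbedding φ

lemma integrableOn_rpow_neg {a : ℝ} (ha : a < 1) (t : ℝ) :
    IntegrableOn (fun s : ℝ => s ^ (-a)) (Ioo 0 t) := by
  rcases le_or_gt t 0 with ht | ht
  · simp [Ioo_eq_empty (not_lt.2 ht)]
  · exact (intervalIntegrable_iff_integrableOn_Ioo_of_le ht.le).1
      (intervalIntegral.intervalIntegrable_rpow' (by linarith))

lemma setIntegral_rpow_neg {a t : ℝ} (ha : a < 1) (ht : 0 ≤ t) :
    ∫ s in Ioo 0 t, s ^ (-a) = t ^ (1 - a) / (1 - a) := by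
  rw [← integral_Ioc_eq_integral_Ioo, ← intervalIntegral.integral_of_le ht,
    integral_rpow (Or.inl (by linarith)), Real.zero_rpow (by linarith)]
  rw [sub_zero, neg_add_eq_sub]

/-- Splitting a convolution with `s ^ (-κ)` at `t / 2`. -/
lemma rpow_neg_mul_le {φ : ℝ → ℝ} {κ s t : ℝ} (hκ : 0 ≤ κ) (hφ0 : ∀ r, 0 < r → 0 ≤ φ r)
    (hφ : AntitoneOn φ (Ioi 0)) (hs : s ∈ Ioo 0 t) :
    s ^ (-κ) * φ (t - s) ≤ (t / 2) ^ (-κ) * φ (t - s) + φ (t / 2) * s ^ (-κ) := by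
  have hts : 0 < t - s := sub_pos.2 hs.2
  have ht2 : 0 < t / 2 := by linarith [hs.1]
  have h1 := hφ0 _ hts
  have h2 := hφ0 _ ht2
  have h3 : 0 ≤ s ^ (-κ) := Real.rpow_nonneg hs.1.le _
  have h4 : 0 ≤ (t / 2) ^ (-κ) := Real.rpow_nonneg ht2.le _
  rcases le_total (t / 2) s with h | h
  · have : s ^ (-κ) ≤ (t / 2) ^ (-κ) := Real.rpow_le_rpow_of_nonpos ht2 h (by linarith)
    nlinarith [mul_nonneg h2 h3]
  · have : φ (t - s) ≤ φ (t / 2) := hφ ht2 hts (by linarith)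
    nlinarith [mul_nonneg h4 h1]

/-- On each half of `(0, t)` only one factor is singular; the other is replaced by its value at `t /
2`, by monotonicity. -/
lemma integrableOn_rpow_neg_mul {φ : ℝ → ℝ} {κ t : ℝ} (hκ : 0 ≤ κ) (hκ1 : κ < 1)
    (hφ0 : ∀ r, 0 < r → 0 ≤ φ r) (hφ : AntitoneOn φ (Ioi 0)) (hi : IntegrableOn φ (Ioo 0 t)) :
    IntegrableOn (fun s => s ^ (-κ) * φ (t - s)) (Ioo 0 t) ∧
      ∫ s in Ioo 0 t, s ^ (-κ) * φ (t - s) ≤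
        (t / 2) ^ (-κ) * (∫ s in Ioo 0 t, φ s) + φ (t / 2) * ∫ s in Ioo 0 t, s ^ (-κ) := by
  have hi' := integrableOn_comp_sub_left hi
  have hb : IntegrableOn (fun s => (t / 2) ^ (-κ) * φ (t - s) + φ (t / 2) * s ^ (-κ)) (Ioo 0 t) :=
    (hi'.const_mul _).add ((integrableOn_rpow_neg hκ1 t).const_mul _)
  have hle : ∀ᵐ s ∂volume.restrict (Ioo 0 t), s ^ (-κ) * φ (t - s) ≤
      (t / 2) ^ (-κ) * φ (t - s) + φ (t / 2) * s ^ (-κ) :=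
    (ae_restrict_iff' measurableSet_Ioo).2
      (Eventually.of_forall fun s hs => rpow_neg_mul_le hκ hφ0 hφ hs)
  have hnn : ∀ᵐ s ∂volume.restrict (Ioo 0 t), 0 ≤ s ^ (-κ) * φ (t - s) :=
    (ae_restrict_iff' measurableSet_Ioo).2 (Eventually.of_forall fun s hs =>
      mul_nonneg (Real.rpow_nonneg hs.1.le _) (hφ0 _ (sub_pos.2 hs.2)))
  have hint : IntegrableOn (fun s => s ^ (-κ) * φ (t - s)) (Ioo 0 t) := by
    refine hb.mono' (AEStronglyMeasurable.mul ?_ hi'.1) ?_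
    · exact (integrableOn_rpow_neg hκ1 t).1
    · filter_upwards [hle, hnn] with s h1 h2
      rwa [Real.norm_of_nonneg h2]
  refine ⟨hint, (integral_mono_ae hint hb hle).trans (le_of_eq ?_)⟩
  rw [integral_add (hi'.const_mul _) ((integrableOn_rpow_neg hκ1 t).const_mul _),
    integral_const_mul, integral_const_mul, setIntegral_comp_sub_left]

lemma antitoneOn_rpow_neg {a : ℝ} (ha : 0 ≤ a) : AntitoneOn (fun r : ℝ => r ^ (-a)) (Ioi 0) :=
  fun _ hx _ _ hxy => Real.rpow_le_rpow_of_nonpos hx hxy (by linarith)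

lemma integrableOn_rpow_neg_mul_rpow_neg {κ a : ℝ} (hκ : 0 ≤ κ) (hκ1 : κ < 1) (ha : 0 ≤ a)
    (ha1 : a < 1) (t : ℝ) :
    IntegrableOn (fun s => s ^ (-κ) * (t - s) ^ (-a)) (Ioo 0 t) :=
  (integrableOn_rpow_neg_mul (φ := fun r => r ^ (-a)) hκ hκ1
    (fun _ hr => Real.rpow_nonneg hr.le _) (antitoneOn_rpow_neg ha)
    (integrableOn_rpow_neg ha1 t)).1

lemma antitoneOn_min_rpow {a b ρ : ℝ} (ha : 0 ≤ a) (hb : 0 ≤ b) (hρ : 0 ≤ ρ) :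
    AntitoneOn (fun r : ℝ => min (r ^ (-a)) (ρ * r ^ (-b))) (Ioi 0) :=
  fun _ hx _ hy hxy => min_le_min (antitoneOn_rpow_neg ha hx hy hxy)
    (mul_le_mul_of_nonneg_left (antitoneOn_rpow_neg hb hx hy hxy) hρ)

lemma integrableOn_min_rpow {a b ρ : ℝ} (ha1 : a < 1) (hρ : 0 ≤ ρ) (t : ℝ) :
    IntegrableOn (fun r : ℝ => min (r ^ (-a)) (ρ * r ^ (-b))) (Ioo 0 t) := by
  refine (integrableOn_rpow_neg ha1 t).mono' (Measurable.aestronglyMeasurable (by fun_prop)) ?_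
  refine (ae_restrict_iff' measurableSet_Ioo).2 (Eventually.of_forall fun s hs => ?_)
  have h1 : 0 ≤ s ^ (-a) := Real.rpow_nonneg hs.1.le _
  have h2 : 0 ≤ ρ * s ^ (-b) := mul_nonneg hρ (Real.rpow_nonneg hs.1.le _)
  rw [Real.norm_of_nonneg (le_min h1 h2)]
  exact min_le_left _ _

/-- `∫ min (r ^ (-a), ρ r ^ (-b)) dr ≤ C ρ ^ ((1 - a) / (b - a))` for `a < 1 < b`. -/
lemma setIntegral_min_rpow_le {a b ρ : ℝ} (ha1 : a < 1) (hb : 1 < b) (hρ : 0 < ρ) (t : ℝ) :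
    ∫ r in Ioo 0 t, min (r ^ (-a)) (ρ * r ^ (-b)) ≤
      (1 / (1 - a) + 1 / (b - 1)) * ρ ^ ((1 - a) / (b - a)) := by
  -- The point where `r ^ (-a)` and `ρ r ^ (-b)` cross; each is integrated on the side where it is
  -- integrable.
  set R := ρ ^ (1 / (b - a)) with hR
  have hba : b - a ≠ 0 := by linarith
  have hR0 : 0 < R := Real.rpow_pos_of_pos hρ _
  set f : ℝ → ℝ := fun r => min (r ^ (-a)) (ρ * r ^ (-b)) with hf
  have hf0 : ∀ r, 0 < r → 0 ≤ f r := fun r hr => le_min (Real.rpow_nonneg hr.le _)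
    (mul_nonneg hρ.le (Real.rpow_nonneg hr.le _))
  have hm : Measurable f := by fun_prop
  have i1 : IntegrableOn (fun r : ℝ => r ^ (-a)) (Ioc 0 R) :=
    (integrableOn_Ioc_iff_integrableOn_Ioo).2 (integrableOn_rpow_neg ha1 R)
  have i2 : IntegrableOn (fun r : ℝ => ρ * r ^ (-b)) (Ioi R) :=
    (integrableOn_Ioi_rpow_of_lt (by linarith) hR0).const_mul ρ
  have l1 : ∀ᵐ r ∂volume.restrict (Ioc 0 R), f r ≤ r ^ (-a) :=
    Eventually.of_forall fun r => min_le_left _ _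
  have l2 : ∀ᵐ r ∂volume.restrict (Ioi R), f r ≤ ρ * r ^ (-b) :=
    Eventually.of_forall fun r => min_le_right _ _
  have j1 : IntegrableOn f (Ioc 0 R) := i1.mono' hm.aestronglyMeasurable
    ((ae_restrict_iff' measurableSet_Ioc).2 (Eventually.of_forall fun r hr => by
      rw [Real.norm_of_nonneg (hf0 r hr.1)]; exact min_le_left _ _))
  have j2 : IntegrableOn f (Ioi R) := i2.mono' hm.aestronglyMeasurable
    ((ae_restrict_iff' measurableSet_Ioi).2 (Eventually.of_forall fun r hr => by
      rw [Real.norm_of_nonneg (hf0 r (hR0.trans hr))]; exact min_le_right _ _))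
  have j : IntegrableOn f (Ioi 0) := by
    rw [← Ioc_union_Ioi_eq_Ioi hR0.le]; exact j1.union j2
  have k1 : ∫ r in Ioc 0 R, r ^ (-a) = ρ ^ ((1 - a) / (b - a)) / (1 - a) := by
    rw [integral_Ioc_eq_integral_Ioo, setIntegral_rpow_neg ha1 hR0.le, hR, ← Real.rpow_mul hρ.le]
    congr 2
    ring
  have k2 : ∫ r in Ioi R, ρ * r ^ (-b) = ρ ^ ((1 - a) / (b - a)) / (b - 1) := by
    rw [integral_const_mul, integral_Ioi_rpow_of_lt (by linarith) hR0, hR, ← Real.rpow_mul hρ.le]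
    have : (1 - a) / (b - a) = 1 + 1 / (b - a) * (-b + 1) := by field_simp; ring
    rw [this, Real.rpow_add hρ, Real.rpow_one]
    have h1 : -b + 1 ≠ 0 := by linarith
    have h2 : b - 1 ≠ 0 := by linarith
    field_simp
    ring
  calc ∫ r in Ioo 0 t, f r ≤ ∫ r in Ioi 0, f r :=
        setIntegral_mono_set j ((ae_restrict_iff' measurableSet_Ioi).2 (Eventually.of_forall hf0))
          (Eventually.of_forall fun r hr => hr.1)
    _ = (∫ r in Ioc 0 R, f r) + ∫ r in Ioi R, f r := by
        rw [← setIntegral_union (Ioc_disjoint_Ioi le_rfl) measurableSet_Ioi j1 j2,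
          Ioc_union_Ioi_eq_Ioi hR0.le]
    _ ≤ (∫ r in Ioc 0 R, r ^ (-a)) + ∫ r in Ioi R, ρ * r ^ (-b) :=
        add_le_add (integral_mono_ae j1 i1 l1) (integral_mono_ae j2 i2 l2)
    _ = _ := by rw [k1, k2]; ring

/-- The interpolation integral in the presence of a weight singular at `s = 0`. Near `s = 0` the
minimum is at most a multiple of `ρ`, and `ρ ≤ ρ ^ ((1 - a) / (b - a))` because `ρ ≤ 1` and the
exponent is at most one. The constant may depend on `t`. -/
lemma setIntegral_rpow_neg_mul_min_le {κ a b t : ℝ} (hκ : 0 ≤ κ) (hκ1 : κ < 1) (ha : 0 ≤ a)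
    (ha1 : a < 1) (hb : 1 < b) (ht : 0 < t) :
    ∃ C, 0 ≤ C ∧ ∀ ρ, 0 < ρ → ρ ≤ 1 →
      IntegrableOn (fun s => s ^ (-κ) * min ((t - s) ^ (-a)) (ρ * (t - s) ^ (-b))) (Ioo 0 t) ∧
      ∫ s in Ioo 0 t, s ^ (-κ) * min ((t - s) ^ (-a)) (ρ * (t - s) ^ (-b)) ≤
        C * ρ ^ ((1 - a) / (b - a)) := by
  have h1a : 0 < 1 - a := by linarith
  have hb1 : 0 < b - 1 := by linarith
  have hκ' : 0 < 1 - κ := by linarith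
  have ht2 : 0 < t / 2 := by linarith
  refine ⟨(t / 2) ^ (-κ) * (1 / (1 - a) + 1 / (b - 1)) +
    (t / 2) ^ (-b) * (t ^ (1 - κ) / (1 - κ)), by positivity, fun ρ hρ hρ1 => ?_⟩
  obtain ⟨h1, h2⟩ := integrableOn_rpow_neg_mul
    (φ := fun r => min (r ^ (-a)) (ρ * r ^ (-b))) (t := t) hκ hκ1
    (fun r hr => le_min (Real.rpow_nonneg hr.le _) (mul_nonneg hρ.le (Real.rpow_nonneg hr.le _)))
    (antitoneOn_min_rpow ha (by linarith) hρ.le) (integrableOn_min_rpow ha1 hρ.le t)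
  refine ⟨h1, h2.trans ?_⟩
  rw [setIntegral_rpow_neg hκ1 ht.le]
  have h3 := setIntegral_min_rpow_le ha1 hb hρ t
  have h4 : ρ ≤ ρ ^ ((1 - a) / (b - a)) := by
    have : (1 - a) / (b - a) ≤ 1 := by rw [div_le_one (by linarith)]; linarith
    simpa using Real.rpow_le_rpow_of_exponent_ge hρ hρ1 this
  have h5 : min ((t / 2) ^ (-a)) (ρ * (t / 2) ^ (-b)) ≤
      ρ ^ ((1 - a) / (b - a)) * (t / 2) ^ (-b) :=
    (min_le_right _ _).trans (mul_le_mul_of_nonneg_right h4 (Real.rpow_nonneg ht2.le _))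
  have h6 := mul_le_mul_of_nonneg_left h3 (Real.rpow_nonneg ht2.le (-κ))
  have h7 := mul_le_mul_of_nonneg_right h5 (show 0 ≤ t ^ (1 - κ) / (1 - κ) by positivity)
  linarith

/-- The weighted singular integral of the Gronwall argument is small for large `lam`. -/
lemma exists_setIntegral_exp_rpow_le {κ : ℝ} (hκ : 0 ≤ κ) (hκ1 : κ < 1) {ε : ℝ} (hε : 0 < ε) :
    ∃ lam : ℝ, 0 < lam ∧ ∀ t, 0 < t →
      IntegrableOn (fun s => s ^ (-κ) * (Real.exp (-lam * (t - s)) * (t - s) ^ (-κ))) (Ioo 0 t) ∧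
      t ^ κ * ∫ s in Ioo 0 t, s ^ (-κ) * (Real.exp (-lam * (t - s)) * (t - s) ^ (-κ)) ≤ ε := by
  have hκ' : 0 < 1 - κ := by linarith
  -- The two summands come from the two halves of the split at `t / 2`; the weighted integral is at
  -- most `C * lam ^ (-(1 - κ))`, uniformly in `t`.
  set C : ℝ := 2 ^ κ * Real.Gamma (1 - κ) + 2 ^ κ * (2 / (1 - κ)) with hC
  have hlim : Tendsto (fun lam : ℝ => C * lam ^ (-(1 - κ))) atTop (𝓝 (C * 0)) :=
    (tendsto_rpow_neg_atTop hκ').const_mul C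
  rw [mul_zero] at hlim
  obtain ⟨lam, hlam, hl0⟩ := ((hlim.eventually (eventually_le_nhds hε)).and
    (eventually_gt_atTop 0)).exists
  refine ⟨lam, hl0, fun t ht => ?_⟩
  have ht2 : 0 < t / 2 := by linarith
  set φ : ℝ → ℝ := fun r => Real.exp (-lam * r) * r ^ (-κ) with hφ
  have hφ0 : ∀ r, 0 < r → 0 ≤ φ r := fun r hr => by positivity
  have hanti : AntitoneOn φ (Ioi 0) := by
    intro x hx y hy hxy
    have h1 : Real.exp (-lam * y) ≤ Real.exp (-lam * x) := Real.exp_le_exp.2 (by nlinarith)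
    exact mul_le_mul h1 (antitoneOn_rpow_neg hκ hx hy hxy) (Real.rpow_nonneg (le_of_lt hy) _)
      (Real.exp_pos _).le
  have hG := Real.integral_rpow_mul_exp_neg_mul_Ioi (a := 1 - κ) (r := lam) hκ' hl0
  have hφI : ∫ r in Ioi 0, φ r = lam ^ (-(1 - κ)) * Real.Gamma (1 - κ) := by
    rw [one_div, Real.inv_rpow hl0.le, ← Real.rpow_neg hl0.le] at hG
    rw [← hG]
    refine integral_congr_ae (Eventually.of_forall fun r => ?_)
    simp only [hφ]
    rw [mul_comm, neg_mul]
    congr 2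
    ring
  have hφi : IntegrableOn φ (Ioi 0) := by
    -- A non-integrable function has integral `0` by convention, but this integral equals a positive
    -- Gamma value.
    by_contra hcon
    have h0 := integral_undef hcon
    rw [hφI] at h0
    exact (mul_pos (Real.rpow_pos_of_pos hl0 _) (Real.Gamma_pos_of_pos hκ')).ne' h0
  obtain ⟨h1, h2⟩ := integrableOn_rpow_neg_mul (t := t) hκ hκ1 hφ0 hanti
    (hφi.mono_set fun r hr => hr.1)
  refine ⟨h1, ?_⟩
  have h3 : ∫ r in Ioo 0 t, φ r ≤ lam ^ (-(1 - κ)) * Real.Gamma (1 - κ) := by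
    rw [← hφI]
    exact setIntegral_mono_set hφi
      ((ae_restrict_iff' measurableSet_Ioi).2 (Eventually.of_forall hφ0))
      (Eventually.of_forall fun r hr => hr.1)
  rw [setIntegral_rpow_neg hκ1 ht.le] at h2
  have h4 : t ^ κ * (t / 2) ^ (-κ) = 2 ^ κ := by
    rw [Real.div_rpow ht.le zero_le_two, Real.rpow_neg zero_le_two, div_inv_eq_mul, ← mul_assoc,
      ← Real.rpow_add ht, add_neg_cancel, Real.rpow_zero, one_mul]
  -- With `x = lam * t` this is `exp(-x/2) x^(1-κ) ≤ exp(-x/2) (1 + x) ≤ 2`.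
  have h5 : Real.exp (-lam * (t / 2)) * t ^ (1 - κ) ≤ 2 * lam ^ (-(1 - κ)) := by
    have hx : 0 < lam * t := mul_pos hl0 ht
    have e1 : t ^ (1 - κ) = (lam * t) ^ (1 - κ) * lam ^ (-(1 - κ)) := by
      rw [Real.mul_rpow hl0.le ht.le, mul_right_comm, ← Real.rpow_add hl0]
      simp
    have e2 : (lam * t) ^ (1 - κ) ≤ 1 + lam * t := by
      have := Real.rpow_le_rpow hx.le (by linarith : lam * t ≤ 1 + lam * t) hκ'.le
      refine this.trans ?_
      simpa using Real.rpow_le_rpow_of_exponent_le (by linarith : 1 ≤ 1 + lam * t)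
        (by linarith : 1 - κ ≤ 1)
    have e3 : Real.exp (-lam * (t / 2)) * (1 + lam * t) ≤ 2 := by
      have := Real.add_one_le_exp (lam * t / 2)
      have e4 : -lam * (t / 2) = -(lam * t / 2) := by ring
      rw [e4, Real.exp_neg, inv_mul_le_iff₀ (Real.exp_pos _)]
      linarith
    rw [e1, ← mul_assoc]
    refine mul_le_mul_of_nonneg_right ?_ (Real.rpow_nonneg hl0.le _)
    exact (mul_le_mul_of_nonneg_left e2 (Real.exp_pos _).le).trans e3
  have h6 : t ^ κ * (φ (t / 2) * (t ^ (1 - κ) / (1 - κ))) ≤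
      2 ^ κ * (2 / (1 - κ)) * lam ^ (-(1 - κ)) := by
    have : t ^ κ * (φ (t / 2) * (t ^ (1 - κ) / (1 - κ))) =
        t ^ κ * (t / 2) ^ (-κ) * (Real.exp (-lam * (t / 2)) * t ^ (1 - κ)) / (1 - κ) := by
      simp only [hφ]; ring
    rw [this, h4]
    have := mul_le_mul_of_nonneg_left h5 (show (0 : ℝ) ≤ 2 ^ κ by positivity)
    calc _ ≤ 2 ^ κ * (2 * lam ^ (-(1 - κ))) / (1 - κ) := div_le_div_of_nonneg_right this hκ'.le
      _ = _ := by ring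
  have h7 : t ^ κ * ((t / 2) ^ (-κ) * ∫ r in Ioo 0 t, φ r) ≤
      2 ^ κ * (lam ^ (-(1 - κ)) * Real.Gamma (1 - κ)) := by
    rw [← mul_assoc, h4]
    exact mul_le_mul_of_nonneg_left h3 (by positivity)
  calc _ ≤ t ^ κ * ((t / 2) ^ (-κ) * (∫ r in Ioo 0 t, φ r) + φ (t / 2) * (t ^ (1 - κ) / (1 - κ))) :=
        mul_le_mul_of_nonneg_left h2 (by positivity)
    _ ≤ C * lam ^ (-(1 - κ)) := by rw [mul_add, hC]; linarith
    _ ≤ ε := hlam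

end SingularIntegrals

/-! ### Continuity and measurability in time -/

section Time

variable {E V W : Type} [NormedAddCommGroup E] [NormedSpace ℝ E] [FiniteDimensional ℝ E]
  [MeasurableSpace E] [BorelSpace E]
  [NormedAddCommGroup V] [NormedSpace ℝ V] [FiniteDimensional ℝ V]
  [NormedAddCommGroup W] [NormedSpace ℝ W] [CompleteSpace W]

/-- The modulus of continuity at `0` of a heat flow. -/
noncomputable def heatModulus (K : ℝ → Measure E) (h : ℝ) : ℝ := ∫ y, min 1 ‖y‖ ∂(K h)

lemma heatModulus_nonneg (K : ℝ → Measure E) (h : ℝ) : 0 ≤ heatModulus K h :=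
  integral_nonneg fun _ => le_min zero_le_one (norm_nonneg _)

/-- The increment `f (x - y) - f x` is at most `min (2M) (Λ‖y‖) ≤ (2M + Λ) min 1 ‖y‖`, which is then
integrated in `y`. -/
lemma norm_convFun_sub_le {K : ℝ → Measure E} {h : ℝ} [IsProbabilityMeasure (K h)] {f : E → W}
    {M Λ : ℝ} (hΛ : 0 ≤ Λ) (hf : IsBC M f) (hl : ∀ x y, ‖f (x - y) - f x‖ ≤ Λ * ‖y‖) (x : E) :
    ‖convFun (K h) f x - f x‖ ≤ (2 * M + Λ) * heatModulus K h := by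
  have hM := hf.nonneg
  have h1 : convFun (K h) f x - f x = ∫ y, (f (x - y) - f x) ∂(K h) := by
    rw [integral_sub (hf.integrable x) (integrable_const _)]
    simp [convFun]
  have hi : Integrable (fun y : E => min 1 ‖y‖) (K h) := by
    refine (integrable_const (1 : ℝ)).mono' (by fun_prop) (Eventually.of_forall fun y => ?_)
    rw [Real.norm_of_nonneg (le_min zero_le_one (norm_nonneg _))]
    exact min_le_left _ _
  rw [h1, heatModulus, ← integral_const_mul]
  refine norm_integral_le_of_norm_le (hi.const_mul _) (Eventually.of_forall fun y => ?_)
  rcases le_total 1 ‖y‖ with h2 | h2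
  · rw [min_eq_left h2]
    have := norm_sub_le (f (x - y)) (f x)
    linarith [hf.2 (x - y), hf.2 x]
  · rw [min_eq_right h2]
    nlinarith [hl x y, norm_nonneg y, mul_nonneg hM (norm_nonneg y)]

/-- Continuity in time, uniformly in space. -/
def UnifContInTime (T : ℝ) (G : ℝ → E → W) : Prop :=
  ∀ t ∈ Ioc 0 T, ∀ ε > 0, ∀ᶠ s in 𝓝[Ioc 0 T] t, ∀ x, ‖G s x - G t x‖ ≤ ε

/-- A forward modulus valid from time `δ` on gives two-sided continuity at `t`: for `s < t` the
increment is read forward from `s`, and `δ = t / 2` stays below all nearby times. -/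
lemma unifContInTime_of_modulus {T : ℝ} {G : ℝ → E → W}
    (h : ∀ δ > 0, ∃ m : ℝ → ℝ, Tendsto m (𝓝[>] 0) (𝓝 0) ∧
      ∀ t h, δ ≤ t → 0 < h → t + h ≤ T → ∀ x, ‖G (t + h) x - G t x‖ ≤ m h) :
    UnifContInTime T G := by
  intro t ht ε hε
  obtain ⟨m, hm, hG⟩ := h (t / 2) (by linarith [ht.1])
  have h1 := hm.eventually (eventually_le_nhds hε)
  rw [eventually_nhdsWithin_iff, Metric.eventually_nhds_iff] at h1
  obtain ⟨η, hη, h1⟩ := h1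
  have h2 : ∀ᶠ s in 𝓝[Ioc 0 T] t, dist s t < min η (t / 2) :=
    nhdsWithin_le_nhds (Metric.ball_mem_nhds t (lt_min hη (by linarith [ht.1])))
  filter_upwards [h2, self_mem_nhdsWithin] with s hs hsT x
  have hs1 := hs.trans_le (min_le_left _ _)
  have hs2 := abs_lt.1 (hs.trans_le (min_le_right _ _))
  rcases lt_trichotomy s t with hst | hst | hst
  · have := hG s (t - s) (by linarith) (by linarith) (by linarith [ht.2]) x
    rw [add_sub_cancel, norm_sub_rev] at this
    refine this.trans (h1 ?_ (sub_pos.2 hst))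
    rwa [dist_zero_right, ← dist_eq_norm, dist_comm]
  · rw [hst, sub_self, norm_zero]
    exact hε.le
  · have := hG t (s - t) (by linarith [ht.1]) (by linarith) (by linarith [hsT.2]) x
    rw [add_sub_cancel] at this
    refine this.trans (h1 ?_ (sub_pos.2 hst))
    rwa [dist_zero_right, ← dist_eq_norm]

lemma UnifContInTime.add {T : ℝ} {G G' : ℝ → E → W} (h : UnifContInTime T G)
    (h' : UnifContInTime T G') : UnifContInTime T (fun t x => G t x + G' t x) := by
  intro t ht ε hε
  filter_upwards [h t ht (ε / 2) (by linarith), h' t ht (ε / 2) (by linarith)] with s h1 h2 x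
  rw [add_sub_add_comm]
  exact (norm_add_le _ _).trans (by linarith [h1 x, h2 x])

lemma UnifContInTime.continuousOn {T : ℝ} {G : ℝ → E → W} (h : UnifContInTime T G)
    (hc : ∀ t ∈ Ioc 0 T, Continuous (G t)) :
    ContinuousOn (fun q : ℝ × E => G q.1 q.2) (Ioc 0 T ×ˢ univ) := by
  rintro ⟨t, x⟩ ⟨ht, -⟩
  rw [ContinuousWithinAt, nhdsWithin_prod_eq, nhdsWithin_univ, Metric.tendsto_nhds]
  intro ε hε
  have h1 := h t ht (ε / 3) (by linarith)
  have h2 := Metric.tendsto_nhds.1 ((hc t ht).tendsto x) (ε / 3) (by linarith)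
  filter_upwards [h1.prod_mk h2] with q hq
  have h3 := hq.1 q.2
  have h4 := hq.2
  rw [dist_eq_norm] at h4 ⊢
  have := norm_add_le (G q.1 q.2 - G t q.2) (G t q.2 - G t x)
  rw [sub_add_sub_cancel] at this
  linarith

variable {T α c A B a b : ℝ} {K : ℝ → Measure E} {J : V →L[ℝ] E}

/-- By the flow property `G (t + h)` is `K h * G t`, and `G t` is Lipschitz because its full
derivative is bounded. -/
lemma IsHeatFamily.norm_sub_le (hK : IsHeatFlow T K) {G : ℝ → E → W} {G' : ℝ → E → E →L[ℝ] W}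
    (hG : IsHeatFamily T K A a G) (hG' : IsHeatFamily T K B b G')
    (hd : ∀ t ∈ Ioc 0 T, HasDirFDeriv (ContinuousLinearMap.id ℝ E) (G t) (G' t))
    {t h : ℝ} (ht : 0 < t) (hh : 0 ≤ h) (hth : t + h ≤ T) (x : E) :
    ‖G (t + h) x - G t x‖ ≤ (2 * (A * t ^ (-a)) + B * t ^ (-b)) * heatModulus K h := by
  have htT : t ∈ Ioc 0 T := ⟨ht, by linarith⟩
  have := hK.prob h ⟨hh, by linarith⟩
  rw [add_comm t h, hG.flow h t hh ht (by linarith)]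
  refine norm_convFun_sub_le (hG'.bc t htT).nonneg (hG.bc t htT) (fun x y => ?_) x
  have := (hd t htT).norm_sub_le (hG'.bc t htT).2 x (-y)
  simpa [sub_eq_add_neg] using this

lemma IsHeatFamily.unifContInTime (hK : IsHeatFlow T K) {G : ℝ → E → W}
    {G' : ℝ → E → E →L[ℝ] W} (ha : 0 ≤ a) (hb : 0 ≤ b) (hA : 0 ≤ A) (hB : 0 ≤ B)
    (hG : IsHeatFamily T K A a G) (hG' : IsHeatFamily T K B b G')
    (hd : ∀ t ∈ Ioc 0 T, HasDirFDeriv (ContinuousLinearMap.id ℝ E) (G t) (G' t)) :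
    UnifContInTime T G := by
  refine unifContInTime_of_modulus fun δ hδ =>
    ⟨fun h => (2 * (A * δ ^ (-a)) + B * δ ^ (-b)) * heatModulus K h, ?_, ?_⟩
  · simpa [heatModulus] using hK.tendsto.const_mul (2 * (A * δ ^ (-a)) + B * δ ^ (-b))
  · intro t h hδt hh hth x
    refine (hG.norm_sub_le hK hG' hd (hδ.trans_le hδt) hh.le hth x).trans
      (mul_le_mul_of_nonneg_right ?_ (heatModulus_nonneg K h))
    have h1 := antitoneOn_rpow_neg ha hδ (hδ.trans_le hδt : t ∈ Ioi 0) hδt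
    have h2 := antitoneOn_rpow_neg hb hδ (hδ.trans_le hδt : t ∈ Ioi 0) hδt
    have h3 := mul_le_mul_of_nonneg_left h1 hA
    have h4 := mul_le_mul_of_nonneg_left h2 hB
    simp only at h3 h4
    linarith

/-- The integral of `f` is the convolution with the reflected function at `0`. By the semigroup law
its increment from `t` to `t + h` is a contraction applied to the increment from `0` to `h`, so no
smoothing is needed. -/
lemma IsHeatFlow.continuousOn_integral (hK : IsHeatFlow T K) {f : E → ℝ} {M Λ : ℝ} (hΛ : 0 ≤ Λ)
    (hf : IsBC M f) (hl : ∀ x y, ‖f (x - y) - f x‖ ≤ Λ * ‖y‖) :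
    ContinuousOn (fun r => ∫ y, f y ∂(K r)) (Ioc 0 T) := by
  have hfn : IsBC M (fun y => f (-y)) := ⟨hf.1.comp continuous_neg, fun y => hf.2 _⟩
  have hu : UnifContInTime T (fun t => convFun (K t) (fun y => f (-y))) := by
    refine unifContInTime_of_modulus fun δ hδ =>
      ⟨fun h => (2 * M + Λ) * heatModulus K h, ?_, ?_⟩
    · simpa [heatModulus] using hK.tendsto.const_mul (2 * M + Λ)
    · intro t h hδt hh hth x
      have ht0 : 0 < t := hδ.trans_le hδt
      have := hK.prob t ⟨ht0.le, by linarith⟩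
      have := hK.prob h ⟨hh.le, by linarith⟩
      have hlip : ∀ x, ‖convFun (K h) (fun y => f (-y)) x - f (-x)‖ ≤
          (2 * M + Λ) * heatModulus K h :=
        norm_convFun_sub_le hΛ hfn (fun x y => by
          have := hl (-x) (-y)
          simpa [neg_add_eq_sub, add_comm, sub_eq_add_neg] using this)
      have hbc : IsBC ((2 * M + Λ) * heatModulus K h)
          (fun x => convFun (K h) (fun y => f (-y)) x - f (-x)) :=
        ⟨(hfn.conv (ν := K h)).1.sub hfn.1, hlip⟩
      have h2 := (hbc.conv (ν := K t)).2 x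
      rw [convFun_sub (hfn.conv (ν := K h)) hfn] at h2
      simp only [hK.conv_eq t h ht0.le hh.le hth, convFun_conv hfn]
      exact h2
  have hc := hu.continuousOn (fun t ht => by
    have := hK.prob t ⟨ht.1.le, ht.2⟩
    exact (hfn.conv (ν := K t)).1)
  have h0 : ContinuousOn (fun r => convFun (K r) (fun y => f (-y)) 0) (Ioc 0 T) :=
    hc.comp (f := fun r : ℝ => (r, (0 : E))) (by fun_prop) (fun r hr => ⟨hr, mem_univ _⟩)
  simpa [convFun] using h0

open Classical in
/-- A heat flow is measurable in time. -/
lemma IsHeatFlow.measurable (hK : IsHeatFlow T K) :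
    Measurable (fun r => if r ∈ Ioc 0 T then K r else Measure.dirac 0) := by
  have hp : ∀ r, IsProbabilityMeasure (if r ∈ Ioc 0 T then K r else Measure.dirac (0 : E)) := by
    intro r
    split_ifs with hr
    exacts [hK.prob r ⟨hr.1.le, hr.2⟩, inferInstance]
  -- It suffices to test closed sets, whose indicators are limits of the Lipschitz functions
  -- `thickenedIndicator`; their integrals are continuous in time on `(0, T]`.
  refine Measurable.measure_of_isPiSystem_of_isProbabilityMeasure
    (S := {F : Set E | IsClosed F}) ?_ isPiSystem_isClosed fun F hF => ?_
  · rw [BorelSpace.measurable_eq (α := E), borel_eq_generateFrom_isClosed]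
  have hδ : ∀ n : ℕ, (0 : ℝ) < 1 / ((n : ℝ) + 1) := fun n => by positivity
  refine measurable_of_tendsto_metrizable (f := fun (n : ℕ) r =>
    ∫⁻ y, (thickenedIndicator (hδ n) F y : ENNReal)
      ∂(if r ∈ Ioc 0 T then K r else Measure.dirac (0 : E))) (fun n => ?_) ?_
  · set f : E → ℝ := fun y => (thickenedIndicator (hδ n) F y : ℝ) with hf
    have hL := lipschitzWith_thickenedIndicator (hδ n) F
    have hfc : Continuous f := NNReal.continuous_coe.comp hL.continuous
    have hbc : IsBC 1 f := ⟨hfc, fun y => by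
      rw [Real.norm_of_nonneg (NNReal.coe_nonneg _)]
      exact_mod_cast thickenedIndicator_le_one (hδ n) F y⟩
    have hcont := hK.continuousOn_integral (NNReal.coe_nonneg _) hbc (fun x y => by
      have := hL.dist_le_mul (x - y) x
      rw [NNReal.dist_eq, dist_eq_norm, sub_sub_cancel_left, norm_neg] at this
      exact this)
    have hme : Measurable (fun r => if r ∈ Ioc 0 T then ∫ y, f y ∂(K r) else
        ∫ y, f y ∂(Measure.dirac 0)) := by
      have := hcont.measurable_piecewise (g := fun _ => ∫ y, f y ∂(Measure.dirac 0))
        continuousOn_const measurableSet_Ioc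
      exact this
    convert hme.ennreal_ofReal using 2 with r
    have hi : Integrable f (if r ∈ Ioc 0 T then K r else Measure.dirac (0 : E)) := by
      have := hp r
      exact (integrable_const (1 : ℝ)).mono' hfc.aestronglyMeasurable (Eventually.of_forall hbc.2)
    have h1 := ofReal_integral_eq_lintegral_ofReal hi
      (Eventually.of_forall fun y => NNReal.coe_nonneg _)
    simp only [hf, ENNReal.ofReal_coe_nnreal] at h1
    rw [← h1]
    split_ifs <;> rfl
  · rw [tendsto_pi_nhds]
    intro r
    have := hp r
    exact tendsto_lintegral_thickenedIndicator_of_isClosed _ hF hδ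
      tendsto_one_div_add_atTop_nhds_zero_nat

/-- Being measurable in time, the heat flow run backwards from `t` is a Markov kernel, and integrals
against kernels are measurable in the parameter. -/
lemma IsHeatFlow.aestronglyMeasurable_convFun (hK : IsHeatFlow T K) {g : ℝ → E → W}
    (hg : StronglyMeasurable (Function.uncurry g)) {t : ℝ} (ht : t ∈ Ioc 0 T) (x : E) :
    AEStronglyMeasurable (fun s => convFun (K (t - s)) (g s) x) (volume.restrict (Ioo 0 t)) := by
  classical
  let k : ProbabilityTheory.Kernel ℝ E :=
    ⟨fun s => if t - s ∈ Ioc 0 T then K (t - s) else Measure.dirac 0,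
      hK.measurable.comp (measurable_const.sub measurable_id)⟩
  have hk : ProbabilityTheory.IsMarkovKernel k := ⟨fun s => by
    change IsProbabilityMeasure (if t - s ∈ Ioc 0 T then K (t - s) else Measure.dirac (0 : E))
    split_ifs with hr
    exacts [hK.prob _ ⟨hr.1.le, hr.2⟩, inferInstance]⟩
  have h1 : StronglyMeasurable (Function.uncurry fun s y => g s (x - y)) :=
    hg.comp_measurable (g := fun q : ℝ × E => (q.1, x - q.2)) (by fun_prop)
  have h2 := h1.integral_kernel_prod_right (κ := k)
  refine h2.aestronglyMeasurable.congr ((ae_restrict_iff' measurableSet_Ioo).2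
    (Eventually.of_forall fun s hs => ?_))
  have h3 : k s = K (t - s) :=
    if_pos (⟨by linarith [hs.2], by linarith [hs.1, ht.2]⟩ : t - s ∈ Ioc 0 T)
  simp only [h3, convFun]

end Time

/-! ### Duhamel integrals -/

section Duhamel

/-- Each directional derivative is an almost everywhere limit of measurable difference quotients,
and in finite dimension the derivative is a finite sum of these. Measurability in time thus passes
to all the derivatives inside Duhamel integrals. -/
lemma aestronglyMeasurable_of_hasFDerivAt {S V W : Type*} [MeasurableSpace S] {μ : Measure S}
    [NormedAddCommGroup V] [NormedSpace ℝ V] [FiniteDimensional ℝ V] [NormedAddCommGroup W]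
    [NormedSpace ℝ W] {F : S → V → W} {F' : S → V →L[ℝ] W}
    (hm : ∀ v, AEStronglyMeasurable (fun s => F s v) μ)
    (hd : ∀ᵐ s ∂μ, HasFDerivAt (F s) (F' s) 0) : AEStronglyMeasurable F' μ := by
  have hdir : ∀ v, AEStronglyMeasurable (fun s => F' s v) μ := by
    intro v
    refine aestronglyMeasurable_of_tendsto_ae atTop
      (f := fun (n : ℕ) s => (n : ℝ) • (F s (0 + (n : ℝ)⁻¹ • v) - F s 0))
      (fun n => ((hm _).sub (hm _)).const_smul _) ?_
    filter_upwards [hd] with s hs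
    exact (hs.lim_real v).comp tendsto_natCast_atTop_atTop
  let b := Module.finBasis ℝ V
  have hF' : F' = fun s => ∑ i, (LinearMap.toContinuousLinearMap (b.coord i)).smulRight
      (F' s (b i)) := by
    funext s
    ext v
    have : F' s v = F' s (∑ i, b.repr v i • b i) := by rw [b.sum_repr]
    rw [this, map_sum]
    simp
  rw [hF']
  refine Finset.aestronglyMeasurable_fun_sum _ fun i _ => ?_
  exact (ContinuousLinearMap.smulRightL ℝ V W
    (LinearMap.toContinuousLinearMap (b.coord i))).continuous.comp_aestronglyMeasurable (hdir (b i))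

variable {E V W : Type} [NormedAddCommGroup E] [NormedSpace ℝ E] [FiniteDimensional ℝ E]
  [MeasurableSpace E] [BorelSpace E]
  [NormedAddCommGroup V] [NormedSpace ℝ V] [FiniteDimensional ℝ V]
  [NormedAddCommGroup W] [NormedSpace ℝ W] [CompleteSpace W]

/-- The integral `∫₀ᵗ F s (t - s) ds`. -/
noncomputable def duhamel (F : ℝ → ℝ → E → W) (t : ℝ) (x : E) : W :=
  ∫ s in Ioo 0 t, F s (t - s) x

/-- A measurable family `F s` of heat families with norm `A s ^ (-κ)`. -/
structure IsDuhamelFamily (T : ℝ) (K : ℝ → Measure E) (A κ a : ℝ) (F : ℝ → ℝ → E → W) : Prop where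
  nonneg : 0 ≤ A
  fam : ∀ s ∈ Ioo 0 T, IsHeatFamily T K (A * s ^ (-κ)) a (F s)
  meas : ∀ t ∈ Ioc 0 T, ∀ x,
    AEStronglyMeasurable (fun s => F s (t - s) x) (volume.restrict (Ioo 0 t))

variable {T α c A B κ a b t : ℝ} {K : ℝ → Measure E} {J : V →L[ℝ] E} {F : ℝ → ℝ → E → W}
  {F' : ℝ → ℝ → E → V →L[ℝ] W}

lemma mem_Ioo_of_mem_Ioo_Ioc {s : ℝ} (ht : t ∈ Ioc 0 T) (hs : s ∈ Ioo 0 t) : s ∈ Ioo 0 T :=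
  ⟨hs.1, hs.2.trans_le ht.2⟩

lemma sub_mem_Ioc {s : ℝ} (ht : t ∈ Ioc 0 T) (hs : s ∈ Ioo 0 t) : t - s ∈ Ioc 0 T :=
  ⟨sub_pos.2 hs.2, by linarith [hs.1, ht.2]⟩

namespace IsDuhamelFamily

lemma norm_le (hF : IsDuhamelFamily T K A κ a F) (ht : t ∈ Ioc 0 T) {s : ℝ} (hs : s ∈ Ioo 0 t)
    (x : E) : ‖F s (t - s) x‖ ≤ A * (s ^ (-κ) * (t - s) ^ (-a)) := by
  rw [← mul_assoc]
  exact ((hF.fam s (mem_Ioo_of_mem_Ioo_Ioc ht hs)).bc _ (sub_mem_Ioc ht hs)).2 x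

lemma ae_norm_le (hF : IsDuhamelFamily T K A κ a F) (ht : t ∈ Ioc 0 T) (x : E) :
    ∀ᵐ s ∂volume.restrict (Ioo 0 t), ‖F s (t - s) x‖ ≤ A * (s ^ (-κ) * (t - s) ^ (-a)) :=
  (ae_restrict_iff' measurableSet_Ioo).2 (Eventually.of_forall fun _ hs => hF.norm_le ht hs x)

lemma integrableOn_bound (A : ℝ) (hκ : 0 ≤ κ) (hκ1 : κ < 1) (ha : 0 ≤ a) (ha1 : a < 1) (t : ℝ) :
    IntegrableOn (fun s => A * (s ^ (-κ) * (t - s) ^ (-a))) (Ioo 0 t) :=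
  (integrableOn_rpow_neg_mul_rpow_neg hκ hκ1 ha ha1 t).const_mul A

lemma integrableOn (hF : IsDuhamelFamily T K A κ a F) (hκ : 0 ≤ κ) (hκ1 : κ < 1) (ha : 0 ≤ a)
    (ha1 : a < 1) (ht : t ∈ Ioc 0 T) (x : E) :
    IntegrableOn (fun s => F s (t - s) x) (Ioo 0 t) :=
  (integrableOn_bound A hκ hκ1 ha ha1 t).mono' (hF.meas t ht x) (hF.ae_norm_le ht x)

lemma isBC_duhamel (hF : IsDuhamelFamily T K A κ a F) (hκ : 0 ≤ κ) (hκ1 : κ < 1) (ha : 0 ≤ a)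
    (ha1 : a < 1) (ht : t ∈ Ioc 0 T) :
    IsBC (A * ∫ s in Ioo 0 t, s ^ (-κ) * (t - s) ^ (-a)) (duhamel F t) := by
  constructor
  · refine continuous_of_dominated (fun x => hF.meas t ht x) (fun x => hF.ae_norm_le ht x)
      (integrableOn_bound A hκ hκ1 ha ha1 t) ((ae_restrict_iff' measurableSet_Ioo).2
        (Eventually.of_forall fun s hs => ?_))
    exact ((hF.fam s (mem_Ioo_of_mem_Ioo_Ioc ht hs)).bc _ (sub_mem_Ioc ht hs)).1
  · intro x
    rw [← integral_const_mul]
    exact norm_integral_le_of_norm_le (integrableOn_bound A hκ hκ1 ha ha1 t) (hF.ae_norm_le ht x)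

/-- Measurability of the derivatives of a Duhamel family. -/
lemma meas_of_hasDirFDeriv (hF : IsDuhamelFamily T K A κ a F)
    (hd : ∀ s ∈ Ioo 0 T, ∀ r ∈ Ioc 0 T, HasDirFDeriv J (F s r) (F' s r)) (ht : t ∈ Ioc 0 T)
    (x : E) : AEStronglyMeasurable (fun s => F' s (t - s) x) (volume.restrict (Ioo 0 t)) :=
  aestronglyMeasurable_of_hasFDerivAt (F := fun s v => F s (t - s) (x + J v))
    (fun _ => hF.meas t ht _) ((ae_restrict_iff' measurableSet_Ioo).2
      (Eventually.of_forall fun s hs =>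
        hd s (mem_Ioo_of_mem_Ioo_Ioc ht hs) _ (sub_mem_Ioc ht hs) x))

/-- The derivatives of a Duhamel family form a Duhamel family. -/
lemma dirFDeriv (hK : IsHeatFlow T K) (hc : 0 ≤ c) (hS : Smooths T α c K J)
    (hF : IsDuhamelFamily T K A κ a F) :
    (∀ s ∈ Ioo 0 T, ∀ r ∈ Ioc 0 T, HasDirFDeriv J (F s r) (dirFDeriv J (F s r))) ∧
      IsDuhamelFamily T K (c * A * 2 ^ (a + 1 / α)) κ (a + 1 / α)
        (fun s r => dirFDeriv J (F s r)) := by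
  have hd : ∀ s ∈ Ioo 0 T, ∀ r ∈ Ioc 0 T,
      HasDirFDeriv J (F s r) (_root_.dirFDeriv J (F s r)) :=
    fun s hs => ((hF.fam s hs).dirFDeriv hK hS).1
  refine ⟨hd, mul_nonneg (mul_nonneg hc hF.nonneg) (by positivity), fun s hs => ?_,
    fun t ht x => hF.meas_of_hasDirFDeriv hd ht x⟩
  convert ((hF.fam s hs).dirFDeriv hK hS).2 using 1
  ring

/-- Differentiation under the integral. -/
lemma hasDirFDeriv_duhamel (hF : IsDuhamelFamily T K A κ a F) (hF' : IsDuhamelFamily T K B κ b F')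
    (hd : ∀ s ∈ Ioo 0 T, ∀ r ∈ Ioc 0 T, HasDirFDeriv J (F s r) (F' s r))
    (hκ : 0 ≤ κ) (hκ1 : κ < 1) (ha : 0 ≤ a) (ha1 : a < 1) (hb : 0 ≤ b) (hb1 : b < 1)
    (ht : t ∈ Ioc 0 T) : HasDirFDeriv J (duhamel F t) (duhamel F' t) := by
  intro x
  have := hasFDerivAt_integral_of_dominated_of_fderiv_le (𝕜 := ℝ)
    (μ := volume.restrict (Ioo 0 t)) (F := fun v s => F s (t - s) (x + J v))
    (F' := fun v s => F' s (t - s) (x + J v)) (x₀ := 0)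
    (bound := fun s => B * (s ^ (-κ) * (t - s) ^ (-b))) univ_mem
    (Eventually.of_forall fun v => hF.meas t ht _) (hF.integrableOn hκ hκ1 ha ha1 ht _)
    (hF'.meas t ht _)
    ((ae_restrict_iff' measurableSet_Ioo).2 (Eventually.of_forall fun s hs v _ =>
      hF'.norm_le ht hs _))
    (integrableOn_bound B hκ hκ1 hb hb1 t)
    ((ae_restrict_iff' measurableSet_Ioo).2 (Eventually.of_forall fun s hs v _ =>
      (hd s (mem_Ioo_of_mem_Ioo_Ioc ht hs) _ (sub_mem_Ioc ht hs)).hasFDerivAt x v))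
  simpa [duhamel] using this

/-- Hölder continuity of a Duhamel integral whose derivative is not integrable. -/
lemma exists_holder_duhamel (hF : IsDuhamelFamily T K A κ a F)
    (hF' : IsDuhamelFamily T K B κ b F')
    (hd : ∀ s ∈ Ioo 0 T, ∀ r ∈ Ioc 0 T, HasDirFDeriv J (F s r) (F' s r))
    (hκ : 0 ≤ κ) (hκ1 : κ < 1) (ha : 0 ≤ a) (ha1 : a < 1) (hb1 : 1 < b) (ht : t ∈ Ioc 0 T) :
    ∃ C, 0 ≤ C ∧ ∀ x v, ‖v‖ ≤ 1 →
      ‖duhamel F t (x + J v) - duhamel F t x‖ ≤ C * ‖v‖ ^ ((1 - a) / (b - a)) := by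
  -- The increment of the integrand is bounded both by its size and by `‖v‖` times its derivative;
  -- the minimum of the two is integrated with `ρ = ‖v‖`.
  obtain ⟨C, hC, h⟩ := setIntegral_rpow_neg_mul_min_le hκ hκ1 ha ha1 hb1 ht.1
  have hA := hF.nonneg
  have hB := hF'.nonneg
  refine ⟨(2 * A + B) * C, by positivity, fun x v hv => ?_⟩
  rcases eq_or_ne v 0 with rfl | hv0
  · simp only [map_zero, add_zero, sub_self, norm_zero]
    positivity
  obtain ⟨h1, h2⟩ := h ‖v‖ (norm_pos_iff.2 hv0) hv
  have hi := hF.integrableOn hκ hκ1 ha ha1 ht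
  have h3 : duhamel F t (x + J v) - duhamel F t x =
      ∫ s in Ioo 0 t, (F s (t - s) (x + J v) - F s (t - s) x) :=
    (integral_sub (hi _) (hi _)).symm
  rw [h3, mul_assoc]
  refine le_trans ?_ (mul_le_mul_of_nonneg_left h2 (by positivity))
  rw [← integral_const_mul]
  refine norm_integral_le_of_norm_le (h1.const_mul _)
    ((ae_restrict_iff' measurableSet_Ioo).2 (Eventually.of_forall fun s hs => ?_))
  have hsT := mem_Ioo_of_mem_Ioo_Ioc ht hs
  have htsT := sub_mem_Ioc ht hs
  have p0 : 0 ≤ s ^ (-κ) := Real.rpow_nonneg hs.1.le _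
  have pa : 0 ≤ (t - s) ^ (-a) := Real.rpow_nonneg htsT.1.le _
  have pb : 0 ≤ (t - s) ^ (-b) := Real.rpow_nonneg htsT.1.le _
  have b1 : ‖F s (t - s) (x + J v) - F s (t - s) x‖ ≤
      (2 * A + B) * s ^ (-κ) * (t - s) ^ (-a) := by
    refine (norm_sub_le _ _).trans ?_
    have e1 := hF.norm_le ht hs (x + J v)
    have e2 := hF.norm_le ht hs x
    nlinarith [mul_nonneg hB (mul_nonneg p0 pa)]
  have b2 : ‖F s (t - s) (x + J v) - F s (t - s) x‖ ≤
      (2 * A + B) * s ^ (-κ) * (‖v‖ * (t - s) ^ (-b)) := by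
    refine ((hd s hsT _ htsT).norm_sub_le (fun y => hF'.norm_le ht hs y) x v).trans ?_
    nlinarith [mul_nonneg hA (mul_nonneg p0 (mul_nonneg (norm_nonneg v) pb))]
  rw [← mul_assoc, mul_min_of_nonneg _ _ (by positivity)]
  exact le_min b1 b2

/-- Continuity in time of a Duhamel integral. -/
lemma unifContInTime_duhamel (hK : IsHeatFlow T K) {F' : ℝ → ℝ → E → E →L[ℝ] W}
    (hF : IsDuhamelFamily T K A 0 a F) (hF' : IsDuhamelFamily T K B 0 b F')
    (hd : ∀ s ∈ Ioo 0 T, ∀ r ∈ Ioc 0 T,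
      HasDirFDeriv (ContinuousLinearMap.id ℝ E) (F s r) (F' s r))
    (ha : 0 ≤ a) (ha1 : a < 1) :
    UnifContInTime T (duhamel F) := by
  have hA := hF.nonneg
  have hB := hF'.nonneg
  have h1a : 0 < 1 - a := by linarith
  -- The interpolation needs an exponent greater than one, whatever `b` is; raising `b` to `e` costs
  -- a power of `max 1 T`.
  set e : ℝ := max b 2 with he
  have heb : b ≤ e := le_max_left _ _
  have he1 : 1 < e := lt_of_lt_of_le (by norm_num) (le_max_right b 2)
  have hθ : 0 < (1 - a) / (e - a) := div_pos h1a (by linarith)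
  set C : ℝ := 2 * A * (1 + max 1 T ^ (e - a)) + B * max 1 T ^ (e - b) with hC
  have hC0 : 0 ≤ C := by positivity
  refine unifContInTime_of_modulus fun δ hδ => ⟨fun h =>
    C * ((1 / (1 - a) + 1 / (e - 1)) * (heatModulus K h + h) ^ ((1 - a) / (e - a))) +
      A * (h ^ (1 - a) / (1 - a)), ?_, fun t h hδt hh hth x => ?_⟩
  · have h1 : Tendsto (fun h => heatModulus K h + h) (𝓝[>] 0) (𝓝 0) := by
      have := hK.tendsto.add (tendsto_nhdsWithin_of_tendsto_nhds (tendsto_id (α := ℝ))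
        : Tendsto id (𝓝[>] (0 : ℝ)) (𝓝 0))
      simpa [heatModulus] using this
    have h2 := (h1.rpow_const (p := (1 - a) / (e - a)) (Or.inr hθ.le))
    have h3 := (tendsto_nhdsWithin_of_tendsto_nhds (tendsto_id (α := ℝ))
        : Tendsto id (𝓝[>] (0 : ℝ)) (𝓝 0)).rpow_const (p := 1 - a) (Or.inr h1a.le)
    rw [Real.zero_rpow hθ.ne'] at h2
    rw [Real.zero_rpow h1a.ne'] at h3
    have h4 := ((h2.const_mul (1 / (1 - a) + 1 / (e - 1))).const_mul C).add
      ((h3.div_const (1 - a)).const_mul A)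
    simpa using h4
  have ht0 : 0 < t := hδ.trans_le hδt
  have htT : t ∈ Ioc 0 T := ⟨ht0, by linarith⟩
  have hthT : t + h ∈ Ioc 0 T := ⟨by linarith, hth⟩
  -- Adding `h` makes `ρ` positive even if the modulus vanishes.
  set ρ := heatModulus K h + h with hρ
  have hρ0 : 0 < ρ := add_pos_of_nonneg_of_pos (heatModulus_nonneg K h) hh
  have hi1 := hF.integrableOn le_rfl zero_lt_one ha ha1 htT x
  have hi2 := hF.integrableOn le_rfl zero_lt_one ha ha1 hthT x
  have hsplit : Ioo 0 (t + h) = Ioo 0 t ∪ Ico t (t + h) :=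
    (Ioo_union_Ico_eq_Ioo ht0 (by linarith)).symm
  have hdisj : Disjoint (Ioo 0 t) (Ico t (t + h)) :=
    Set.disjoint_left.2 fun s hs hs' => absurd hs.2 (not_lt.2 hs'.1)
  have hi3 : IntegrableOn (fun s => F s (t + h - s) x) (Ioo 0 t) :=
    hi2.mono_set (hsplit ▸ subset_union_left)
  have hi4 : IntegrableOn (fun s => F s (t + h - s) x) (Ico t (t + h)) :=
    hi2.mono_set (hsplit ▸ subset_union_right)
  -- Sources before time `t` are evolved for an extra time `h`, controlled by interpolation; sources
  -- in `[t, t + h)` are new and act on a short interval.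
  have hdec : duhamel F (t + h) x - duhamel F t x =
      (∫ s in Ioo 0 t, (F s (t + h - s) x - F s (t - s) x)) +
        ∫ s in Ico t (t + h), F s (t + h - s) x := by
    unfold duhamel
    rw [integral_sub hi3 hi1, hsplit, setIntegral_union hdisj measurableSet_Ico hi3 hi4]
    abel
  have hfirst : ‖∫ s in Ioo 0 t, (F s (t + h - s) x - F s (t - s) x)‖ ≤
      C * ((1 / (1 - a) + 1 / (e - 1)) * ρ ^ ((1 - a) / (e - a))) := by
    refine le_trans ?_ (mul_le_mul_of_nonneg_left (setIntegral_min_rpow_le ha1 he1 hρ0 t) hC0)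
    rw [← setIntegral_comp_sub_left (fun r => min (r ^ (-a)) (ρ * r ^ (-e))),
      ← integral_const_mul]
    refine norm_integral_le_of_norm_le
      ((integrableOn_comp_sub_left (integrableOn_min_rpow ha1 hρ0.le t)).const_mul C)
      ((ae_restrict_iff' measurableSet_Ioo).2 (Eventually.of_forall fun s hs => ?_))
    have hsT := mem_Ioo_of_mem_Ioo_Ioc htT hs
    have hr := sub_mem_Ioc htT hs
    have e1 : t + h - s = (t - s) + h := by ring
    have hr' : t - s + h ∈ Ioc 0 T := ⟨by linarith [hr.1], by linarith [hs.1]⟩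
    set r := t - s with hrdef
    rw [e1]
    have f1 := hF.fam s hsT
    have f2 := hF'.fam s hsT
    rw [neg_zero, Real.rpow_zero, mul_one] at f1 f2
    have pa : 0 ≤ r ^ (-a) := Real.rpow_nonneg hr.1.le _
    have pe : 0 ≤ r ^ (-e) := Real.rpow_nonneg hr.1.le _
    have hTp : ∀ q : ℝ, 0 ≤ max 1 T ^ q := fun q => by positivity
    have hpow : ∀ q : ℝ, q ≤ e → r ^ (-q) ≤ max 1 T ^ (e - q) * r ^ (-e) := fun q hq => by
      have : r ^ (-q) = r ^ (e - q) * r ^ (-e) := by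
        rw [← Real.rpow_add hr.1]; congr 1; ring
      rw [this]
      exact mul_le_mul_of_nonneg_right (Real.rpow_le_rpow hr.1.le
        (hr.2.trans (le_max_right _ _)) (by linarith)) pe
    rw [mul_min_of_nonneg _ _ hC0]
    refine le_min ?_ ?_
    · refine (norm_sub_le _ _).trans ?_
      have g1 := (f1.bc _ hr').2 x
      have g2 := (f1.bc _ hr).2 x
      have g3 : (r + h) ^ (-a) ≤ r ^ (-a) :=
        antitoneOn_rpow_neg ha hr.1 hr'.1 (by linarith)
      have g4 := mul_le_mul_of_nonneg_left g3 hA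
      have g5 : 0 ≤ (2 * A * max 1 T ^ (e - a) + B * max 1 T ^ (e - b)) * r ^ (-a) := by
        have := hTp (e - a)
        have := hTp (e - b)
        positivity
      rw [hC]
      linarith
    · refine (f1.norm_sub_le hK f2 (hd s hsT) hr.1 hh.le hr'.2 x).trans ?_
      have g1 := mul_le_mul_of_nonneg_left (hpow a (by linarith)) hA
      have g2 := mul_le_mul_of_nonneg_left (hpow b heb) hB
      have g3 : 2 * (A * r ^ (-a)) + B * r ^ (-b) ≤ C * r ^ (-e) := by
        have := mul_nonneg hA pe
        rw [hC]
        linarith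
      have g4 : heatModulus K h ≤ ρ := by linarith
      calc _ ≤ C * r ^ (-e) * ρ :=
            mul_le_mul g3 g4 (heatModulus_nonneg K h) (mul_nonneg hC0 pe)
        _ = _ := by ring
  have hsecond : ‖∫ s in Ico t (t + h), F s (t + h - s) x‖ ≤ A * (h ^ (1 - a) / (1 - a)) := by
    rw [← setIntegral_rpow_neg ha1 hh.le, ← setIntegral_comp_sub_left (fun r => r ^ (-a)),
      ← integral_const_mul]
    have hsh : ∫ s in Ioo 0 h, A * (h - s) ^ (-a) =
        ∫ s in Ioo t (t + h), A * (t + h - s) ^ (-a) := by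
      rw [← integral_Ioc_eq_integral_Ioo, ← integral_Ioc_eq_integral_Ioo,
        ← intervalIntegral.integral_of_le hh.le, ← intervalIntegral.integral_of_le (by linarith)]
      have := intervalIntegral.integral_comp_sub_right (a := t) (b := t + h)
        (fun s => A * (h - s) ^ (-a)) t
      rw [sub_self, add_sub_cancel_left] at this
      rw [← this]
      congr 1
      funext s
      congr 2
      ring
    rw [hsh, integral_Ico_eq_integral_Ioo]
    have hint : IntegrableOn (fun s => A * (t + h - s) ^ (-a)) (Ioo t (t + h)) :=
      Integrable.const_mul ((integrableOn_comp_sub_left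
        (integrableOn_rpow_neg ha1 (t + h))).mono_set (Ioo_subset_Ioo_left ht0.le)) A
    refine norm_integral_le_of_norm_le hint
      ((ae_restrict_iff' measurableSet_Ioo).2 (Eventually.of_forall fun s hs => ?_))
    have := hF.norm_le hthT (s := s) ⟨ht0.trans hs.1, hs.2⟩ x
    rwa [neg_zero, Real.rpow_zero, one_mul] at this
  rw [hdec]
  exact (norm_add_le _ _).trans (add_le_add hfirst hsecond)

end IsDuhamelFamily

end Duhamel

/-! ### Sources, Gronwall's inequality and Schauder estimates -/

section Sources

/-- In the weighted norm `sup exp(-lam t) t^κ δ t x` the integral term is at most half of the norm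
once `lam` is large. The supremum of `δ s x` over `x` need not be measurable in `s`, so the
inequality is assumed for every majorant `D` with an integrable product. The a priori bound `B` only
makes the norm finite; `C` depends neither on it nor on `A`, so it is uniform over translations in
the application. -/
lemma singular_gronwall {κ c L T : ℝ} (hκ : 0 ≤ κ) (hκ1 : κ < 1) (hc : 0 ≤ c) (hL : 0 ≤ L) :
    ∃ C, 0 ≤ C ∧ ∀ {X : Type} (δ : ℝ → X → ℝ) (A B : ℝ), 0 ≤ A →
      (∀ t ∈ Ioc 0 T, ∀ x, 0 ≤ δ t x ∧ δ t x ≤ B) →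
      (∀ D : ℝ → ℝ, ∀ t ∈ Ioc 0 T, (∀ s ∈ Ioo 0 t, ∀ x, δ s x ≤ D s) →
        IntegrableOn (fun s => D s * (t - s) ^ (-κ)) (Ioo 0 t) →
        ∀ x, δ t x ≤ A * t ^ (-κ) + c * ∫ s in Ioo 0 t, L * (D s * (t - s) ^ (-κ))) →
      ∀ t ∈ Ioc 0 T, ∀ x, δ t x ≤ C * A * t ^ (-κ) := by
  have hcL : 0 ≤ c * L := mul_nonneg hc hL
  -- This makes `c * L` times the weighted integral at most `1 / 2`; the `+ 1` allows `c * L = 0`.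
  obtain ⟨lam, hlam, hexp⟩ := exists_setIntegral_exp_rpow_le hκ hκ1
    (ε := 1 / (2 * (c * L + 1))) (by positivity)
  refine ⟨2 * Real.exp (lam * T), by positivity, fun {X} δ A B hA hδ hD t₀ ht₀ x₀ => ?_⟩
  set S : Set ℝ := {r | ∃ t ∈ Ioc 0 T, ∃ x, r = Real.exp (-lam * t) * t ^ κ * δ t x} with hS
  have hSb : BddAbove S := by
    refine ⟨1 * T ^ κ * B, ?_⟩
    rintro r ⟨t, ht, x, rfl⟩
    have h1 : Real.exp (-lam * t) ≤ 1 := Real.exp_le_one_iff.2 (by nlinarith [ht.1])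
    have h2 : t ^ κ ≤ T ^ κ := Real.rpow_le_rpow ht.1.le ht.2 hκ
    have h3 : 0 ≤ t ^ κ := Real.rpow_nonneg ht.1.le _
    exact mul_le_mul (mul_le_mul h1 h2 h3 zero_le_one) (hδ t ht x).2 (hδ t ht x).1
      (mul_nonneg zero_le_one (h3.trans h2))
  set Φ := sSup S with hΦ
  have hle : ∀ t ∈ Ioc 0 T, ∀ x, Real.exp (-lam * t) * t ^ κ * δ t x ≤ Φ := fun t ht x =>
    le_csSup hSb ⟨t, ht, x, rfl⟩
  have hδ' : ∀ t ∈ Ioc 0 T, ∀ x, δ t x ≤ Φ * (Real.exp (lam * t) * t ^ (-κ)) := by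
    intro t ht x
    have h1 := mul_le_mul_of_nonneg_right (hle t ht x)
      (show 0 ≤ Real.exp (lam * t) * t ^ (-κ) from
        mul_nonneg (Real.exp_pos _).le (Real.rpow_nonneg ht.1.le _))
    refine le_trans (le_of_eq ?_) h1
    have h2 : Real.exp (-lam * t) * Real.exp (lam * t) = 1 := by
      rw [← Real.exp_add]; simp
    have h3 : t ^ κ * t ^ (-κ) = 1 := by rw [← Real.rpow_add ht.1]; simp
    calc δ t x = (Real.exp (-lam * t) * Real.exp (lam * t)) * (t ^ κ * t ^ (-κ)) * δ t x := by
          rw [h2, h3]; ring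
      _ = _ := by ring
  have hΦ0 : 0 ≤ Φ := le_trans (mul_nonneg (mul_nonneg (Real.exp_pos _).le
    (Real.rpow_nonneg ht₀.1.le _)) (hδ t₀ ht₀ x₀).1) (hle t₀ ht₀ x₀)
  -- The hypothesis is applied with the best majorant of the form `exp(lam s) s^(-κ)`, whose
  -- coefficient is the weighted norm itself. Since `Φ` is finite, `Φ ≤ 2A` follows.
  have hΦle : Φ ≤ A + Φ / 2 := by
    refine csSup_le ⟨_, t₀, ht₀, x₀, rfl⟩ ?_
    rintro r ⟨t, ht, x, rfl⟩
    obtain ⟨i1, i2⟩ := hexp t ht.1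
    have hfun : ∀ s, Φ * (Real.exp (lam * s) * s ^ (-κ)) * (t - s) ^ (-κ) =
        Φ * Real.exp (lam * t) *
          (s ^ (-κ) * (Real.exp (-lam * (t - s)) * (t - s) ^ (-κ))) := by
      intro s
      have : Real.exp (lam * s) = Real.exp (lam * t) * Real.exp (-lam * (t - s)) := by
        rw [← Real.exp_add]; congr 1; ring
      rw [this]; ring
    have h1 := hD (fun s => Φ * (Real.exp (lam * s) * s ^ (-κ))) t ht
      (fun s hs x => hδ' s (⟨hs.1, hs.2.le.trans ht.2⟩) x)
      (by simp only [hfun]; exact Integrable.const_mul i1 _) x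
    simp only [hfun] at h1
    rw [integral_const_mul, integral_const_mul] at h1
    set I := ∫ s in Ioo 0 t, s ^ (-κ) * (Real.exp (-lam * (t - s)) * (t - s) ^ (-κ)) with hI
    have h2 : Real.exp (-lam * t) * Real.exp (lam * t) = 1 := by
      rw [← Real.exp_add]; simp
    have h3 : t ^ κ * t ^ (-κ) = 1 := by rw [← Real.rpow_add ht.1]; simp
    have h4 : Real.exp (-lam * t) ≤ 1 := Real.exp_le_one_iff.2 (by nlinarith [ht.1])
    have h5 := mul_le_mul_of_nonneg_left h1 (show 0 ≤ Real.exp (-lam * t) * t ^ κ from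
      mul_nonneg (Real.exp_pos _).le (Real.rpow_nonneg ht.1.le _))
    have h6 : Real.exp (-lam * t) * t ^ κ *
        (A * t ^ (-κ) + c * (L * (Φ * Real.exp (lam * t) * I))) =
        Real.exp (-lam * t) * (t ^ κ * t ^ (-κ)) * A +
          c * L * Φ * (Real.exp (-lam * t) * Real.exp (lam * t)) * (t ^ κ * I) := by ring
    rw [h6, h2, h3] at h5
    have h7 : c * L * Φ * 1 * (t ^ κ * I) ≤ c * L * Φ * 1 * (1 / (2 * (c * L + 1))) :=
      mul_le_mul_of_nonneg_left i2 (by positivity)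
    have h8 : c * L * Φ * 1 * (1 / (2 * (c * L + 1))) ≤ Φ / 2 := by
      rw [mul_one, mul_one_div, div_le_div_iff₀ (by positivity) two_pos]
      nlinarith
    nlinarith
  have hfin := hδ' t₀ ht₀ x₀
  have h1 : Real.exp (lam * t₀) ≤ Real.exp (lam * T) := Real.exp_le_exp.2 (by nlinarith [ht₀.2])
  have hp : 0 ≤ t₀ ^ (-κ) := Real.rpow_nonneg ht₀.1.le _
  calc δ t₀ x₀ ≤ Φ * (Real.exp (lam * t₀) * t₀ ^ (-κ)) := hfin
    _ ≤ (2 * A) * (Real.exp (lam * T) * t₀ ^ (-κ)) :=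
        mul_le_mul (by linarith) (mul_le_mul_of_nonneg_right h1 hp)
          (mul_nonneg (Real.exp_pos _).le hp) (by linarith)
    _ = _ := by ring

variable {E V W : Type} [NormedAddCommGroup E] [NormedSpace ℝ E] [FiniteDimensional ℝ E]
  [MeasurableSpace E] [BorelSpace E]
  [NormedAddCommGroup V] [NormedSpace ℝ V] [FiniteDimensional ℝ V]
  [NormedAddCommGroup W] [NormedSpace ℝ W] [CompleteSpace W]
  {T α c t : ℝ} {K : ℝ → Measure E} {J : V →L[ℝ] E}

lemma IsHeatFlow.mono (hK : IsHeatFlow T K) {T' : ℝ} (h : T' ≤ T) : IsHeatFlow T' K :=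
  ⟨fun t ht => hK.prob t ⟨ht.1, ht.2.trans h⟩,
    fun s t hs ht hst => hK.conv_eq s t hs ht (hst.trans h), hK.tendsto⟩

lemma Smooths.mono (hS : Smooths T α c K J) {T' : ℝ} (h : T' ≤ T) : Smooths T' α c K J :=
  fun t ht => hS t ⟨ht.1, ht.2.trans h⟩

lemma Smooths.norm_dirFDeriv_sub_le (hK : IsHeatFlow T K) (hS : Smooths T α c K J)
    {f f' : E → W} {M M' D : ℝ} (hf : IsBC M f) (hf' : IsBC M' f')
    (hD : ∀ x, ‖f x - f' x‖ ≤ D) (ht : t ∈ Ioc 0 T) (x : E) :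
    ‖dirFDeriv J (convFun (K t) f) x - dirFDeriv J (convFun (K t) f') x‖ ≤
      c * t ^ (-(1 / α)) * D := by
  have hp := hK.prob t ⟨ht.1.le, ht.2⟩
  have h1 := ((hS t ht W f M hf).1.sub (hS t ht W f' M' hf').1).eq
  rw [← convFun_sub hf hf'] at h1
  have h2 := (hS t ht W (fun x => f x - f' x) D ⟨hf.1.sub hf'.1, hD⟩).2.2 x
  rwa [← h1] at h2

lemma Smooths.norm_dirFDeriv_shift_le (hK : IsHeatFlow T K) (hS : Smooths T α c K J)
    {f : E → W} {M D : ℝ} (hf : IsBC M f) (η : E)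
    (hD : ∀ x, ‖f (x + η) - f x‖ ≤ D) (ht : t ∈ Ioc 0 T) (x : E) :
    ‖dirFDeriv J (convFun (K t) f) (x + η) - dirFDeriv J (convFun (K t) f) x‖ ≤
      c * t ^ (-(1 / α)) * D := by
  have h1 := hS.norm_dirFDeriv_sub_le hK (hf.comp_add_right η) hf hD ht x
  rw [convFun_comp_add_right, ← ((hS t ht W f M hf).1.comp_add_right η).eq] at h1
  exact h1

/-- A bounded source, measurable in time and continuous in space. -/
structure IsSource (T N : ℝ) (g : ℝ → E → W) : Prop where
  meas : StronglyMeasurable (Function.uncurry g)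
  bc : ∀ s ∈ Ioo 0 T, IsBC N (g s)

variable {N : ℝ} {g : ℝ → E → W}

lemma IsSource.isDuhamelFamily (hT : 0 < T) (hK : IsHeatFlow T K) (hg : IsSource T N g) :
    IsDuhamelFamily T K N 0 0 (fun s r => convFun (K r) (g s)) where
  nonneg := (hg.bc (T / 2) ⟨by linarith, by linarith⟩).nonneg
  fam s hs := by
    rw [neg_zero, Real.rpow_zero, mul_one]
    exact isHeatFamily_convFun hK (hg.bc s hs)
  meas t ht x := hK.aestronglyMeasurable_convFun hg.meas ht x

/-- Since `1 ≤ T ^ κ * s ^ (-κ)`, a bounded family also fits the singular weight. The source is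
bounded but its Hölder constant blows up at `s = 0`, and differentiation under the integral wants
one weight for both. -/
lemma IsDuhamelFamily.weaken {A κ a : ℝ} {F : ℝ → ℝ → E → W} (hF : IsDuhamelFamily T K A 0 a F)
    (hκ : 0 ≤ κ) (hT : 0 < T) : IsDuhamelFamily T K (A * T ^ κ) κ a F where
  nonneg := mul_nonneg hF.nonneg (by positivity)
  meas := hF.meas
  fam s hs := by
    have hf := hF.fam s hs
    rw [neg_zero, Real.rpow_zero, mul_one] at hf
    refine ⟨fun t ht => (hf.bc t ht).mono (mul_le_mul_of_nonneg_right ?_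
      (Real.rpow_nonneg ht.1.le _)), hf.flow⟩
    rw [mul_assoc]
    refine le_mul_of_one_le_right hF.nonneg ?_
    rw [Real.rpow_neg hs.1.le, ← div_eq_mul_inv, one_le_div (Real.rpow_pos_of_pos hs.1 _)]
    exact Real.rpow_le_rpow hs.1.le hs.2.le hκ

lemma IsSource.isDuhamelFamily_dirFDeriv (hT : 0 < T) (hc : 0 ≤ c) (hK : IsHeatFlow T K)
    (hS : Smooths T α c K J) (hg : IsSource T N g) :
    (∀ s ∈ Ioo 0 T, ∀ r ∈ Ioc 0 T, HasDirFDeriv J (convFun (K r) (g s))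
      (dirFDeriv J (convFun (K r) (g s)))) ∧
    IsDuhamelFamily T K (c * N) 0 (1 / α) (fun s r => dirFDeriv J (convFun (K r) (g s))) := by
  have h0 := hg.isDuhamelFamily hT hK
  obtain ⟨h1, h2⟩ := h0.dirFDeriv hK hc hS
  refine ⟨h1, mul_nonneg hc h0.nonneg, fun s hs => ⟨fun r hr => ?_, (h2.fam s hs).flow⟩, h2.meas⟩
  rw [neg_zero, Real.rpow_zero, mul_one]
  convert (hS r hr W (g s) N (hg.bc s hs)).2 using 1
  ring

/-- A source which is Hölder in the directions of `J`, with a singularity at time `0`. -/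
def IsHolderSource (T C κ β : ℝ) (J : V →L[ℝ] E) (g : ℝ → E → W) : Prop :=
  ∀ s ∈ Ioo 0 T, ∀ x v, ‖g s (x + J v) - g s x‖ ≤ C * s ^ (-κ) * ‖v‖ ^ β

/-- Hölder continuity of the source lowers the cost of the first derivative from `1 / α` to `(1 - β)
/ α`; the price is the singular weight `s ^ (-κ)`. -/
lemma IsSource.isDuhamelFamily_dirFDeriv_of_holder {C κ β : ℝ} (hT : 0 < T) (hα : 0 < α)
    (hc : 0 ≤ c) (hβ : 0 ≤ β) (hC : 0 ≤ C) (hK : IsHeatFlow T K) (hS : Smooths T α c K J)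
    (hg : IsSource T N g) (hgC : IsHolderSource T C κ β J g) :
    IsDuhamelFamily T K ((1 + c) * C) κ ((1 - β) / α)
      (fun s r => dirFDeriv J (convFun (K r) (g s))) where
  nonneg := by positivity
  fam s hs := by
    have hCs : 0 ≤ C * s ^ (-κ) := mul_nonneg hC (Real.rpow_nonneg hs.1.le _)
    convert isHeatFamily_dirFDeriv_of_holder hα hc hK hS (hg.bc s hs) hβ hCs (hgC s hs) using 1
    ring
  meas := (hg.isDuhamelFamily_dirFDeriv hT hc hK hS).2.meas

/-- `w` is of class `C_b^n` with `n ∈ {1, 2}` and Hölder of exponent `θ` in the directions of `J`,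
uniformly in space. -/
inductive IsDirHolder (J : V →L[ℝ] E) (θ : ℝ) : ℕ → (E → ℝ) → Prop
  | one {w : E → ℝ} {w₁ : E → V →L[ℝ] ℝ} {M C : ℝ} (h₀ : IsBC M w) (h₁ : IsBC M w₁)
      (hd : HasDirFDeriv J w w₁)
      (hθ : ∀ x v, ‖v‖ ≤ 1 → ‖w₁ (x + J v) - w₁ x‖ ≤ C * ‖v‖ ^ θ) : IsDirHolder J θ 1 w
  | two {w : E → ℝ} {w₁ : E → V →L[ℝ] ℝ} {w₂ : E → V →L[ℝ] V →L[ℝ] ℝ} {M C : ℝ} (h₀ : IsBC M w)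
      (h₁ : IsBC M w₁) (h₂ : IsBC M w₂) (hd : HasDirFDeriv J w w₁) (hd' : HasDirFDeriv J w₁ w₂)
      (hθ : ∀ x v, ‖v‖ ≤ 1 → ‖w₂ (x + J v) - w₂ x‖ ≤ C * ‖v‖ ^ θ) : IsDirHolder J θ 2 w

lemma IsBC.add' {E W : Type*} [TopologicalSpace E] [NormedAddCommGroup W] {f g : E → W} {M M' : ℝ}
    (hf : IsBC M f) (hg : IsBC M' g) : IsBC (M + M') (fun x => f x + g x) :=
  ⟨hf.1.add hg.1, fun x => (norm_add_le _ _).trans (add_le_add (hf.2 x) (hg.2 x))⟩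

/-- Here `f` comes from the initial datum: it has one more bounded derivative, hence at distances up
to one it is Hölder of any exponent up to one. -/
lemma holder_add_of_lipschitz {f g : E → W} {f' : E → V →L[ℝ] W} {A C θ : ℝ}
    (hd : HasDirFDeriv J f f') (hf' : IsBC A f') (hθ1 : θ ≤ 1) (hθ0 : 0 < θ)
    (hg : ∀ x v, ‖v‖ ≤ 1 → ‖g (x + J v) - g x‖ ≤ C * ‖v‖ ^ θ) :
    ∀ x v, ‖v‖ ≤ 1 → ‖(f (x + J v) + g (x + J v)) - (f x + g x)‖ ≤ (A + C) * ‖v‖ ^ θ := by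
  intro x v hv
  rw [add_sub_add_comm, add_mul]
  refine (norm_add_le _ _).trans (add_le_add ((hd.norm_sub_le hf'.2 x v).trans ?_) (hg x v hv))
  refine mul_le_mul_of_nonneg_left ?_ hf'.nonneg
  rcases (norm_nonneg v).eq_or_lt with h | h
  · rw [← h, Real.zero_rpow hθ0.ne']
  · simpa using Real.rpow_le_rpow_of_exponent_ge h hv hθ1

/-- Schauder estimate in the directions of `J`. -/
lemma isDirHolder_of_holderSource {C κ β M : ℝ} {u₀ : E → ℝ} {g : ℝ → E → ℝ} (hT : 0 < T)
    (hα : 1 < α) (hc : 0 ≤ c) (hβ : 0 ≤ β) (hβ1 : β ≤ 1) (hκ : 0 ≤ κ) (hκ1 : κ < 1) (hC : 0 ≤ C)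
    (hK : IsHeatFlow T K) (hS : Smooths T α c K J) (hu₀ : IsBC M u₀) (hg : IsSource T N g)
    (hgC : IsHolderSource T C κ β J g) (n : ℕ) (hn : n = 1 ∨ n = 2) (hn1 : (n : ℝ) < α + β)
    (hn2 : α + β < n + 1) (ht : t ∈ Ioc 0 T) :
    IsDirHolder J (α + β - n) n
      (fun x => convFun (K t) u₀ x + duhamel (fun s r => convFun (K r) (g s)) t x) := by
  have hα0 : 0 < α := by linarith
  have f0 := isHeatFamily_convFun hK hu₀
  obtain ⟨d0, f1⟩ := f0.dirFDeriv hK hS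
  obtain ⟨d1, f2⟩ := f1.dirFDeriv hK hS
  obtain ⟨d2, f3⟩ := f2.dirFDeriv hK hS
  have q0 := (hg.isDuhamelFamily hT hK).weaken hκ hT
  have e0 := (hg.isDuhamelFamily_dirFDeriv hT hc hK hS).1
  have q1 := hg.isDuhamelFamily_dirFDeriv_of_holder hT hα0 hc hβ hC hK hS hgC
  obtain ⟨e1, q2⟩ := q1.dirFDeriv hK hc hS
  obtain ⟨e2, q3⟩ := q2.dirFDeriv hK hc hS
  -- The first three derivatives cost `(1 - β) / α`, `(2 - β) / α` and `(3 - β) / α`; comparing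
  -- these with one is comparing the order of the derivative with `α + β`.
  have a1 : 0 ≤ (1 - β) / α := div_nonneg (by linarith) hα0.le
  have a1' : (1 - β) / α < 1 := by rw [div_lt_one hα0]; linarith
  have e12 : (1 - β) / α + 1 / α = (2 - β) / α := by rw [← add_div]; ring_nf
  have e23 : (1 - β) / α + 1 / α + 1 / α = (3 - β) / α := by rw [← add_div, ← add_div]; ring_nf
  have D0 := q0.hasDirFDeriv_duhamel q1 e0 hκ hκ1 le_rfl zero_lt_one a1 a1' ht
  have B0 := q0.isBC_duhamel hκ hκ1 le_rfl zero_lt_one ht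
  have B1 := q1.isBC_duhamel hκ hκ1 a1 a1' ht
  rcases hn with rfl | rfl
  · push_cast at hn1 hn2 ⊢
    have a2 : 1 < (1 - β) / α + 1 / α := by rw [e12, one_lt_div hα0]; linarith
    obtain ⟨C', -, hh⟩ := q1.exists_holder_duhamel q2 e1 hκ hκ1 a1 a1' a2 ht
    -- Consecutive costs differ by `1 / α`, so the interpolation exponent is `α` times the
    -- integrability margin `1 - (1 - β) / α`.
    have hθ : (1 - (1 - β) / α) / ((1 - β) / α + 1 / α - (1 - β) / α) = α + β - 1 := by
      field_simp; ring
    rw [hθ] at hh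
    refine IsDirHolder.one (((f0.bc t ht).add' B0).mono (le_max_left _ _))
      (((f1.bc t ht).add' B1).mono (le_max_right _ _)) ((d0 t ht).add D0)
      (holder_add_of_lipschitz (d1 t ht) (f2.bc t ht) (by linarith) (by linarith) hh)
  · push_cast at hn1 hn2 ⊢
    have a2 : 0 ≤ (1 - β) / α + 1 / α := by positivity
    have a2' : (1 - β) / α + 1 / α < 1 := by rw [e12, div_lt_one hα0]; linarith
    have a3 : 1 < (1 - β) / α + 1 / α + 1 / α := by rw [e23, one_lt_div hα0]; linarith
    obtain ⟨C', -, hh⟩ := q2.exists_holder_duhamel q3 e2 hκ hκ1 a2 a2' a3 ht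
    have hθ : (1 - ((1 - β) / α + 1 / α)) /
        ((1 - β) / α + 1 / α + 1 / α - ((1 - β) / α + 1 / α)) = α + β - 2 := by
      field_simp; ring
    rw [hθ] at hh
    have D1 := q1.hasDirFDeriv_duhamel q2 e1 hκ hκ1 a1 a1' a2 a2' ht
    have B2 := q2.isBC_duhamel hκ hκ1 a2 a2' ht
    exact IsDirHolder.two
      (((f0.bc t ht).add' B0).mono ((le_max_left _ _).trans (le_max_left _ _)))
      (((f1.bc t ht).add' B1).mono ((le_max_right _ _).trans (le_max_left _ _)))
      (((f2.bc t ht).add' B2).mono (le_max_right _ _)) ((d0 t ht).add D0) ((d1 t ht).add D1)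
      (holder_add_of_lipschitz (d2 t ht) (f3.bc t ht) (by linarith) (by linarith) hh)

end Sources

/-! ### Hölder spaces and directional derivatives -/

section HolderSpaces

variable {E V : Type} [NormedAddCommGroup E] [NormedSpace ℝ E]
  [NormedAddCommGroup V] [NormedSpace ℝ V] {J : V →L[ℝ] E}

lemma norm_iteratedFDeriv_one_le (f : V → ℝ) (x : V) :
    ‖iteratedFDeriv ℝ 1 f x‖ ≤ ‖fderiv ℝ f x‖ :=
  ContinuousMultilinearMap.opNorm_le_bound (ContinuousLinearMap.opNorm_nonneg _) fun m => by
    rw [iteratedFDeriv_one_apply]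
    simpa using (fderiv ℝ f x).le_opNorm (m 0)

lemma norm_fderiv_le_iteratedFDeriv_one (f : V → ℝ) (x : V) :
    ‖fderiv ℝ f x‖ ≤ ‖iteratedFDeriv ℝ 1 f x‖ :=
  ContinuousLinearMap.opNorm_le_bound _ (norm_nonneg _) fun v => by
    have := (iteratedFDeriv ℝ 1 f x).le_opNorm (fun _ => v)
    rw [iteratedFDeriv_one_apply] at this
    simpa using this

lemma norm_iteratedFDeriv_one_sub_le (f : V → ℝ) (x y : V) :
    ‖iteratedFDeriv ℝ 1 f x - iteratedFDeriv ℝ 1 f y‖ ≤ ‖fderiv ℝ f x - fderiv ℝ f y‖ :=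
  ContinuousMultilinearMap.opNorm_le_bound (ContinuousLinearMap.opNorm_nonneg _) fun m => by
    rw [sub_apply, iteratedFDeriv_one_apply, iteratedFDeriv_one_apply]
    simpa using (fderiv ℝ f x - fderiv ℝ f y).le_opNorm (m 0)

lemma norm_iteratedFDeriv_two_le (f : V → ℝ) (x : V) :
    ‖iteratedFDeriv ℝ 2 f x‖ ≤ ‖fderiv ℝ (fderiv ℝ f) x‖ :=
  ContinuousMultilinearMap.opNorm_le_bound (ContinuousLinearMap.opNorm_nonneg _) fun m => by
    rw [iteratedFDeriv_two_apply]
    simpa [Fin.prod_univ_two, mul_assoc] using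
      (fderiv ℝ (fderiv ℝ f) x).le_opNorm₂ (m 0) (m 1)

lemma norm_iteratedFDeriv_two_sub_le (f : V → ℝ) (x y : V) :
    ‖iteratedFDeriv ℝ 2 f x - iteratedFDeriv ℝ 2 f y‖ ≤
      ‖fderiv ℝ (fderiv ℝ f) x - fderiv ℝ (fderiv ℝ f) y‖ :=
  ContinuousMultilinearMap.opNorm_le_bound (ContinuousLinearMap.opNorm_nonneg _) fun m => by
    rw [sub_apply, iteratedFDeriv_two_apply, iteratedFDeriv_two_apply]
    simpa [Fin.prod_univ_two, mul_assoc] using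
      (fderiv ℝ (fderiv ℝ f) x - fderiv ℝ (fderiv ℝ f) y).le_opNorm₂ (m 0) (m 1)

/-- From Hölder continuity at distances at most one to global Hölder continuity. -/
lemma holder_of_local {W : Type*} [NormedAddCommGroup W] {f : E → W} {M C θ : ℝ} (hθ : 0 ≤ θ)
    (hf : IsBC M f) (h : ∀ x v, ‖v‖ ≤ 1 → ‖f (x + J v) - f x‖ ≤ C * ‖v‖ ^ θ) (x : E) (v w : V) :
    ‖f (x + J v) - f (x + J w)‖ ≤ max C (2 * M) * ‖v - w‖ ^ θ := by
  have hp : 0 ≤ ‖v - w‖ ^ θ := Real.rpow_nonneg (norm_nonneg _) _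
  rcases le_total ‖v - w‖ 1 with h1 | h1
  · have := h (x + J w) (v - w) h1
    rw [map_sub, add_assoc, add_sub_cancel] at this
    exact this.trans (mul_le_mul_of_nonneg_right (le_max_left _ _) hp)
  · have h2 : 1 ≤ ‖v - w‖ ^ θ := Real.one_le_rpow h1 hθ
    have hM : 0 ≤ M := (norm_nonneg _).trans (hf.2 0)
    calc _ ≤ 2 * M := (norm_sub_le _ _).trans (by linarith [hf.2 (x + J v), hf.2 (x + J w)])
      _ ≤ 2 * M * ‖v - w‖ ^ θ := le_mul_of_one_le_right (by positivity) h2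
      _ ≤ _ := mul_le_mul_of_nonneg_right (le_max_right _ _) hp

lemma HasDirFDeriv.fderiv_eq {W : Type*} [NormedAddCommGroup W] [NormedSpace ℝ W] {f : E → W}
    {f' : E → V →L[ℝ] W} (h : HasDirFDeriv J f f') (x : E) :
    fderiv ℝ (fun v => f (x + J v)) = fun v => f' (x + J v) :=
  funext fun v => (h.hasFDerivAt x v).fderiv

lemma HasDirFDeriv.contDiff_one {W : Type*} [NormedAddCommGroup W] [NormedSpace ℝ W] {f : E → W}
    {f' : E → V →L[ℝ] W} (h : HasDirFDeriv J f f') (hc : Continuous f') (x : E) :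
    ContDiff ℝ 1 (fun v => f (x + J v)) := by
  rw [contDiff_one_iff_fderiv, h.fderiv_eq]
  exact ⟨fun v => (h.hasFDerivAt x v).differentiableAt, hc.comp (by fun_prop)⟩

/-- The window for `γ` makes `n` its integer part and `γ - n` its fractional part. The data of
`IsDirHolder` do not depend on the base point, so one constant serves all slices; `2 * M` handles
increments of length above one. -/
lemma IsDirHolder.holderBound {γ : ℝ} {n : ℕ} {w : E → ℝ} (h : IsDirHolder J (γ - n) n w)
    (hn1 : (n : ℝ) < γ) (hn2 : γ < n + 1) :
    ∃ C, ∀ x, HolderBound γ C (fun v => w (x + J v)) := by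
  have hγ0 : 0 ≤ γ := (Nat.cast_nonneg n).trans hn1.le
  have hfl : ⌊γ⌋₊ = n := (Nat.floor_eq_iff hγ0).2 ⟨hn1.le, hn2⟩
  have hfr : Int.fract γ = γ - n :=
    Int.fract_eq_iff.2 ⟨by linarith, by linarith, n, by simp⟩
  have hθ : 0 ≤ γ - n := by linarith
  unfold HolderBound
  rw [hfl, hfr]
  cases h with
  | @one _ w₁ M C h₀ h₁ hd hC =>
    have hM : 0 ≤ M := (norm_nonneg _).trans (h₀.2 0)
    refine ⟨max C (2 * M), fun x => ⟨⟨hd.contDiff_one h₁.1 x, fun j hj v => ?_⟩, fun v v' => ?_⟩⟩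
    · have hM' : M ≤ max C (2 * M) := le_max_of_le_right (by linarith)
      interval_cases j
      · rw [norm_iteratedFDeriv_zero]
        exact (h₀.2 _).trans hM'
      · refine (norm_iteratedFDeriv_one_le _ _).trans ?_
        rw [hd.fderiv_eq]
        exact (h₁.2 _).trans hM'
    · refine (norm_iteratedFDeriv_one_sub_le _ _ _).trans ?_
      rw [hd.fderiv_eq]
      exact holder_of_local hθ h₁ hC x v v'
  | @two _ w₁ w₂ M C h₀ h₁ h₂ hd hd' hC =>
    have hM : 0 ≤ M := (norm_nonneg _).trans (h₀.2 0)
    have hfd : ∀ x, fderiv ℝ (fderiv ℝ (fun v => w (x + J v))) = fun v => w₂ (x + J v) :=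
      fun x => by rw [hd.fderiv_eq, hd'.fderiv_eq]
    refine ⟨max C (2 * M), fun x => ⟨⟨?_, fun j hj v => ?_⟩, fun v v' => ?_⟩⟩
    · have : ContDiff ℝ (1 + 1) (fun v => w (x + J v)) := by
        rw [contDiff_succ_iff_fderiv]
        refine ⟨fun v => (hd.hasFDerivAt x v).differentiableAt, by simp, ?_⟩
        rw [hd.fderiv_eq]
        exact hd'.contDiff_one h₂.1 x
      exact_mod_cast this
    · have hM' : M ≤ max C (2 * M) := le_max_of_le_right (by linarith)
      interval_cases j
      · rw [norm_iteratedFDeriv_zero]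
        exact (h₀.2 _).trans hM'
      · refine (norm_iteratedFDeriv_one_le _ _).trans ?_
        rw [hd.fderiv_eq]
        exact (h₁.2 _).trans hM'
      · refine (norm_iteratedFDeriv_two_le _ _).trans ?_
        rw [hfd]
        exact (h₂.2 _).trans hM'
    · refine (norm_iteratedFDeriv_two_sub_le _ _ _).trans ?_
      rw [hfd]
      exact holder_of_local hθ h₂ hC x v v'

lemma cbBound_one_iff {C : ℝ} {f : E → ℝ} :
    CbBound 1 C f ↔ ContDiff ℝ 1 f ∧ (∀ x, |f x| ≤ C) ∧ ∀ x, ‖fderiv ℝ f x‖ ≤ C := by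
  constructor
  · rintro ⟨h1, h2⟩
    refine ⟨by exact_mod_cast h1, fun x => ?_, fun x => ?_⟩
    · simpa [norm_iteratedFDeriv_zero] using h2 0 zero_le_one x
    · exact (norm_fderiv_le_iteratedFDeriv_one f x).trans (h2 1 le_rfl x)
  · rintro ⟨h1, h2, h3⟩
    refine ⟨by exact_mod_cast h1, fun j hj x => ?_⟩
    interval_cases j
    · simpa [norm_iteratedFDeriv_zero] using h2 x
    · exact (norm_iteratedFDeriv_one_le f x).trans (h3 x)

lemma hasDirFDeriv_id_iff {f : E → ℝ} {f' : E → E →L[ℝ] ℝ} :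
    HasDirFDeriv (ContinuousLinearMap.id ℝ E) f f' ↔ ∀ x, HasFDerivAt f (f' x) x := by
  constructor
  · intro h x
    have := h.hasFDerivAt 0 x
    simpa using this
  · intro h x
    have h1 : HasFDerivAt f (f' x) (x + 0) := by simpa using h x
    have h2 : HasFDerivAt (fun v : E => x + v) (ContinuousLinearMap.id ℝ E) 0 :=
      (hasFDerivAt_id 0).const_add x
    exact HasFDerivAt.comp (g := f) (f := fun v : E => x + v) 0 h1 h2

end HolderSpaces

/-! ### The mild formulation -/

section Mild

variable {E : Type} [NormedAddCommGroup E] [InnerProductSpace ℝ E] [FiniteDimensional ℝ E]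
  [MeasurableSpace E] [BorelSpace E]

/-- The right-hand side of the mild formulation with source `g`. -/
noncomputable def mildMap (K : ℝ → Measure E) (u₀ : E → ℝ) (g : ℝ → E → ℝ) (t : ℝ) (x : E) : ℝ :=
  convFun (K t) u₀ x + duhamel (fun s r => convFun (K r) (g s)) t x

/-- The derivative of `mildMap`. -/
noncomputable def mildDeriv (K : ℝ → Measure E) (u₀ : E → ℝ) (g : ℝ → E → ℝ) (t : ℝ) (x : E) :
    E →L[ℝ] ℝ :=
  dirFDeriv (ContinuousLinearMap.id ℝ E) (convFun (K t) u₀) x +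
    duhamel (fun s r => dirFDeriv (ContinuousLinearMap.id ℝ E) (convFun (K r) (g s))) t x

open Classical in
/-- The source `H(s, y, w(s, y))`, cut off outside `(0, T)`. -/
noncomputable def hamSource (T : ℝ) (H : ℝ → E → E → ℝ) (w : ℝ → E → E →L[ℝ] ℝ) (s : ℝ) (y : E) :
    ℝ :=
  if s ∈ Ioo 0 T then H s y ((InnerProductSpace.toDual ℝ E).symm (w s y)) else 0

lemma HamiltonianLip.exists_bound {T : ℝ} {H : ℝ → E → E → ℝ} (hH : HamiltonianLip T H) {R : ℝ}
    (hR : 0 ≤ R) : ∃ N L, 0 ≤ N ∧ 0 ≤ L ∧ ∀ t ∈ Ioo 0 T, ∀ x p, ‖p‖ ≤ R →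
      |H t x p| ≤ N ∧ ∀ q, ‖q‖ ≤ R → |H t x p - H t x q| ≤ L * ‖p - q‖ := by
  obtain ⟨-, ⟨H₀, hH₀, h0⟩, hL⟩ := hH
  -- The hypothesis concerns open balls of positive radius; `R + 1` includes the closed ball of
  -- radius `R`, also for `R = 0`.
  obtain ⟨L, hL0, hL⟩ := hL (R + 1) (by linarith)
  refine ⟨H₀ + L * R, L, by positivity, hL0.le, fun t ht x p hp => ⟨?_, fun q hq => ?_⟩⟩
  · have h1 := hL t ht x p (by simp; linarith) 0 (by simp; linarith)
    rw [sub_zero] at h1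
    have h2 := abs_sub_abs_le_abs_sub (H t x p) (H t x 0)
    have h3 := mul_le_mul_of_nonneg_left hp hL0.le
    linarith [h0 t ht x]
  · exact hL t ht x p (by simp; linarith) q (by simp; linarith)

lemma isSource_hamSource {T T₁ N R : ℝ} {H : ℝ → E → E → ℝ} (hT : T ≤ T₁)
    (hH : ContinuousOn (fun q : ℝ × E × E => H q.1 q.2.1 q.2.2) (Icc 0 T₁ ×ˢ univ))
    (hN : ∀ t ∈ Ioo 0 T₁, ∀ x p, ‖p‖ ≤ R → |H t x p| ≤ N) {w : ℝ → E → E →L[ℝ] ℝ}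
    (hw : ContinuousOn (fun q : ℝ × E => w q.1 q.2) (Ioc 0 T ×ˢ univ))
    (hR : ∀ t ∈ Ioc 0 T, ∀ x, ‖w t x‖ ≤ R) : IsSource T N (hamSource T H w) := by
  classical
  have hc : ContinuousOn (fun q : ℝ × E =>
      H q.1 q.2 ((InnerProductSpace.toDual ℝ E).symm (w q.1 q.2))) (Ioo 0 T ×ˢ univ) := by
    have h1 : ContinuousOn (fun q : ℝ × E =>
        (q.1, q.2, (InnerProductSpace.toDual ℝ E).symm (w q.1 q.2))) (Ioo 0 T ×ˢ univ) := by
      refine continuousOn_fst.prodMk (continuousOn_snd.prodMk ?_)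
      exact (InnerProductSpace.toDual ℝ E).symm.continuous.comp_continuousOn
        (hw.mono (prod_mono Ioo_subset_Ioc_self Subset.rfl))
    exact hH.comp h1 (fun q hq => ⟨⟨hq.1.1.le, hq.1.2.le.trans hT⟩, mem_univ _⟩)
  constructor
  · have hm := hc.measurable_piecewise (g := fun _ => (0 : ℝ)) continuousOn_const
      (measurableSet_Ioo.prod MeasurableSet.univ)
    have he : Function.uncurry (hamSource T H w) = (Ioo 0 T ×ˢ (univ : Set E)).piecewise
        (fun q : ℝ × E => H q.1 q.2 ((InnerProductSpace.toDual ℝ E).symm (w q.1 q.2)))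
        (fun _ => 0) := by
      funext q
      by_cases hq : q.1 ∈ Ioo 0 T
      · rw [piecewise_eq_of_mem _ _ _ (show q ∈ Ioo 0 T ×ˢ univ from ⟨hq, mem_univ _⟩)]
        exact if_pos hq
      · rw [piecewise_eq_of_notMem _ _ _ fun h => hq h.1]
        exact if_neg hq
    rw [he]
    exact hm.stronglyMeasurable
  · intro s hs
    have he : hamSource T H w s =
        fun y => H s y ((InnerProductSpace.toDual ℝ E).symm (w s y)) :=
      funext fun y => if_pos hs
    rw [he]
    refine ⟨?_, fun y => hN s ⟨hs.1, hs.2.trans_le hT⟩ _ _ ?_⟩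
    · exact hc.comp_continuous (f := fun y : E => (s, y)) (by fun_prop)
        (fun y => ⟨hs, mem_univ _⟩)
    · rw [LinearIsometryEquiv.norm_map]
      exact hR s ⟨hs.1, hs.2.le⟩ y

variable {T α c t N M Λ : ℝ} {K : ℝ → Measure E} {u₀ : E → ℝ} {g : ℝ → E → ℝ}

lemma IsDuhamelFamily.isBC_duhamel_zero {W : Type} [NormedAddCommGroup W] [NormedSpace ℝ W]
    [CompleteSpace W] {A a : ℝ} {F : ℝ → ℝ → E → W} (hF : IsDuhamelFamily T K A 0 a F)
    (ha : 0 ≤ a) (ha1 : a < 1) (ht : t ∈ Ioc 0 T) :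
    IsBC (A * (t ^ (1 - a) / (1 - a))) (duhamel F t) := by
  have h := hF.isBC_duhamel le_rfl zero_lt_one ha ha1 ht
  simp only [neg_zero, Real.rpow_zero, one_mul] at h
  rwa [setIntegral_comp_sub_left (fun r => r ^ (-a)), setIntegral_rpow_neg ha1 ht.1.le] at h

/-- Averaging preserves the Lipschitz constant. So the initial datum contributes to `Du` a bound
that does not blow up as `t → 0`. -/
lemma norm_dirFDeriv_convFun_le_of_lipschitz (hK : IsHeatFlow T K)
    (hS : Smooths T α c K (ContinuousLinearMap.id ℝ E)) (hu₀ : IsBC M u₀) (hΛ : 0 ≤ Λ)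
    (hl : ∀ x y, ‖u₀ x - u₀ y‖ ≤ Λ * ‖x - y‖) (ht : t ∈ Ioc 0 T) (x : E) :
    ‖dirFDeriv (ContinuousLinearMap.id ℝ E) (convFun (K t) u₀) x‖ ≤ Λ := by
  have hp := hK.prob t ⟨ht.1.le, ht.2⟩
  have hd := (hS t ht ℝ u₀ M hu₀).1 x
  refine hd.le_of_lip' hΛ (Eventually.of_forall fun v => ?_)
  have hb : IsBC (Λ * ‖v‖) (fun x => u₀ (x + v) - u₀ x) :=
    ⟨((hu₀.comp_add_right v).sub hu₀).1, fun x => by simpa using hl (x + v) x⟩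
  have := (hb.conv (ν := K t)).2 x
  rw [convFun_sub (hu₀.comp_add_right v) hu₀, convFun_comp_add_right] at this
  simpa using this

lemma hasDirFDeriv_mildMap (hT : 0 < T) (hα : 1 < α) (hc : 0 ≤ c) (hK : IsHeatFlow T K)
    (hS : Smooths T α c K (ContinuousLinearMap.id ℝ E)) (hu₀ : IsBC M u₀) (hg : IsSource T N g)
    (ht : t ∈ Ioc 0 T) :
    HasDirFDeriv (ContinuousLinearMap.id ℝ E) (mildMap K u₀ g t) (mildDeriv K u₀ g t) := by
  obtain ⟨hd, h1⟩ := hg.isDuhamelFamily_dirFDeriv hT hc hK hS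
  exact (hS t ht ℝ u₀ M hu₀).1.add ((hg.isDuhamelFamily hT hK).hasDirFDeriv_duhamel h1 hd le_rfl
    zero_lt_one le_rfl zero_lt_one (by positivity) (by rw [div_lt_one] <;> linarith) ht)

lemma isBC_mildMap (hT : 0 < T) (hK : IsHeatFlow T K) (hu₀ : IsBC M u₀) (hg : IsSource T N g)
    (ht : t ∈ Ioc 0 T) : IsBC (M + N * T) (mildMap K u₀ g t) := by
  have hp := hK.prob t ⟨ht.1.le, ht.2⟩
  have h0 := hg.isDuhamelFamily hT hK
  have h := h0.isBC_duhamel_zero le_rfl zero_lt_one ht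
  simp only [sub_zero, Real.rpow_one, div_one] at h
  exact (hu₀.conv (ν := K t)).add' (h.mono (mul_le_mul_of_nonneg_left ht.2 h0.nonneg))

lemma isBC_mildDeriv (hT : 0 < T) (hα : 1 < α) (hc : 0 ≤ c) (hK : IsHeatFlow T K)
    (hS : Smooths T α c K (ContinuousLinearMap.id ℝ E)) (hu₀ : IsBC M u₀) (hΛ : 0 ≤ Λ)
    (hl : ∀ x y, ‖u₀ x - u₀ y‖ ≤ Λ * ‖x - y‖) (hg : IsSource T N g) (ht : t ∈ Ioc 0 T) :
    IsBC (Λ + c * N * (t ^ (1 - 1 / α) / (1 - 1 / α))) (mildDeriv K u₀ g t) :=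
  IsBC.add' ⟨(hS t ht ℝ u₀ M hu₀).2.1, norm_dirFDeriv_convFun_le_of_lipschitz hK hS hu₀ hΛ hl ht⟩
    ((hg.isDuhamelFamily_dirFDeriv hT hc hK hS).2.isBC_duhamel_zero (by positivity)
      (by rw [div_lt_one] <;> linarith) ht)

lemma unifContInTime_mild (hT : 0 < T) (hα : 1 < α) (hc : 0 ≤ c) (hK : IsHeatFlow T K)
    (hS : Smooths T α c K (ContinuousLinearMap.id ℝ E)) (hu₀ : IsBC M u₀) (hg : IsSource T N g) :
    UnifContInTime T (mildMap K u₀ g) ∧ UnifContInTime T (mildDeriv K u₀ g) := by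
  have hM := hu₀.nonneg
  have f0 := isHeatFamily_convFun hK hu₀
  obtain ⟨d0, f1⟩ := f0.dirFDeriv hK hS
  obtain ⟨d1, f2⟩ := f1.dirFDeriv hK hS
  have q0 := hg.isDuhamelFamily hT hK
  obtain ⟨e0, q1⟩ := hg.isDuhamelFamily_dirFDeriv hT hc hK hS
  obtain ⟨e1, q2⟩ := q1.dirFDeriv hK hc hS
  have h1 : 1 / α < 1 := by rw [div_lt_one] <;> linarith
  have h0 : 0 ≤ 1 / α := by positivity
  constructor
  · exact (f0.unifContInTime hK le_rfl (by positivity) hM (by positivity) f1 d0).add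
      (q0.unifContInTime_duhamel hK q1 e0 le_rfl zero_lt_one)
  · exact (f1.unifContInTime hK (by positivity) (by positivity) (by positivity) (by positivity)
      f2 d1).add (q1.unifContInTime_duhamel hK q2 e1 h0 h1)

lemma norm_mildDeriv_sub_le (hT : 0 < T) (hα : 1 < α) (hc : 0 ≤ c) (hK : IsHeatFlow T K)
    (hS : Smooths T α c K (ContinuousLinearMap.id ℝ E)) (hg : IsSource T N g)
    {g' : ℝ → E → ℝ} {N' D : ℝ} (hg' : IsSource T N' g')
    (hD : ∀ s ∈ Ioo 0 T, ∀ x, ‖g s x - g' s x‖ ≤ D) (ht : t ∈ Ioc 0 T) (x : E) :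
    ‖mildDeriv K u₀ g t x - mildDeriv K u₀ g' t x‖ ≤
      c * D * (t ^ (1 - 1 / α) / (1 - 1 / α)) := by
  have h1 : 1 / α < 1 := by rw [div_lt_one] <;> linarith
  have h0 : 0 ≤ 1 / α := by positivity
  have i1 := (hg.isDuhamelFamily_dirFDeriv hT hc hK hS).2.integrableOn le_rfl zero_lt_one h0 h1 ht x
  have i2 :=
    (hg'.isDuhamelFamily_dirFDeriv hT hc hK hS).2.integrableOn le_rfl zero_lt_one h0 h1 ht x
  unfold mildDeriv
  rw [add_sub_add_left_eq_sub]
  unfold duhamel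
  rw [← integral_sub i1 i2, ← setIntegral_rpow_neg h1 ht.1.le,
    ← setIntegral_comp_sub_left (fun r => r ^ (-(1 / α))), ← integral_const_mul]
  refine norm_integral_le_of_norm_le
    ((integrableOn_comp_sub_left (integrableOn_rpow_neg h1 t)).const_mul _)
    ((ae_restrict_iff' measurableSet_Ioo).2 (Eventually.of_forall fun s hs => ?_))
  have hsT := mem_Ioo_of_mem_Ioo_Ioc ht hs
  refine (hS.norm_dirFDeriv_sub_le hK (hg.bc s hsT) (hg'.bc s hsT) (hD s hsT)
    (sub_mem_Ioc ht hs) x).trans (le_of_eq (by ring))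

/-- Short-time existence: the derivative of the solution as a fixed point. -/
lemma exists_fixedPoint {H : ℝ → E → E → ℝ} (hT : 0 < T) (hα : 1 < α) (hc : 0 ≤ c)
    (hK : IsHeatFlow T K) (hS : Smooths T α c K (ContinuousLinearMap.id ℝ E)) (hu₀ : IsBC M u₀)
    (hΛ : 0 ≤ Λ) (hl : ∀ x y, ‖u₀ x - u₀ y‖ ≤ Λ * ‖x - y‖) (hH : HamiltonianLip T H) :
    ∃ R N, ∃ T₀ ∈ Ioc 0 T, ∀ T' ∈ Ioc 0 T₀, ∃ w : ℝ → E → E →L[ℝ] ℝ,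
      IsSource T' N (hamSource T' H w) ∧
      ∀ t ∈ Ioc 0 T', (∀ x, ‖w t x‖ ≤ R) ∧ w t = mildDeriv K u₀ (hamSource T' H w) t := by
  classical
  have hR : 0 ≤ Λ + 1 := by linarith
  obtain ⟨N, L, hN, hL, hNL⟩ := hH.exists_bound hR
  have h1 : 0 < 1 - 1 / α := by
    have : 1 / α < 1 := by rw [div_lt_one] <;> linarith
    linarith
  -- One smallness condition serves two purposes: the part with `N` keeps the ball invariant, the
  -- part with `L` gives the contraction.
  set Q : ℝ := c * (N + L) / (1 - 1 / α) with hQ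
  have hlim : Tendsto (fun t : ℝ => Q * t ^ (1 - 1 / α)) (𝓝[>] 0) (𝓝 0) := by
    have h2 := ((tendsto_nhdsWithin_of_tendsto_nhds (tendsto_id (α := ℝ))
        : Tendsto id (𝓝[>] (0 : ℝ)) (𝓝 0)).rpow_const (p := 1 - 1 / α)
        (Or.inr h1.le)).const_mul Q
    rw [Real.zero_rpow h1.ne', mul_zero] at h2
    exact h2
  obtain ⟨T₀, hT₀Q, hT₀⟩ := ((hlim.eventually (eventually_le_nhds (show (0 : ℝ) < 1 / 2 by
    norm_num))).and (Ioc_mem_nhdsGT hT)).exists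
  refine ⟨Λ + 1, N, T₀, hT₀, fun T' hT' => ?_⟩
  have hT'0 : 0 < T' := hT'.1
  have hT'T : T' ≤ T := hT'.2.trans hT₀.2
  have hsmall : ∀ t ∈ Ioc 0 T', c * (N + L) * (t ^ (1 - 1 / α) / (1 - 1 / α)) ≤ 1 / 2 := by
    intro t ht
    refine le_trans ?_ hT₀Q
    rw [hQ, div_mul_eq_mul_div, mul_div_assoc]
    have : t ^ (1 - 1 / α) ≤ T₀ ^ (1 - 1 / α) :=
      Real.rpow_le_rpow ht.1.le (ht.2.trans hT'.2) h1.le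
    gcongr
  have hfac : ∀ t ∈ Ioc 0 T', 0 ≤ t ^ (1 - 1 / α) / (1 - 1 / α) := fun t ht =>
    div_nonneg (Real.rpow_nonneg ht.1.le _) h1.le
  have hK' := hK.mono hT'T
  have hS' := hS.mono hT'T
  let S : Set (ℝ × E) := Ioc 0 T' ×ˢ univ
  -- The extension by zero is harmless, since `hamSource` is itself cut off outside `(0, T')`.
  let ext : (S → E →L[ℝ] ℝ) → ℝ → E → E →L[ℝ] ℝ := fun v s y =>
    if h : (s, y) ∈ S then v ⟨(s, y), h⟩ else 0
  have hext : ∀ (v : S → E →L[ℝ] ℝ) (q : S), ext v q.1.1 q.1.2 = v q := fun v q =>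
    dif_pos q.2
  -- The radius is `Λ` for the initial datum plus room for the Duhamel term, which is at most `1 /
  -- 2`.
  let X := Metric.closedBall (0 : BoundedContinuousFunction S (E →L[ℝ] ℝ)) (Λ + 1)
  have hXn : ∀ v : X, ∀ q, ‖v.1 q‖ ≤ Λ + 1 := fun v q =>
    (v.1.norm_coe_le_norm q).trans (mem_closedBall_zero_iff.1 v.2)
  have hXc : ∀ v : X, ContinuousOn (fun q : ℝ × E => ext v.1 q.1 q.2) (Ioc 0 T' ×ˢ univ) := by
    intro v
    rw [continuousOn_iff_continuous_domRestrict]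
    exact v.1.continuous.congr fun q => (hext v.1 q).symm
  have hXb : ∀ v : X, ∀ t ∈ Ioc 0 T', ∀ x, ‖ext v.1 t x‖ ≤ Λ + 1 := fun v t ht x => by
    rw [hext v.1 ⟨(t, x), ht, mem_univ _⟩]
    exact hXn v _
  have hsrc : ∀ v : X, IsSource T' N (hamSource T' H (ext v.1)) := fun v =>
    isSource_hamSource hT'T hH.1 (fun t ht x p hp => (hNL t ht x p hp).1) (hXc v) (hXb v)
  have hmap : ∀ v : X, ∃ v' : X, ∀ q : S,
      v'.1 q = mildDeriv K u₀ (hamSource T' H (ext v.1)) q.1.1 q.1.2 := by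
    intro v
    have hbc := fun t ht => isBC_mildDeriv (t := t) hT'0 hα hc hK' hS' hu₀ hΛ hl (hsrc v) ht
    have hcont := (unifContInTime_mild hT'0 hα hc hK' hS' hu₀ (hsrc v)).2.continuousOn
      (fun t ht => (hbc t ht).1)
    have hcont' : Continuous fun q : S =>
        mildDeriv K u₀ (hamSource T' H (ext v.1)) q.1.1 q.1.2 :=
      continuousOn_iff_continuous_domRestrict.1 hcont
    have hbd : ∀ q : S, ‖mildDeriv K u₀ (hamSource T' H (ext v.1)) q.1.1 q.1.2‖ ≤ Λ + 1 := by
      intro q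
      have ht : q.1.1 ∈ Ioc 0 T' := q.2.1
      refine ((hbc _ ht).2 _).trans ?_
      have h2 := hsmall _ ht
      have h3 := mul_nonneg (mul_nonneg hc hL) (hfac _ ht)
      linarith
    exact ⟨⟨BoundedContinuousFunction.ofNormedAddCommGroup _ hcont' (Λ + 1) hbd,
      mem_closedBall_zero_iff.2
        (BoundedContinuousFunction.norm_ofNormedAddCommGroup_le _ hR hbd)⟩, fun q => rfl⟩
  choose Φ hΦ using hmap
  have hcontr : ContractingWith (1 / 2) Φ := by
    refine ⟨by
      rw [← NNReal.coe_lt_coe]; norm_num, LipschitzWith.of_dist_le_mul fun v v' => ?_⟩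
    rw [Subtype.dist_eq, Subtype.dist_eq, BoundedContinuousFunction.dist_le (by positivity)]
    intro q
    have ht : q.1.1 ∈ Ioc 0 T' := q.2.1
    rw [dist_eq_norm, hΦ, hΦ]
    refine (norm_mildDeriv_sub_le hT'0 hα hc hK' hS' (hsrc v) (hsrc v')
      (D := L * dist v.1 v'.1) (fun s hs x => ?_) ht q.1.2).trans ?_
    · have hs' : s ∈ Ioc 0 T' := ⟨hs.1, hs.2.le⟩
      unfold hamSource
      rw [if_pos hs, if_pos hs]
      refine ((hNL s ⟨hs.1, hs.2.trans_le hT'T⟩ x _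
        (by rw [LinearIsometryEquiv.norm_map]; exact hXb v s hs' x)).2 _
        (by rw [LinearIsometryEquiv.norm_map]; exact hXb v' s hs' x)).trans ?_
      rw [← map_sub, LinearIsometryEquiv.norm_map,
        hext v.1 ⟨(s, x), hs', mem_univ _⟩, hext v'.1 ⟨(s, x), hs', mem_univ _⟩, ← dist_eq_norm]
      exact mul_le_mul_of_nonneg_left (BoundedContinuousFunction.dist_coe_le_dist _) hL
    · have h2 := hsmall _ ht
      have h3 := mul_nonneg (mul_nonneg hc hN) (hfac _ ht)
      have h4 : c * L * (q.1.1 ^ (1 - 1 / α) / (1 - 1 / α)) ≤ 1 / 2 := by linarith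
      have h5 := mul_le_mul_of_nonneg_right h4 (dist_nonneg (x := v.1) (y := v'.1))
      have h6 : ((1 / 2 : NNReal) : ℝ) = 1 / 2 := by norm_num
      rw [h6]
      linarith
  have hcompl : CompleteSpace X := Metric.isClosed_closedBall.completeSpace_coe
  obtain ⟨v, hfix, -⟩ := hcontr.exists_fixedPoint ⟨0, Metric.mem_closedBall_self hR⟩
    (edist_ne_top _ _)
  refine ⟨ext v.1, hsrc v, fun t ht => ⟨hXb v t ht, funext fun x => ?_⟩⟩
  have h2 := hΦ v ⟨(t, x), ht, mem_univ _⟩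
  rw [hfix.eq] at h2
  rw [hext v.1 ⟨(t, x), ht, mem_univ _⟩, h2]

end Mild

/-! ### Regularity of mild solutions -/

section Regularity

variable {E : Type} [NormedAddCommGroup E] [InnerProductSpace ℝ E] [FiniteDimensional ℝ E]
  [MeasurableSpace E] [BorelSpace E]
  {T T₁ α β c t N M Λ R : ℝ} {K : ℝ → Measure E} {u₀ : E → ℝ} {H : ℝ → E → E → ℝ}
  {w : ℝ → E → E →L[ℝ] ℝ}

/-- The source `H(s, y, Du(s, y))` of a mild solution is Hölder in space. -/
lemma exists_holderSource (hT : 0 < T) (hTT : T ≤ T₁) (hα : 1 < α) (hc : 0 ≤ c) (hβ : 0 ≤ β)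
    (hβ1 : β ≤ 1) (hK : IsHeatFlow T K) (hS : Smooths T α c K (ContinuousLinearMap.id ℝ E))
    (hu₀ : IsBC M u₀) (hΛ : 0 ≤ Λ) (hl : ∀ x y, ‖u₀ x - u₀ y‖ ≤ Λ * ‖x - y‖) (hR : 0 ≤ R)
    (hH : HamiltonianLip T₁ H) (hHx : HamiltonianHolder T₁ β H)
    (hg : IsSource T N (hamSource T H w)) (hwR : ∀ t ∈ Ioc 0 T, ∀ x, ‖w t x‖ ≤ R)
    (hw : ∀ t ∈ Ioc 0 T, w t = mildDeriv K u₀ (hamSource T H w) t) :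
    ∃ C, 0 ≤ C ∧
      IsHolderSource T C (1 / α) β (ContinuousLinearMap.id ℝ E) (hamSource T H w) := by
  have hN : 0 ≤ N := (hg.bc (T / 2) ⟨by linarith, by linarith⟩).nonneg
  obtain ⟨N', L, hN', hL, hNL⟩ := hH.exists_bound hR
  obtain ⟨m, hm, hHm⟩ := hHx (R + 1) (by linarith)
  set κ := 1 / α with hκdef
  have hκ : 0 ≤ κ := by positivity
  have hκ1 : κ < 1 := by rw [hκdef, div_lt_one] <;> linarith
  have h1κ : 0 < 1 - κ := by linarith
  obtain ⟨C₀, hC₀, hgron⟩ := singular_gronwall (T := T) hκ hκ1 hc hL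
  -- The first summand comes from the Lipschitz datum, the second from the `x`-dependence of `H`,
  -- where `t ^ (1 - κ) ≤ T * t ^ (-κ)` is used.
  set A₀ : ℝ := c * Λ + c * m * (T / (1 - κ)) with hA₀
  have hA₀0 : 0 ≤ A₀ := by positivity
  -- Through the intermediate value `H(s, x, Du(s, x + η))`, the increment splits into one in the
  -- position and one in the gradient; the latter is the unknown in Gronwall's inequality.
  have hinc : ∀ η : E, ‖η‖ < 1 → ∀ s ∈ Ioo 0 T, ∀ x,
      ‖hamSource T H w s (x + η) - hamSource T H w s x‖ ≤
        m * ‖η‖ ^ β + L * ‖w s (x + η) - w s x‖ := by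
    intro η hη s hs x
    have hs' : s ∈ Ioc 0 T := ⟨hs.1, hs.2.le⟩
    have hs₁ : s ∈ Ioo 0 T₁ := ⟨hs.1, hs.2.trans_le hTT⟩
    have hn : ∀ y, ‖(InnerProductSpace.toDual ℝ E).symm (w s y)‖ ≤ R := fun y => by
      rw [LinearIsometryEquiv.norm_map]; exact hwR s hs' y
    unfold hamSource
    rw [if_pos hs, if_pos hs]
    have h1 := hHm s ⟨hs.1.le, hs₁.2.le⟩ ((InnerProductSpace.toDual ℝ E).symm (w s (x + η)))
      (by rw [mem_ball_zero_iff]; linarith [hn (x + η)]) (x + η) x (by simpa using hη)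
    have h2 := (hNL s hs₁ x _ (hn (x + η))).2 _ (hn x)
    rw [← map_sub, LinearIsometryEquiv.norm_map] at h2
    rw [add_sub_cancel_left] at h1
    exact (abs_sub_le _ _ _).trans (add_le_add h1 h2)
  have hpow : ∀ η : E, ‖η‖ < 1 → ‖η‖ ≤ ‖η‖ ^ β := fun η hη => by
    rcases (norm_nonneg η).eq_or_lt with h | h
    · rw [← h]; exact Real.rpow_nonneg le_rfl _
    · simpa using Real.rpow_le_rpow_of_exponent_ge h hη.le hβ1
  obtain ⟨-, hq⟩ := hg.isDuhamelFamily_dirFDeriv hT hc hK hS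
  have hwη : ∀ η : E, ‖η‖ < 1 → ∀ t ∈ Ioc 0 T, ∀ x,
      ‖w t (x + η) - w t x‖ ≤ C₀ * (A₀ * ‖η‖ ^ β) * t ^ (-κ) := by
    intro η hη
    have hηβ : 0 ≤ ‖η‖ ^ β := Real.rpow_nonneg (norm_nonneg _) _
    -- The a priori bound `2 * R` comes from the boundedness of `Du`.
    refine hgron (fun t x => ‖w t (x + η) - w t x‖) _ (2 * R) (by positivity)
      (fun t ht x => ⟨norm_nonneg _, (norm_sub_le _ _).trans
        (by linarith [hwR t ht (x + η), hwR t ht x])⟩) fun D t ht hD hDi x => ?_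
    have hp : 0 ≤ t ^ (-κ) := Real.rpow_nonneg ht.1.le _
    have i1 := hq.integrableOn le_rfl zero_lt_one hκ hκ1 ht
    have i3 : IntegrableOn (fun s => (t - s) ^ (-κ)) (Ioo 0 t) :=
      integrableOn_comp_sub_left (integrableOn_rpow_neg hκ1 t)
    have hfirst := hS.norm_dirFDeriv_shift_le hK hu₀ η (D := Λ * ‖η‖)
      (fun x => by simpa using hl (x + η) x) ht x
    have hsecond : ‖duhamel (fun s r => dirFDeriv (ContinuousLinearMap.id ℝ E)
          (convFun (K r) (hamSource T H w s))) t (x + η) -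
        duhamel (fun s r => dirFDeriv (ContinuousLinearMap.id ℝ E)
          (convFun (K r) (hamSource T H w s))) t x‖ ≤
        c * m * ‖η‖ ^ β * (t ^ (1 - κ) / (1 - κ)) +
          c * ∫ s in Ioo 0 t, L * (D s * (t - s) ^ (-κ)) := by
      unfold duhamel
      rw [← integral_sub (i1 _) (i1 _), ← setIntegral_rpow_neg hκ1 ht.1.le,
        ← setIntegral_comp_sub_left (fun r => r ^ (-κ)), ← integral_const_mul,
        ← integral_const_mul, ← integral_add (i3.const_mul _) ((hDi.const_mul L).const_mul c)]
      refine norm_integral_le_of_norm_le ((i3.const_mul _).add ((hDi.const_mul L).const_mul c))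
        ((ae_restrict_iff' measurableSet_Ioo).2 (Eventually.of_forall fun s hs => ?_))
      have hsT := mem_Ioo_of_mem_Ioo_Ioc ht hs
      have h2 := hS.norm_dirFDeriv_shift_le hK (hg.bc s hsT) η (D := m * ‖η‖ ^ β + L * D s)
        (fun y => (hinc η hη s hsT y).trans
          (add_le_add le_rfl (mul_le_mul_of_nonneg_left (hD s hs y) hL))) (sub_mem_Ioc ht hs) x
      refine h2.trans (le_of_eq ?_)
      rw [← hκdef]
      ring
    have htk : t ^ (1 - κ) = t * t ^ (-κ) := by
      rw [sub_eq_add_neg, Real.rpow_add ht.1, Real.rpow_one]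
    have h4 : c * m * ‖η‖ ^ β * (t ^ (1 - κ) / (1 - κ)) ≤
        c * m * (T / (1 - κ)) * ‖η‖ ^ β * t ^ (-κ) := by
      rw [htk]
      have h5 : t * t ^ (-κ) / (1 - κ) ≤ T / (1 - κ) * t ^ (-κ) := by
        rw [div_mul_eq_mul_div]
        exact div_le_div_of_nonneg_right (mul_le_mul_of_nonneg_right ht.2 hp) h1κ.le
      calc _ ≤ c * m * ‖η‖ ^ β * (T / (1 - κ) * t ^ (-κ)) :=
            mul_le_mul_of_nonneg_left h5 (by positivity)
        _ = _ := by ring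
    have h6 : c * t ^ (-κ) * (Λ * ‖η‖) ≤ c * Λ * ‖η‖ ^ β * t ^ (-κ) := by
      calc _ = c * Λ * t ^ (-κ) * ‖η‖ := by ring
        _ ≤ c * Λ * t ^ (-κ) * ‖η‖ ^ β := mul_le_mul_of_nonneg_left (hpow η hη) (by positivity)
        _ = _ := by ring
    have hsum : ∀ y, w t y = dirFDeriv (ContinuousLinearMap.id ℝ E) (convFun (K t) u₀) y +
        duhamel (fun s r => dirFDeriv (ContinuousLinearMap.id ℝ E)
          (convFun (K r) (hamSource T H w s))) t y := fun y => congrFun (hw t ht) y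
    rw [hsum (x + η), hsum x, add_sub_add_comm]
    refine (norm_add_le _ _).trans ((add_le_add hfirst hsecond).trans ?_)
    rw [← hκdef, hA₀]
    linarith
  have hTκ : 0 ≤ T ^ κ := by positivity
  -- The first two summands are the two parts of the increment for `‖η‖ < 1`; the third covers `‖η‖
  -- ≥ 1`, where boundedness suffices. The factors `T ^ κ` absorb the missing weight `s ^ (-κ) ≥ T ^
  -- (-κ)`.
  refine ⟨m * T ^ κ + L * (C₀ * A₀) + 2 * N * T ^ κ, by positivity, fun s hs x η => ?_⟩
  have hs' : s ∈ Ioc 0 T := ⟨hs.1, hs.2.le⟩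
  have hsκ : 0 ≤ s ^ (-κ) := Real.rpow_nonneg hs.1.le _
  have hηβ : 0 ≤ ‖η‖ ^ β := Real.rpow_nonneg (norm_nonneg _) _
  have h1 : 1 ≤ T ^ κ * s ^ (-κ) := by
    rw [Real.rpow_neg hs.1.le, ← div_eq_mul_inv, one_le_div (Real.rpow_pos_of_pos hs.1 _)]
    exact Real.rpow_le_rpow hs.1.le hs.2.le hκ
  simp only [ContinuousLinearMap.id_apply]
  have n1 : 0 ≤ m * T ^ κ * s ^ (-κ) * ‖η‖ ^ β := by positivity
  have n2 : 0 ≤ L * (C₀ * A₀) * s ^ (-κ) * ‖η‖ ^ β := by positivity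
  have n3 : 0 ≤ 2 * N * T ^ κ * s ^ (-κ) * ‖η‖ ^ β := by positivity
  rcases lt_or_ge ‖η‖ 1 with hη | hη
  · have h2 := hinc η hη s hs x
    have h3 := mul_le_mul_of_nonneg_left (hwη η hη s hs' x) hL
    have h4 := mul_le_mul_of_nonneg_left h1 (mul_nonneg hm.le hηβ)
    linarith
  · have h2 : 1 ≤ ‖η‖ ^ β := Real.one_le_rpow hη hβ
    have h3 : 1 ≤ T ^ κ * s ^ (-κ) * ‖η‖ ^ β := one_le_mul_of_one_le_of_one_le h1 h2
    have h4 := mul_le_mul_of_nonneg_left h3 (show 0 ≤ 2 * N by positivity)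
    have h5 := norm_sub_le (hamSource T H w s (x + η)) (hamSource T H w s x)
    linarith [(hg.bc s hs).2 (x + η), (hg.bc s hs).2 x]

lemma UnifContInTime.of_memCC1 {u : ℝ → E → ℝ} (hu : MemCC1 T u) :
    UnifContInTime T (fun t => fderiv ℝ (u t)) := by
  have hd : ∀ t ∈ Ioc 0 T, Differentiable ℝ (u t) := fun t ht => by
    obtain ⟨C, hC⟩ := hu.1 t ht
    exact (cbBound_one_iff.1 hC).1.differentiable (by norm_num)
  intro t ht ε hε
  filter_upwards [hu.2 t ht ε hε, self_mem_nhdsWithin] with s hs hsT x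
  have := (cbBound_one_iff.1 hs).2.2 x
  rwa [fderiv_fun_sub (hd s hsT x) (hd t ht x)] at this

lemma memCbC1_of_hasDirFDeriv {u : ℝ → E → ℝ} {u' : ℝ → E → E →L[ℝ] ℝ} {C C' : ℝ}
    (hu : ∀ t ∈ Ioc 0 T, IsBC C (u t)) (hu' : ∀ t ∈ Ioc 0 T, IsBC C' (u' t))
    (hd : ∀ t ∈ Ioc 0 T, HasDirFDeriv (ContinuousLinearMap.id ℝ E) (u t) (u' t))
    (hc : UnifContInTime T u) (hc' : UnifContInTime T u') : MemCbC1 T u := by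
  have hder : ∀ t ∈ Ioc 0 T, ∀ x, HasFDerivAt (u t) (u' t x) x := fun t ht =>
    hasDirFDeriv_id_iff.1 (hd t ht)
  have hfd : ∀ t ∈ Ioc 0 T, fderiv ℝ (u t) = u' t := fun t ht =>
    funext fun x => (hder t ht x).fderiv
  have hcd : ∀ t ∈ Ioc 0 T, ContDiff ℝ 1 (u t) := fun t ht => by
    rw [contDiff_one_iff_fderiv, hfd t ht]
    exact ⟨fun x => (hder t ht x).differentiableAt, (hu' t ht).1⟩
  have hb : ∀ t ∈ Ioc 0 T, CbBound 1 (max C C') (u t) := fun t ht =>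
    cbBound_one_iff.2 ⟨hcd t ht, fun x => ((hu t ht).2 x).trans (le_max_left _ _), fun x => by
      rw [hfd t ht]; exact ((hu' t ht).2 x).trans (le_max_right _ _)⟩
  refine ⟨⟨fun t ht => ⟨_, hb t ht⟩, fun t ht ε hε => ?_⟩, _, hb⟩
  filter_upwards [hc t ht ε hε, hc' t ht ε hε, self_mem_nhdsWithin] with s h1 h2 hs
  refine cbBound_one_iff.2 ⟨(hcd s hs).sub (hcd t ht), h1, fun x => ?_⟩
  rw [((hder s hs x).fun_sub (hder t ht x)).fderiv]
  exact h2 x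

end Regularity

/-! ### Mild solutions as values of `mildMap` -/

section MildSolutions

variable {ι : Type} [Fintype ι] {L : LevyTriplet ι} {T t : ℝ}
  {H : ℝ → EuclideanSpace ℝ ι → EuclideanSpace ℝ ι → ℝ} {u : ℝ → EuclideanSpace ℝ ι → ℝ}
  {w : ℝ → EuclideanSpace ℝ ι → EuclideanSpace ℝ ι →L[ℝ] ℝ} {u₀ : EuclideanSpace ℝ ι → ℝ}

lemma semigroup_eq_convFun_hamSource (hw : ∀ s ∈ Ioc 0 T, fderiv ℝ (u s) = w s)
    {s : ℝ} (hs : s ∈ Ioo 0 T) (r : ℝ) (x : EuclideanSpace ℝ ι) :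
    L.semigroup r (fun y => H s y (gradient (u s) y)) x =
      convFun (L.heatMeasure r) (hamSource T H w s) x := by
  have : hamSource T H w s = fun y => H s y (gradient (u s) y) := funext fun y => by
    unfold hamSource
    rw [if_pos hs, ← hw s ⟨hs.1, hs.2.le⟩]
    rfl
  rw [this]
  rfl

lemma semigroup_add_integral_eq_mildMap (hw : ∀ s ∈ Ioc 0 T, fderiv ℝ (u s) = w s)
    (ht : t ∈ Ioc 0 T) (x : EuclideanSpace ℝ ι) :
    L.semigroup t u₀ x +
      ∫ s in (0 : ℝ)..t, L.semigroup (t - s) (fun y => H s y (gradient (u s) y)) x =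
      mildMap L.heatMeasure u₀ (hamSource T H w) t x := by
  rw [intervalIntegral.integral_of_le ht.1.le, integral_Ioc_eq_integral_Ioo]
  refine congrArg₂ _ rfl (setIntegral_congr_fun measurableSet_Ioo fun s hs => ?_)
  exact semigroup_eq_convFun_hamSource hw (mem_Ioo_of_mem_Ioo_Ioc ht hs) _ x

lemma isMildSolution_of_eq_mildMap {N : ℝ} (hT : 0 < T) (hK : IsHeatFlow T L.heatMeasure)
    (hg : IsSource T N (hamSource T H w)) (hw : ∀ s ∈ Ioc 0 T, fderiv ℝ (u s) = w s)
    (hu : MemCC1 T u)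
    (heq : ∀ t ∈ Ioc 0 T, u t = mildMap L.heatMeasure u₀ (hamSource T H w) t) :
    IsMildSolution L T H u₀ u := by
  refine ⟨hu, fun t ht x => ⟨?_, ?_⟩⟩
  · rw [intervalIntegrable_iff_integrableOn_Ioo_of_le ht.1.le]
    have h := (hg.isDuhamelFamily hT hK).integrableOn le_rfl zero_lt_one le_rfl zero_lt_one ht x
    refine IntegrableOn.congr_fun h (fun s hs => ?_) measurableSet_Ioo
    exact (semigroup_eq_convFun_hamSource hw (mem_Ioo_of_mem_Ioo_Ioc ht hs) _ x).symm
  · rw [semigroup_add_integral_eq_mildMap hw ht, heq t ht]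

end MildSolutions

/-! ### The theorem -/

lemma exists_nat_between {γ : ℝ} (h1 : 1 < γ) (h3 : γ ≤ 3) (hn : ∀ n : ℕ, γ ≠ n) :
    ∃ n : ℕ, (n = 1 ∨ n = 2) ∧ (n : ℝ) < γ ∧ γ < n + 1 := by
  have h2 : γ ≠ 2 := by exact_mod_cast hn 2
  have h3' : γ ≠ 3 := by exact_mod_cast hn 3
  rcases lt_or_gt_of_ne h2 with h | h
  · exact ⟨1, Or.inl rfl, by simpa using h1, by norm_num; linarith⟩
  · exact ⟨2, Or.inr rfl, by simpa using h, by norm_num; exact lt_of_le_of_ne h3 h3'⟩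

theorem mainTheorem10 (d₁ d₂ : ℕ) (T α₁ α₂ β : ℝ) (hT : 0 < T)
    (hα₂ : 1 < α₂) (hα : α₂ ≤ α₁) (hα₁ : α₁ ≤ 2) (hβ₀ : 0 ≤ β) (hβ₁ : β ≤ 1)
    (L₁ : LevyTriplet (Fin d₁)) (L₂ : LevyTriplet (Fin d₂))
    (hL₁ : L₁.HasOrder T α₁) (hL₂ : L₂.HasOrder T α₂)
    (H : ℝ → EuclideanSpace ℝ (Fin d₁ ⊕ Fin d₂) → EuclideanSpace ℝ (Fin d₁ ⊕ Fin d₂) → ℝ)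
    (hH : HamiltonianLip T H) (hHx : HamiltonianHolder T β H)
    (u₀ : EuclideanSpace ℝ (Fin d₁ ⊕ Fin d₂) → ℝ)
    (hu₀_bdd : ∃ C : ℝ, ∀ x, |u₀ x| ≤ C) (hu₀_lip : ∃ K, LipschitzWith K u₀) :
    -- existence of a mild solution for all sufficiently small times
    (∃ T₀ ∈ Ioc 0 T, ∀ T' ∈ Ioc 0 T₀, ∃ u : ℝ → EuclideanSpace ℝ (Fin d₁ ⊕ Fin d₂) → ℝ,
      IsMildSolution (L₁.directSum L₂) T' H u₀ u ∧ MemCbC1 T' u) ∧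
    -- regularity of every such solution
    (∀ T' ∈ Ioc 0 T, ∀ u : ℝ → EuclideanSpace ℝ (Fin d₁ ⊕ Fin d₂) → ℝ,
      IsMildSolution (L₁.directSum L₂) T' H u₀ u → MemCbC1 T' u →
      (∀ n : ℕ, α₂ + β ≠ n) →
        (∀ t ∈ Ioc 0 T', MemCbHolder (α₂ + β) (u t)) ∧
        ((∀ n : ℕ, α₁ + β ≠ n) → ∀ t ∈ Ioc 0 T', ∃ C : ℝ, ∀ x₂ : EuclideanSpace ℝ (Fin d₂),
          HolderBound (α₁ + β) C (fun x₁ => u t (pairPt x₁ x₂)))) := by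
  obtain ⟨M, hM⟩ := hu₀_bdd
  obtain ⟨Λ, hΛ⟩ := hu₀_lip
  have hu₀ : IsBC M u₀ := ⟨hΛ.continuous, hM⟩
  have hl : ∀ x y, ‖u₀ x - u₀ y‖ ≤ (Λ : ℝ) * ‖x - y‖ := fun x y => by
    simpa [dist_eq_norm] using hΛ.dist_le_mul x y
  have hΛ0 : (0 : ℝ) ≤ Λ := Λ.2
  have hα₁' : 1 < α₁ := hα₂.trans_le hα
  -- the heat flow and its smoothing properties
  have hsum : ∀ t ∈ Icc 0 T, (L₁.directSum L₂).IsHeatMeasure t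
      ((L₁.heatMeasure t).map inlL ∗ (L₂.heatMeasure t).map inrL) := fun t ht =>
    (hL₁.isHeatMeasure ht).directSum (hL₂.isHeatMeasure ht)
  have hheat : ∀ t ∈ Icc 0 T, (L₁.directSum L₂).IsHeatMeasure t
      ((L₁.directSum L₂).heatMeasure t) := fun t ht => (hsum t ht).heatMeasure
  have hKeq : ∀ t ∈ Ioc 0 T, (L₁.directSum L₂).heatMeasure t =
      (L₁.heatMeasure t).map inlL ∗ (L₂.heatMeasure t).map inrL := fun t ht =>
    (hheat t ⟨ht.1.le, ht.2⟩).unique (hsum t ⟨ht.1.le, ht.2⟩)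
  have hp₁ : ∀ t ∈ Ioc 0 T, IsProbabilityMeasure ((L₁.heatMeasure t).map
      (inlL : _ →L[ℝ] EuclideanSpace ℝ (Fin d₁ ⊕ Fin d₂))) := fun t ht => by
    have := (hL₁.isHeatMeasure ⟨ht.1.le, ht.2⟩).1
    exact LevyTriplet.isProbabilityMeasure_map_clm _ _
  have hp₂ : ∀ t ∈ Ioc 0 T, IsProbabilityMeasure ((L₂.heatMeasure t).map
      (inrL : _ →L[ℝ] EuclideanSpace ℝ (Fin d₁ ⊕ Fin d₂))) := fun t ht => by
    have := (hL₂.isHeatMeasure ⟨ht.1.le, ht.2⟩).1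
    exact LevyTriplet.isProbabilityMeasure_map_clm _ _
  have hK := LevyTriplet.isHeatFlow_of_isHeatMeasure hT hheat
  set K := (L₁.directSum L₂).heatMeasure with hKdef
  obtain ⟨c₁, hc₁, S₁⟩ := smooths_of_hasOrder hL₁ inlL hp₂ hKeq
  -- For the second group of variables the two convolution factors exchange roles.
  obtain ⟨c₂, hc₂, S₂⟩ := smooths_of_hasOrder hL₂ inrL hp₁ (K := K) (fun t ht => by
    have := hp₁ t ht
    have := hp₂ t ht
    rw [hKeq t ht, Measure.conv_comm])
  obtain ⟨c, hc, S⟩ := Smooths.id_of_partial (by linarith) hα hc₁ hc₂ S₁ S₂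
  constructor
  · obtain ⟨R, N, T₀, hT₀, h⟩ := exists_fixedPoint hT hα₂ hc.le hK S hu₀ hΛ0 hl hH
    refine ⟨T₀, hT₀, fun T' hT' => ?_⟩
    obtain ⟨w, hg, hw⟩ := h T' hT'
    have hT'T : T' ≤ T := hT'.2.trans hT₀.2
    have hK' := hK.mono hT'T
    have S' := S.mono hT'T
    have hd := fun t ht => hasDirFDeriv_mildMap (t := t) hT'.1 hα₂ hc.le hK' S' hu₀ hg ht
    have hun := unifContInTime_mild hT'.1 hα₂ hc.le hK' S' hu₀ hg
    -- The bound for the gradient is taken from the fixed point, since `R` does not depend on `t`.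
    have hmem : MemCbC1 T' (mildMap K u₀ (hamSource T' H w)) :=
      memCbC1_of_hasDirFDeriv (C' := R) (fun t ht => isBC_mildMap hT'.1 hK' hu₀ hg ht)
        (fun t ht => ⟨(isBC_mildDeriv hT'.1 hα₂ hc.le hK' S' hu₀ hΛ0 hl hg ht).1, fun x => by
          rw [← (hw t ht).2]; exact (hw t ht).1 x⟩) hd hun.1 hun.2
    refine ⟨mildMap K u₀ (hamSource T' H w), ?_, hmem⟩
    refine isMildSolution_of_eq_mildMap hT'.1 hK' hg (fun s hs => ?_) hmem.1 fun t _ => rfl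
    rw [(hw s hs).2]
    exact funext fun x => (hasDirFDeriv_id_iff.1 (hd s hs) x).fderiv
  · intro T' hT' u hu huC hn₂
    have hT'T : T' ≤ T := hT'.2
    have hK' := hK.mono hT'T
    obtain ⟨R, hR⟩ := huC.2
    set w : ℝ → EuclideanSpace ℝ (Fin d₁ ⊕ Fin d₂) →
      EuclideanSpace ℝ (Fin d₁ ⊕ Fin d₂) →L[ℝ] ℝ := fun t => fderiv ℝ (u t) with hwdef
    have hwR : ∀ t ∈ Ioc 0 T', ∀ x, ‖w t x‖ ≤ R := fun t ht =>
      (cbBound_one_iff.1 (hR t ht)).2.2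
    have hR0 : 0 ≤ R := (norm_nonneg _).trans (hwR T' ⟨hT'.1, le_rfl⟩ 0)
    have hwc : ContinuousOn (fun q : ℝ × EuclideanSpace ℝ (Fin d₁ ⊕ Fin d₂) => w q.1 q.2)
        (Ioc 0 T' ×ˢ univ) :=
      (UnifContInTime.of_memCC1 hu.1).continuousOn fun t ht =>
        (cbBound_one_iff.1 (hR t ht)).1.continuous_fderiv (by norm_num)
    obtain ⟨N, _, _, _, hN⟩ := hH.exists_bound hR0
    have hg : IsSource T' N (hamSource T' H w) :=
      isSource_hamSource hT'T hH.1 (fun t ht x p hp => (hN t ht x p hp).1) hwc hwR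
    have heq : ∀ t ∈ Ioc 0 T', u t = mildMap K u₀ (hamSource T' H w) t := fun t ht =>
      funext fun x => by
        rw [(hu.2 t ht x).2]
        exact semigroup_add_integral_eq_mildMap (fun s _ => rfl) ht x
    -- Differentiating the mild formula gives a closed equation for `Du`, to which the Gronwall
    -- argument applies.
    have hw : ∀ t ∈ Ioc 0 T', w t = mildDeriv K u₀ (hamSource T' H w) t := fun t ht => by
      funext x
      have hd := hasDirFDeriv_mildMap hT'.1 hα₂ hc.le hK' (S.mono hT'T) hu₀ hg ht
      rw [← heq t ht] at hd
      exact (hasDirFDeriv_id_iff.1 hd x).fderiv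
    obtain ⟨C, hC, hgC⟩ := exists_holderSource hT'.1 hT'T hα₂ hc.le hβ₀ hβ₁ hK' (S.mono hT'T)
      hu₀ hΛ0 hl hR0 hH hHx hg hwR hw
    have hκ : 0 ≤ 1 / α₂ := by positivity
    have hκ1 : 1 / α₂ < 1 := by rw [div_lt_one] <;> linarith
    refine ⟨fun t ht => ?_, fun hn₁ t ht => ?_⟩
    · obtain ⟨n, hn, h1, h2⟩ := exists_nat_between (by linarith) (by linarith) hn₂
      obtain ⟨B, hB⟩ := (isDirHolder_of_holderSource hT'.1 hα₂ hc.le hβ₀ hβ₁ hκ hκ1 hC hK'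
        (S.mono hT'T) hu₀ hg hgC n hn h1 h2 ht).holderBound h1 h2
      refine ⟨B, ?_⟩
      rw [heq t ht]
      have h0 := hB 0
      simp only [ContinuousLinearMap.id_apply, zero_add] at h0
      exact h0
    · obtain ⟨n, hn, h1, h2⟩ := exists_nat_between (by linarith) (by linarith) hn₁
      -- The orders decouple: the singular weight keeps the exponent `1 / α₂` of the full gradient,
      -- while the smoothing along `x₁` has order `α₁`.
      have hgC' : IsHolderSource T' C (1 / α₂) β
          (inlL : EuclideanSpace ℝ (Fin d₁) →L[ℝ] EuclideanSpace ℝ (Fin d₁ ⊕ Fin d₂))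
          (hamSource T' H w) := fun s hs x v => by
        have := hgC s hs x (inlL v)
        rwa [ContinuousLinearMap.id_apply, inlL_apply, norm_pairPt_left] at this
      obtain ⟨B, hB⟩ := (isDirHolder_of_holderSource hT'.1 hα₁' hc₁.le hβ₀ hβ₁ hκ hκ1 hC hK'
        (S₁.mono hT'T) hu₀ hg hgC' n hn h1 h2 ht).holderBound h1 h2
      refine ⟨B, fun x₂ => ?_⟩
      -- The slice is `u t` along `inlL` from the base point `(0, x₂)`; the constant `B` was chosen
      -- before the base point.
      have hpair : (fun x₁ => u t (pairPt x₁ x₂)) = fun x₁ =>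
          convFun (K t) u₀ (inrL x₂ + inlL x₁) +
            duhamel (fun s r => convFun (K r) (hamSource T' H w s)) t (inrL x₂ + inlL x₁) := by
        funext x₁
        rw [heq t ht, pairPt_eq, add_comm]
        rfl
      rw [hpair]
      exact hB (inrL x₂)
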